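/- **Setting.** Write $[n]=\{0,\dots,n-1\}$ and, for $u,v\in\mathbb Z^2$, $u=(u.x,u.y)$, $u\times v=u.x\,v.y-u.y\,v.x$ and $|u|$ for the Euclidean length. A (two-dimensional) string is a partial function $S:\mathbb Z^2\rightharpoonup\mathbb Z$ with domain $\operatorname{dom}(S)$; $S+q$ is the string with domain $\operatorname{dom}(S)+q$ and $(S+q)(v)=S(v-q)$; $\mathrm{Ham}(S,R)$ is the number of $u\in\operatorname{dom}(S)\cap\operatorname{dom}(R)$ with $S(u)\ne R(u)$. A string $S$ is monochromatic with character $\mathrm{chr}(S)$ if $S(u)=\mathrm{chr}(S)$ for all $u\in\operatorname{dom}(S)$. Let $1\le m\le n\le\frac32 m$, and let $P$ and $T$ be strings with $\operatorname{dom}(P)=[m]^2$ and $\operatorname{dom}(T)=[n]^2$. Let $Q\subset\mathbb Z^2$ be a finite set with $\operatorname{dom}(P+q)\subseteq\operatorname{dom}(T)$ for all $q\in Q$. Let $\psi\in(0,\infty)\times[0,\infty)$ and $\phi\in[0,\infty)\times(-\infty,0)$ be integer vectors whose coordinates have absolute value at most $n-m$ and whose angle $\alpha$ satisfies $\sin\alpha\ge\frac12$.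 A *tile* is a set $\{u\in\mathbb Z^2:\phi_0\le\phi\times u\le\phi_1,\ \psi_0\le\psi\times u\le\psi_1\}$ with $\phi_0,\phi_1,\psi_0,\psi_1\in\mathbb Z$. A *truncated tile* is the intersection of a tile with a possibly unbounded rectangle $[x_0,x_1]\times[y_0,y_1]$ such that $x_1-x_0+1\ge|\phi.x|+|\psi.x|$ and $y_1-y_0+1\ge|\phi.y|+|\psi.y|$. A *(truncated) subtile* is the set of all points $u$ of a (truncated) tile with $u-\gamma\in\mathbb Z\phi+\mathbb Z\psi$, for some $\gamma\in\mathbb Z^2$. A *(truncated) subtile string* is a string whose domain is a (truncated) subtile. Let $\mathcal V$ be a finite set of monochromatic truncated subtile strings that partition $P$ (their domains are pairwise disjoint with union $\operatorname{dom}(P)$, and they agree with $P$), and let $\mathcal V_a=\{V\in\mathcal V:\mathrm{chr}(V)=a\}$. **Theorem.** Let $\mathcal S$ be a finite set of monochromatic subtile strings whose domains are pairwise disjoint subsets of $\operatorname{dom}(T)$. There is an algorithm which, given $m,n,\phi,\psi,\mathcal V,\mathcal S,Q$, computes $\sum_{S\in\mathcal S}\mathrm{Ham}(P+q,S)$ for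 all $q\in Q$ in total time $$\tilde{\mathcal O}\Bigl(m^2+\sum_{S\in\mathcal S}|\mathcal V_{\mathrm{chr}(S)}|\Bigr).$$ Precisely: there are one word-RAM program and constants $K,C,c\in\mathbb N$ such that for all data as above and every word length $w\ge K(\lfloor\log_2 n\rfloor+1)$ such that all characters of strings in $\mathcal V$ and $\mathcal S$ fit into signed $w$-bit words, the program, started with $m,n,\phi,\psi,\mathcal V,\mathcal S,Q$ in memory (strings being stored as lists of point-character pairs, all lists and sets in arbitrary order), halts after at most $C\,(m^2+\sum_{S\in\mathcal S}|\mathcal V_{\mathrm{chr}(S)}|)\,(\lfloor\log_2 n\rfloor+1)^c$ steps, with the values $\sum_{S\in\mathcal S}\mathrm{Ham}(P+q,S)$, for $q\in Q$ in the order in which $Q$ was given, in the memory cells $0,1,\dots,|Q|-1$. -/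

import Mathlib

namespace HamTwoD

/-! ## Plane geometry and two-dimensional strings -/

/-- Points of the integer plane; `u.1` and `u.2` are the two coordinates. -/
abbrev Pt := ℤ × ℤ

/-- The cross product `u × v`. -/
def cross (u v : Pt) : ℤ := u.1 * v.2 - u.2 * v.1

/-- The Euclidean length of a vector. -/
noncomputable def len (u : Pt) : ℝ := Real.sqrt ((u.1 : ℝ) ^ 2 + (u.2 : ℝ) ^ 2)

/-- The sine of the (unoriented) angle between two nonzero vectors. -/
noncomputable def sinAngle (u v : Pt) : ℝ := |(cross u v : ℝ)| / (len u * len v)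

/-- The square grid `[n] × [n]`, where `[n] = {0, …, n - 1}`. -/
def grid (n : ℕ) : Set Pt := {u | 0 ≤ u.1 ∧ u.1 < n ∧ 0 ≤ u.2 ∧ u.2 < n}

/-- A two-dimensional string: a partial function from the integer plane to characters. -/
abbrev Str := Pt → Option ℤ

/-- The domain of a string. -/
def dom (S : Str) : Set Pt := {u | ∃ a, S u = some a}

/-- The mismatches between two strings. -/
def mismatches (S R : Str) : Set Pt := {u | ∃ a b, S u = some a ∧ R u = some b ∧ a ≠ b}

/-- The Hamming distance (used for strings with finitely many mismatches). -/
noncomputable def ham (S R : Str) : ℕ := (mismatches S R).ncard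

/-- The shifted string `S + q`. -/
def shift (S : Str) (q : Pt) : Str := fun v => S (v - q)

/-- The string `S` carries the character `a` at every point of its domain. -/
def MonochromaticWith (S : Str) (a : ℤ) : Prop := ∀ u ∈ dom S, S u = some a

/-- The string `S` is partitioned into the strings of the family `F`. -/
def PartitionedInto (S : Str) (F : Finset Str) : Prop :=
  (∀ R ∈ F, ∀ R' ∈ F, R ≠ R' → Disjoint (dom R) (dom R')) ∧
  (⋃ R ∈ F, dom R) = dom S ∧
  ∀ R ∈ F, ∀ u ∈ dom R, R u = S u

/-! ## Lattices, tiles and subtiles with respect to two vectors `φ`, `ψ` -/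

/-- `u` and `v` differ by an element of the lattice spanned by `φ` and `ψ`. -/
def LatticeCongruent (φ ψ u v : Pt) : Prop := ∃ s t : ℤ, u - v = s • φ + t • ψ

/-- The integer points of a parallelogram with sides parallel to `φ` and `ψ`. -/
def parallelogram (φ ψ : Pt) (φ₀ φ₁ ψ₀ ψ₁ : ℤ) : Set Pt :=
  {u | φ₀ ≤ cross φ u ∧ cross φ u ≤ φ₁ ∧ ψ₀ ≤ cross ψ u ∧ cross ψ u ≤ ψ₁}

def IsTile (φ ψ : Pt) (U : Set Pt) : Prop :=
  ∃ φ₀ φ₁ ψ₀ ψ₁ : ℤ, U = parallelogram φ ψ φ₀ φ₁ ψ₀ ψ₁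

/-- An axis-parallel rectangle with possibly infinite bounds. -/
def box (x₀ : WithBot ℤ) (x₁ : WithTop ℤ) (y₀ : WithBot ℤ) (y₁ : WithTop ℤ) : Set Pt :=
  {u | x₀ ≤ (u.1 : WithBot ℤ) ∧ (u.1 : WithTop ℤ) ≤ x₁ ∧
       y₀ ≤ (u.2 : WithBot ℤ) ∧ (u.2 : WithTop ℤ) ≤ y₁}

/-- `b - a + 1 ≥ d` for an interval `[a, b]` with possibly infinite ends (an infinite interval
is long enough for every `d`). -/
def LengthAtLeast (a : WithBot ℤ) (b : WithTop ℤ) (d : ℤ) : Prop :=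
  ∀ a' b' : ℤ, a = (a' : WithBot ℤ) → b = (b' : WithTop ℤ) → d ≤ b' - a' + 1

def IsTruncatedTile (φ ψ : Pt) (U : Set Pt) : Prop :=
  ∃ (x₀ : WithBot ℤ) (x₁ : WithTop ℤ) (y₀ : WithBot ℤ) (y₁ : WithTop ℤ) (φ₀ φ₁ ψ₀ ψ₁ : ℤ),
    U = box x₀ x₁ y₀ y₁ ∩ parallelogram φ ψ φ₀ φ₁ ψ₀ ψ₁ ∧
    LengthAtLeast x₀ x₁ (|φ.1| + |ψ.1|) ∧
    LengthAtLeast y₀ y₁ (|φ.2| + |ψ.2|)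

def IsSubtile (φ ψ : Pt) (V : Set Pt) : Prop :=
  ∃ (U : Set Pt) (γ : Pt), IsTile φ ψ U ∧ V = {u | u ∈ U ∧ LatticeCongruent φ ψ u γ}

def IsTruncatedSubtile (φ ψ : Pt) (V : Set Pt) : Prop :=
  ∃ (U : Set Pt) (γ : Pt), IsTruncatedTile φ ψ U ∧ V = {u | u ∈ U ∧ LatticeCongruent φ ψ u γ}

/-- The members of the family `𝒱` whose character is `a`. -/
def withChar (𝒱 : Finset Str) (chr : Str → ℤ) (a : ℤ) : Set Str := {V | V ∈ 𝒱 ∧ chr V = a}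

/-- The standing situation: an `m × m` pattern `P`, an `n × n` text `T` with
`m ≤ n ≤ 3m/2`, candidate shifts `Q`, two vectors `φ`, `ψ` in neighbouring quadrants with an angle
of sine at least `1/2` and coordinates of absolute value at most `n - m`, and a partition `𝒱`
of `P` into monochromatic truncated subtile strings, `chr V` being the character of `V`. -/
structure Setting (m n : ℕ) (P T : Str) (Q : Finset Pt) (φ ψ : Pt)
    (𝒱 : Finset Str) (chr : Str → ℤ) : Prop where
  m_pos : 1 ≤ m
  m_le_n : m ≤ n
  n_le : 2 * n ≤ 3 * m
  dom_P : dom P = grid m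
  dom_T : dom T = grid n
  shifts : ∀ q ∈ Q, dom (shift P q) ⊆ dom T
  ψ_quadrant : 0 < ψ.1 ∧ 0 ≤ ψ.2
  φ_quadrant : 0 ≤ φ.1 ∧ φ.2 < 0
  angle : 1 / 2 ≤ sinAngle ψ φ
  φ_small : |φ.1| ≤ (n : ℤ) - m ∧ |φ.2| ≤ (n : ℤ) - m
  ψ_small : |ψ.1| ≤ (n : ℤ) - m ∧ |ψ.2| ≤ (n : ℤ) - m
  partition : PartitionedInto P 𝒱
  subtiles : ∀ V ∈ 𝒱, IsTruncatedSubtile φ ψ (dom V)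
  chars : ∀ V ∈ 𝒱, MonochromaticWith V (chr V)

/-! ## The word RAM

Words are bit vectors of length `w`, with arithmetic modulo `2 ^ w`; the memory has one word for
each address.  Programs are structured, work on registers numbered by natural numbers (a program
mentions only finitely many of them), and every elementary instruction and every test costs one
unit of time. -/

inductive BinOp
  | add | sub | mul | udiv | umod | and | or | xor | shl | shr | eq | ult | slt

/-- The binary operations; comparisons return `1` or `0`, `ult` is the comparison of unsigned
numbers and `slt` the comparison of signed numbers in two-complement representation. -/
def BinOp.apply {w : ℕ} : BinOp → BitVec w → BitVec w → BitVec w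
  | .add, x, y => x + y
  | .sub, x, y => x - y
  | .mul, x, y => x * y
  | .udiv, x, y => x / y
  | .umod, x, y => x % y
  | .and, x, y => x &&& y
  | .or, x, y => x ||| y
  | .xor, x, y => x ^^^ y
  | .shl, x, y => x <<< y
  | .shr, x, y => x >>> y
  | .eq, x, y => if x = y then 1#w else 0#w
  | .ult, x, y => if x.toNat < y.toNat then 1#w else 0#w
  | .slt, x, y => if x.toInt < y.toInt then 1#w else 0#w

inductive Prog
  /-- do nothing -/
  | skip
  /-- `r := k` for a fixed number `k` -/
  | const (r : ℕ) (k : ℕ)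
  /-- `r := a op b` for registers `r`, `a`, `b` -/
  | op (o : BinOp) (r a b : ℕ)
  /-- `r := mem[a]` -/
  | load (r a : ℕ)
  /-- `mem[a] := r` -/
  | store (a r : ℕ)
  /-- first `p`, then `p'` -/
  | seq (p p' : Prog)
  /-- if register `r` is nonzero then `p` else `p'` -/
  | ite (r : ℕ) (p p' : Prog)
  /-- while register `r` is nonzero do `p` -/
  | loop (r : ℕ) (p : Prog)

structure State (w : ℕ) where
  reg : ℕ → BitVec w
  mem : BitVec w → BitVec w

def State.setReg {w : ℕ} (σ : State w) (r : ℕ) (x : BitVec w) : State w :=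
  { σ with reg := Function.update σ.reg r x }

def State.setMem {w : ℕ} (σ : State w) (a x : BitVec w) : State w :=
  { σ with mem := Function.update σ.mem a x }

/-- `Exec p σ t σ'`: started in the state `σ`, the program `p` halts after exactly `t` steps in
the state `σ'`. -/
inductive Exec {w : ℕ} : Prog → State w → ℕ → State w → Prop
  | skip (σ : State w) : Exec .skip σ 1 σ
  | const (σ : State w) (r k : ℕ) : Exec (.const r k) σ 1 (σ.setReg r (BitVec.ofNat w k))
  | op (σ : State w) (o : BinOp) (r a b : ℕ) :
      Exec (.op o r a b) σ 1 (σ.setReg r (o.apply (σ.reg a) (σ.reg b)))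
  | load (σ : State w) (r a : ℕ) : Exec (.load r a) σ 1 (σ.setReg r (σ.mem (σ.reg a)))
  | store (σ : State w) (a r : ℕ) : Exec (.store a r) σ 1 (σ.setMem (σ.reg a) (σ.reg r))
  | seq {p p' : Prog} {σ σ' σ'' : State w} {t t' : ℕ} :
      Exec p σ t σ' → Exec p' σ' t' σ'' → Exec (.seq p p') σ (t + t') σ''
  | ite_true {r : ℕ} {p p' : Prog} {σ σ' : State w} {t : ℕ} :
      σ.reg r ≠ 0#w → Exec p σ t σ' → Exec (.ite r p p') σ (t + 1) σ'
  | ite_false {r : ℕ} {p p' : Prog} {σ σ' : State w} {t : ℕ} :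
      σ.reg r = 0#w → Exec p' σ t σ' → Exec (.ite r p p') σ (t + 1) σ'
  | loop_stop {r : ℕ} {p : Prog} {σ : State w} :
      σ.reg r = 0#w → Exec (.loop r p) σ 1 σ
  | loop_step {r : ℕ} {p : Prog} {σ σ' σ'' : State w} {t t' : ℕ} :
      σ.reg r ≠ 0#w → Exec p σ t σ' → Exec (.loop r p) σ' t' σ'' →
      Exec (.loop r p) σ (t + t' + 1) σ''

/-- The start state for a given input: the input occupies the memory cells `0, 1, 2, …`
(integers in two-complement representation); all other cells and all registers are `0`. -/
def startState (w : ℕ) (input : List ℤ) : State w where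
  reg := fun _ => 0#w
  mem := fun a => BitVec.ofInt w (input.getD a.toNat 0)

/-- The integer `a` is representable by a signed word of length `w`. -/
def FitsWord (w : ℕ) (a : ℤ) : Prop := -(2 : ℤ) ^ (w - 1) ≤ a ∧ a < (2 : ℤ) ^ (w - 1)

/-! ## Storing the input -/

/-- A stored string: a list of point-character pairs. -/
abbrev StoredStr := List (Pt × ℤ)

/-- The list `L` of point-character pairs, in any order, stores the string `S`. -/
def Stores (L : StoredStr) (S : Str) : Prop :=
  L.Nodup ∧ ∀ u a, (u, a) ∈ L ↔ S u = some a

/-- The list `Ls` stores the strings of the family `F`, each once and in any order. -/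
def StoresFamily (Ls : List StoredStr) (F : Finset Str) : Prop :=
  ∃ l : List Str, l.Nodup ∧ (∀ S, S ∈ l ↔ S ∈ F) ∧ List.Forall₂ Stores Ls l

/-- The list `L` stores the set `Q` of points, each point once and in any order. -/
def StoresPoints (L : List Pt) (Q : Finset Pt) : Prop :=
  L.Nodup ∧ ∀ q, q ∈ L ↔ q ∈ Q

def encodeStr (L : StoredStr) : List ℤ :=
  (L.length : ℤ) :: L.flatMap fun p => [p.1.1, p.1.2, p.2]

def encodeFamily (Ls : List StoredStr) : List ℤ :=
  (Ls.length : ℤ) :: Ls.flatMap encodeStr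

def encodePoints (L : List Pt) : List ℤ :=
  (L.length : ℤ) :: L.flatMap fun q => [q.1, q.2]

def encodeInput (m n : ℕ) (φ ψ : Pt) (Vs Ss : List StoredStr) (Qs : List Pt) : List ℤ :=
  [(m : ℤ), (n : ℤ), φ.1, φ.2, ψ.1, ψ.2] ++ encodeFamily Vs ++ encodeFamily Ss ++ encodePoints Qs

end HamTwoD

open HamTwoD

namespace HamTwoD

/-! ## A small imperative language over the integers -/

/-! Fix a string `S` of the second family, with character `c`, and a shift `q`. Since `S` is
monochromatic, its distance to the shifted pattern is the number of points of `S` in the window `q +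
[m]²` minus the number of matches. Since the strings `V` partition the pattern, the matches are
counted by the points `v` of strings `V` of character `c` with `v + q ∈ S` (`ham_eq`). The window
counts come from two-dimensional prefix sums by inclusion–exclusion (`quad_rec`, `out_eq`). The real
task is to compute `F(q)`, the sum of these correlations over all pairs `(V, S)` of equal character,
spending only polylogarithmic time per pair and per shift.

In the coordinates `(φ × u, ψ × u)`, with `d = φ × ψ > 0`, a subtile is a product of two arithmetic
progressions of step `d`. Translation by `ψ` moves the first coordinate by `d`, translation by `φ`
moves the second by `-d`. Hence the mixed second difference `f(u) - f(u-φ) - f(u-ψ) + f(u-φ-ψ)` of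
the indicator of `S` telescopes to four signed point masses at corners (`subtile_diff`). The second
difference in `q` of the correlation of `V` and `S` is therefore a signed sum of four indicators
`[corner - q ∈ V]` (`correlation_diff`). A truncated subtile `V` is cut out by two residues modulo
`d` and by intervals for four linear functionals: `φ × u`, `ψ × u` and, by Cramer's rule, `d` times
the two coordinates. The extreme values attained on `V` serve as bounds
(`mem_truncatedSubtile_iff`). So a pair contributes four signed boxes in a four-dimensional space of
functionals of `q`.

The boxes are kept in a dyadic table. An initial segment is a disjoint union of dyadic intervals,
one for each binary digit `1` of its end (`ind_lt_eq_sum`), and products over the four functionals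
multiply the numbers of levels (`sum_table`, `sum_pairTab`). This costs of the order of `log⁴ n`
updates per pair and as many lookups per point. If `G(q)` denotes the value looked up, then `F(q) =
G(q) + F(q-φ) + F(q-ψ) - F(q-φ-ψ)`. As `F` vanishes outside `[-n, n)²`, and as the quadrants of `φ`
and `ψ` put all three predecessors earlier in the order "first coordinate increasing, then second
decreasing", one sweep over `4n²` points, of the order of `m²`, computes `F`.

Dictionaries are replaced by direct addressing in memory that is zero at the start: keys of the
table are below a fixed power of `n`, up to constants, and fit into words. Characters also serve as
addresses, namely of the heads of linked lists of the strings `V`. As characters are arbitrary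
words, these cells could clash with the other arrays. By pigeonhole, however, some block of
addresses contains no character, and rotating the address space by the start of that block separates
the two regions (`freeOffset_spec`, `addr_inj`).

The program is written in a small language with unbounded integers, separate arrays and a time
counter. It is verified there by weakest preconditions (`mainP_wp`) and transferred to the word RAM
by a simulation (`Sm.comp_exec`). -/

inductive AOp
  | add | sub | mul | div | mod | shr | lt | hi

inductive Ex
  | num (k : ℕ)
  | v (r : ℕ)
  | op (o : AOp) (a b : Ex)
  | ld (k : ℕ) (e : Ex)

inductive Sm
  | nop
  | asg (r : ℕ) (e : Ex)
  | st (k : ℕ) (i e : Ex)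
  | sq (a b : Sm)
  | cond (e : Ex) (a : Sm)
  | rep (r : ℕ) (e : Ex) (s : Sm)

/-- Values are unbounded integers and arrays are disjoint. `time` is a ghost counter that bounds the
number of machine steps from above. -/
structure St where
  var : ℕ → ℤ
  mem : ℕ → ℤ → ℤ
  time : ℕ

/-- Where the cell `i` of the array `k` is stored. -/
def addr (roff : ℤ) (k : ℕ) (i : ℤ) : ℤ :=
  if k = 0 then i else if k = 32 then i - roff else 0 - (i * 32 + k)

/-- The word length and the usable cells of each array. -/
structure Layout where
  w : ℕ
  ok : ℕ → ℤ → Prop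
  roff : ℤ
  wpos : 0 < w
  inj : ∀ k i k' i', ok k i → ok k' i' →
    BitVec.ofInt w (addr roff k i) = BitVec.ofInt w (addr roff k' i') → k = k' ∧ i = i'

def Layout.half (Λ : Layout) : ℤ := 2 ^ (Λ.w - 1)

def AOp.ev (w : ℕ) : AOp → ℤ → ℤ → ℤ
  | .add, a, b => a + b
  | .sub, a, b => a - b
  | .mul, a, b => a * b
  | .div, a, b => a / b
  | .mod, a, b => a % b
  | .shr, a, b => a / 2 ^ b.toNat
  | .lt, a, b => if a < b then 1 else 0
  | .hi, a, b => (a % 2 ^ w) / b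

/-- Ring operations commute with reduction modulo `2 ^ w`, so they are safe without any bound. Only
operations that look at the size of their operands need genuine words. In particular no bound on the
entries of the dyadic table is ever needed. For `hi` the dividend is deliberately read as an
unsigned word. -/
def AOp.sf (Λ : Layout) : AOp → ℤ → ℤ → Prop
  | .add, _, _ => True
  | .sub, _, _ => True
  | .mul, _, _ => True
  | .div, a, b => 0 ≤ a ∧ a < Λ.half ∧ 0 ≤ b ∧ b < Λ.half
  | .mod, a, b => 0 ≤ a ∧ a < Λ.half ∧ 0 ≤ b ∧ b < Λ.half
  | .shr, a, b => 0 ≤ a ∧ a < Λ.half ∧ 0 ≤ b ∧ b < Λ.half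
  | .lt, a, b => -Λ.half ≤ a ∧ a < Λ.half ∧ -Λ.half ≤ b ∧ b < Λ.half
  | .hi, _, b => 0 ≤ b ∧ b < Λ.half

def AOp.bin : AOp → BinOp
  | .add => .add
  | .sub => .sub
  | .mul => .mul
  | .div => .udiv
  | .mod => .umod
  | .shr => .shr
  | .lt => .slt
  | .hi => .udiv

def Ex.ev (Λ : Layout) (σ : St) : Ex → ℤ
  | .num k => k
  | .v r => σ.var r
  | .op o a b => o.ev Λ.w (a.ev Λ σ) (b.ev Λ σ)
  | .ld k e => σ.mem k (e.ev Λ σ)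

/-- Array 32 is addressed relative to variable 0, so it may be touched only once that variable holds
the offset of the layout. -/
def Layout.Acc (Λ : Layout) (σ : St) (k : ℕ) (i : ℤ) : Prop :=
  Λ.ok k i ∧ (k = 32 → σ.var 0 = Λ.roff)

def Ex.sf (Λ : Layout) (σ : St) : Ex → Prop
  | .num _ => True
  | .v _ => True
  | .op o a b => a.sf Λ σ ∧ b.sf Λ σ ∧ o.sf Λ (a.ev Λ σ) (b.ev Λ σ)
  | .ld k e => e.sf Λ σ ∧ Λ.Acc σ k (e.ev Λ σ)

/-- The `7` for a load covers at most six steps of address computation and the access itself. -/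
def Ex.cost : Ex → ℕ
  | .num _ => 1
  | .v _ => 1
  | .op _ a b => a.cost + b.cost + 1
  | .ld _ e => e.cost + 7

def St.tick (σ : St) (c : ℕ) : St := { σ with time := σ.time + c }
def St.setv (σ : St) (r : ℕ) (z : ℤ) (c : ℕ) : St :=
  { σ with var := Function.update σ.var r z, time := σ.time + c }
def St.setm (σ : St) (k : ℕ) (i z : ℤ) (c : ℕ) : St :=
  { σ with mem := Function.update σ.mem k (Function.update (σ.mem k) i z), time := σ.time + c }

@[simp] lemma St.tick_var (σ : St) (c) : (σ.tick c).var = σ.var := rfl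
@[simp] lemma St.tick_mem (σ : St) (c) : (σ.tick c).mem = σ.mem := rfl
@[simp] lemma St.tick_time (σ : St) (c) : (σ.tick c).time = σ.time + c := rfl
@[simp] lemma St.setv_mem (σ : St) (r z c) : (σ.setv r z c).mem = σ.mem := rfl
@[simp] lemma St.setv_time (σ : St) (r z c) : (σ.setv r z c).time = σ.time + c := rfl
lemma St.setv_var (σ : St) (r z c r') :
    (σ.setv r z c).var r' = if r' = r then z else σ.var r' := by
  simp [St.setv, Function.update_apply]
@[simp] lemma St.setm_var (σ : St) (k i z c) : (σ.setm k i z c).var = σ.var := rfl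
@[simp] lemma St.setm_time (σ : St) (k i z c) : (σ.setm k i z c).time = σ.time + c := rfl
lemma St.setm_mem (σ : St) (k i z c k') :
    (σ.setm k i z c).mem k' = if k' = k then Function.update (σ.mem k) i z else σ.mem k' := by
  by_cases h : k' = k
  · subst h; simp [St.setm]
  · simp [St.setm, h]

/-! ### Weakest preconditions, loop rules and the frame rule. -/

/-- The number of rounds is fixed on entry and the true index is kept apart from `r`, so the body
may overwrite `r`. The `5` ticks pay for copying the index, loading the constant 1, the two counter
updates and the loop test. -/
def wpRep (body : (St → Prop) → St → Prop) (r : ℕ) (Q : St → Prop) : ℕ → ℤ → St → Prop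
  | 0, _, σ => Q (σ.tick 1)
  | n + 1, i, σ => body (fun σ' => wpRep body r Q n (i + 1) (σ'.tick 5)) (σ.setv r i 0)

/-- The weakest precondition (total correctness, including the absence of overflows). -/
def Sm.wp (Λ : Layout) : Sm → (St → Prop) → St → Prop
  | .nop, Q, σ => Q (σ.tick 1)
  | .asg r e, Q, σ => e.sf Λ σ ∧ Q (σ.setv r (e.ev Λ σ) (e.cost + 1))
  | .st k i e, Q, σ => i.sf Λ σ ∧ e.sf Λ σ ∧ Λ.Acc σ k (i.ev Λ σ) ∧
      Q (σ.setm k (i.ev Λ σ) (e.ev Λ σ) (i.cost + e.cost + 7))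
  | .sq a b, Q, σ => a.wp Λ (b.wp Λ Q) σ
  | .cond e a, Q, σ => e.sf Λ σ ∧ -Λ.half ≤ e.ev Λ σ ∧ e.ev Λ σ < Λ.half ∧
      (e.ev Λ σ ≠ 0 → a.wp Λ Q (σ.tick (e.cost + 1))) ∧
      (e.ev Λ σ = 0 → Q (σ.tick (e.cost + 2)))
  | .rep r e s, Q, σ => e.sf Λ σ ∧ 0 ≤ e.ev Λ σ ∧ e.ev Λ σ < Λ.half ∧
      wpRep (s.wp Λ) r Q (e.ev Λ σ).toNat 0 (σ.tick (e.cost + 1))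

lemma Sm.wp_mono {Λ : Layout} (s : Sm) : ∀ {Q Q' : St → Prop} {σ : St}, (∀ σ, Q σ → Q' σ) →
    s.wp Λ Q σ → s.wp Λ Q' σ := by
  induction s with
  | nop => intro Q Q' σ h; exact h _
  | asg r e => intro Q Q' σ h hq; exact ⟨hq.1, h _ hq.2⟩
  | st k i e => intro Q Q' σ h hq; exact ⟨hq.1, hq.2.1, hq.2.2.1, h _ hq.2.2.2⟩
  | sq a b iha ihb => intro Q Q' σ h hq; exact iha (fun σ => ihb h) hq
  | cond e a iha =>
    intro Q Q' σ h hq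
    exact ⟨hq.1, hq.2.1, hq.2.2.1, fun hn => iha h (hq.2.2.2.1 hn), fun hn => h _ (hq.2.2.2.2 hn)⟩
  | rep r e s ih =>
    intro Q Q' σ h hq
    refine ⟨hq.1, hq.2.1, hq.2.2.1, ?_⟩
    have key : ∀ n i σ, wpRep (s.wp Λ) r Q n i σ → wpRep (s.wp Λ) r Q' n i σ := by
      intro n
      induction n with
      | zero => intro i σ; exact h _
      | succ n ihn => intro i σ hh; exact ih (fun σ => ihn _ _) hh
    exact key _ _ _ hq.2.2.2

/-- The loop rule. -/
lemma Sm.wp_rep {Λ : Layout} {r : ℕ} {e : Ex} {s : Sm} {Q : St → Prop} {σ : St}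
    (Inv : ℕ → St → Prop) (n : ℕ) (hsf : e.sf Λ σ) (hn : e.ev Λ σ = n) (hlt : (n : ℤ) < Λ.half)
    (h0 : Inv 0 (σ.tick (e.cost + 1)))
    (step : ∀ i < n, ∀ σ', Inv i σ' →
      s.wp Λ (fun σ'' => Inv (i + 1) (σ''.tick 5)) (σ'.setv r i 0))
    (post : ∀ σ', Inv n σ' → Q (σ'.tick 1)) : (Sm.rep r e s).wp Λ Q σ := by
  refine ⟨hsf, by omega, by omega, ?_⟩
  have key : ∀ k i : ℕ, i + k = n → ∀ σ', Inv i σ' → wpRep (s.wp Λ) r Q k i σ' := by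
    intro k
    induction k with
    | zero => intro i hi σ' h; simp at hi; subst hi; exact post _ h
    | succ k ih =>
      intro i hi σ' h
      refine Sm.wp_mono s ?_ (step i (by omega) σ' h)
      intro σ'' h''
      have := ih (i + 1) (by omega) _ h''
      exact_mod_cast this
  rw [hn]
  simpa using key n 0 (by omega) _ h0

/-- The loop rule for a loop over the members of a list. -/
lemma Sm.wp_rep_list {α : Type*} {Λ : Layout} {r : ℕ} {e : Ex} {s : Sm} {Q : St → Prop} {σ : St}
    (l : List α) (Inv : List α → St → Prop) (hsf : e.sf Λ σ) (hn : e.ev Λ σ = l.length)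
    (hlt : (l.length : ℤ) < Λ.half) (h0 : Inv [] (σ.tick (e.cost + 1)))
    (step : ∀ l₁ x l₂, l = l₁ ++ x :: l₂ → ∀ σ', Inv l₁ σ' →
      s.wp Λ (fun σ'' => Inv (l₁ ++ [x]) (σ''.tick 5)) (σ'.setv r l₁.length 0))
    (post : ∀ σ', Inv l σ' → Q (σ'.tick 1)) : (Sm.rep r e s).wp Λ Q σ := by
  refine Sm.wp_rep (fun i σ => Inv (l.take i) σ) l.length hsf hn hlt (by simpa using h0) ?_ ?_
  · intro i hi σ' h
    have h1 := step (l.take i) l[i] (l.drop (i + 1)) (by simp) σ' h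
    simp only [List.length_take, min_eq_left hi.le, List.take_append_getElem] at h1
    exact h1
  · intro σ' h
    exact post _ (by simpa using h)

def Sm.vars : Sm → List ℕ
  | .nop => []
  | .asg r _ => [r]
  | .st _ _ _ => []
  | .sq a b => a.vars ++ b.vars
  | .cond _ a => a.vars
  | .rep r _ s => r :: s.vars

def Sm.arrs : Sm → List ℕ
  | .nop => []
  | .asg _ _ => []
  | .st k _ _ => [k]
  | .sq a b => a.arrs ++ b.arrs
  | .cond _ a => a.arrs
  | .rep _ _ s => s.arrs

/-- Variables and arrays that a statement does not assign to are unchanged. -/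
def Frame (s : Sm) (σ σ' : St) : Prop :=
  (∀ r, r ∉ s.vars → σ'.var r = σ.var r) ∧ ∀ k, k ∉ s.arrs → σ'.mem k = σ.mem k

/-- A syntactic frame rule: it lets every later specification mention only what changes, the rest
being decided from the lists of assigned variables and arrays. -/
lemma Sm.wp_frame {Λ : Layout} (s : Sm) : ∀ {Q : St → Prop} {σ : St},
    s.wp Λ Q σ → s.wp Λ (fun σ' => Q σ' ∧ Frame s σ σ') σ := by
  induction s with
  | nop => intro Q σ h; exact ⟨h, fun _ _ => rfl, fun _ _ => rfl⟩
  | asg r e =>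
    intro Q σ h
    refine ⟨h.1, h.2, fun r' h' => ?_, fun _ _ => rfl⟩
    simp [Sm.vars] at h'
    simp [St.setv_var, h']
  | st k i e =>
    intro Q σ h
    refine ⟨h.1, h.2.1, h.2.2.1, h.2.2.2, fun _ _ => rfl, fun k' h' => ?_⟩
    simp [Sm.arrs] at h'
    simp [St.setm_mem, h']
  | sq a b iha ihb =>
    intro Q σ h
    refine Sm.wp_mono a ?_ (iha h)
    rintro σ₁ ⟨h₁, f₁⟩
    refine Sm.wp_mono b ?_ (ihb h₁)
    rintro σ₂ ⟨h₂, f₂⟩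
    refine ⟨h₂, fun r hr => ?_, fun r hr => ?_⟩
    · simp [Sm.vars] at hr
      rw [f₂.1 r hr.2, f₁.1 r hr.1]
    · simp [Sm.arrs] at hr
      rw [f₂.2 r hr.2, f₁.2 r hr.1]
  | cond e a iha =>
    intro Q σ h
    exact ⟨h.1, h.2.1, h.2.2.1, fun hn => iha (h.2.2.2.1 hn),
      fun hn => ⟨h.2.2.2.2 hn, fun _ _ => rfl, fun _ _ => rfl⟩⟩
  | rep r e s ih =>
    intro Q σ h
    refine ⟨h.1, h.2.1, h.2.2.1, ?_⟩
    have key : ∀ n i σ₁, Frame (.rep r e s) σ σ₁ → wpRep (s.wp Λ) r Q n i σ₁ →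
        wpRep (s.wp Λ) r (fun σ' => Q σ' ∧ Frame (.rep r e s) σ σ') n i σ₁ := by
      intro n
      induction n with
      | zero => intro i σ₁ hf hq; exact ⟨hq, hf⟩
      | succ n ihn =>
        intro i σ₁ hf hq
        refine Sm.wp_mono s ?_ (ih hq)
        rintro σ₂ ⟨hq₂, f₂⟩
        refine ihn _ _ ⟨fun r' hr => ?_, fun k hk => ?_⟩ hq₂
        · rw [← hf.1 r' hr]
          simp [Sm.vars] at hr
          simpa [St.setv_var, hr.1] using f₂.1 r' hr.2
        · rw [← hf.2 k hk]
          exact f₂.2 k hk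
    exact key _ _ _ ⟨fun _ _ => rfl, fun _ _ => rfl⟩ h.2.2.2

/-! ## Compilation -/

/-- The address of a cell of array `k`, from its index in the temporary register `d`. -/
def adjust (k d : ℕ) : Prog :=
  if k = 0 then .skip
  else if k = 32 then .op .sub (2 * d + 1) (2 * d + 1) 0
  else .seq (.const (2 * d + 3) 32) (.seq (.op .mul (2 * d + 1) (2 * d + 1) (2 * d + 3))
    (.seq (.const (2 * d + 3) k) (.seq (.op .add (2 * d + 1) (2 * d + 1) (2 * d + 3))
    (.seq (.const (2 * d + 3) 0) (.op .sub (2 * d + 1) (2 * d + 3) (2 * d + 1))))))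

/-- Variables live in even registers and temporaries in odd ones. The argument `d` says that the
temporaries with number below `d` are in use, and the result is left in temporary `d`. -/
def Ex.comp : Ex → ℕ → Prog
  | .num k, d => .const (2 * d + 1) k
  | .v r, d => .op .or (2 * d + 1) (2 * r) (2 * r)
  | .op o a b, d => .seq (a.comp d)
      (.seq (b.comp (d + 1)) (.op o.bin (2 * d + 1) (2 * d + 1) (2 * d + 3)))
  | .ld k e, d => .seq (e.comp d) (.seq (adjust k d) (.load (2 * d + 1) (2 * d + 1)))

def Sm.comp : Sm → ℕ → Prog
  | .nop, _ => .skip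
  | .asg r e, d => .seq (e.comp d) (.op .or (2 * r) (2 * d + 1) (2 * d + 1))
  | .st k i e, d => .seq (e.comp d) (.seq (i.comp (d + 1)) (.seq (adjust k (d + 1))
      (.store (2 * d + 3) (2 * d + 1))))
  | .sq a b, d => .seq (a.comp d) (b.comp d)
  | .cond e a, d => .seq (e.comp d) (.ite (2 * d + 1) (a.comp d) .skip)
  -- Temporary `d` counts the remaining rounds down, `d + 1` counts the index up and `d + 2`
  -- receives the constant 1; hence the body starts at depth `d + 3`.
  | .rep r e s, d => .seq (e.comp d) (.seq (.const (2 * d + 3) 0)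
      (.loop (2 * d + 1) (.seq (.op .or (2 * r) (2 * d + 3) (2 * d + 3)) (.seq (s.comp (d + 3))
        (.seq (.const (2 * d + 5) 1) (.seq (.op .add (2 * d + 3) (2 * d + 3) (2 * d + 5))
        (.op .sub (2 * d + 1) (2 * d + 1) (2 * d + 5))))))))

/-- The machine state `τ` implements the abstract state `σ`. -/
def Rel (Λ : Layout) (σ : St) (τ : State Λ.w) : Prop :=
  (∀ r, τ.reg (2 * r) = BitVec.ofInt Λ.w (σ.var r)) ∧
  ∀ k i, Λ.ok k i → τ.mem (BitVec.ofInt Λ.w (addr Λ.roff k i)) = BitVec.ofInt Λ.w (σ.mem k i)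

lemma ofInt_sub (w : ℕ) (x y : ℤ) :
    BitVec.ofInt w (x - y) = BitVec.ofInt w x - BitVec.ofInt w y := by
  rw [eq_sub_iff_add_eq, ← BitVec.ofInt_add]; congr 1; ring

lemma Layout.two_half (Λ : Layout) : (2 : ℤ) ^ Λ.w = 2 * Λ.half := by
  unfold Layout.half
  have := Λ.wpos
  rw [← pow_succ']; congr 1; omega

lemma Layout.half_pos (Λ : Layout) : 0 < Λ.half := by unfold Layout.half; positivity

lemma toNat_ofInt_nonneg {w : ℕ} {a : ℤ} (h0 : 0 ≤ a) (h1 : a < 2 ^ w) :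
    (BitVec.ofInt w a).toNat = a.toNat := by
  rw [BitVec.toNat_ofInt, Int.emod_eq_of_lt h0 (by exact_mod_cast h1)]

lemma toNat_ediv' {a b : ℤ} (ha : 0 ≤ a) (hb : 0 ≤ b) : (a / b).toNat = a.toNat / b.toNat := by
  lift a to ℕ using ha
  lift b to ℕ using hb
  norm_cast

lemma toInt_ofInt_fits (Λ : Layout) {a : ℤ} (h0 : -Λ.half ≤ a) (h1 : a < Λ.half) :
    (BitVec.ofInt Λ.w a).toInt = a := by
  have := Λ.two_half
  rw [BitVec.toInt_ofInt]
  apply Int.bmod_eq_of_le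
  · push_cast; omega
  · push_cast; omega

lemma ofInt_inj_of_fits (Λ : Layout) {a b : ℤ} (h0 : -Λ.half ≤ a) (h1 : a < Λ.half)
    (h2 : -Λ.half ≤ b) (h3 : b < Λ.half)
    (h : BitVec.ofInt Λ.w a = BitVec.ofInt Λ.w b) : a = b := by
  rw [← toInt_ofInt_fits Λ h0 h1, h, toInt_ofInt_fits Λ h2 h3]

lemma AOp.bin_apply (Λ : Layout) (o : AOp) (a b : ℤ) (h : o.sf Λ a b) :
    o.bin.apply (BitVec.ofInt Λ.w a) (BitVec.ofInt Λ.w b) = BitVec.ofInt Λ.w (o.ev Λ.w a b) := by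
  have h2 := Λ.two_half
  have hp := Λ.half_pos
  cases o with
  | add => simp [AOp.bin, BinOp.apply, AOp.ev, BitVec.ofInt_add]
  | sub => simp [AOp.bin, BinOp.apply, AOp.ev, ofInt_sub]
  | mul => simp [AOp.bin, BinOp.apply, AOp.ev, BitVec.ofInt_mul]
  | div =>
    obtain ⟨h1, h3, h4, h5⟩ := h
    simp only [AOp.bin, BinOp.apply, AOp.ev]
    apply BitVec.eq_of_toNat_eq
    have := Int.ediv_nonneg h1 h4
    have : a / b ≤ a := Int.ediv_le_self _ h1
    rw [BitVec.toNat_udiv, toNat_ofInt_nonneg h1 (by omega), toNat_ofInt_nonneg h4 (by omega),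
      toNat_ofInt_nonneg (by omega) (by omega), toNat_ediv' h1 h4]
  | mod =>
    obtain ⟨h1, h3, h4, h5⟩ := h
    simp only [AOp.bin, BinOp.apply, AOp.ev]
    apply BitVec.eq_of_toNat_eq
    have : a % b ≤ a := by
      have := Int.ediv_nonneg h1 h4
      have := Int.emod_add_mul_ediv a b
      nlinarith
    have h7 : 0 ≤ a % b := by
      -- A remainder by zero is the dividend itself, both for integers and for words.
      rcases h4.eq_or_lt with h | h
      · simpa [← h] using h1
      · exact Int.emod_nonneg _ h.ne'
    rw [BitVec.toNat_umod, toNat_ofInt_nonneg h1 (by omega), toNat_ofInt_nonneg h4 (by omega),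
      toNat_ofInt_nonneg (by omega) (by omega), Int.toNat_emod h1 h4]
  | shr =>
    obtain ⟨h1, h3, h4, h5⟩ := h
    simp only [AOp.bin, BinOp.apply, AOp.ev]
    apply BitVec.eq_of_toNat_eq
    have : 0 ≤ a / 2 ^ b.toNat := Int.ediv_nonneg h1 (by positivity)
    have : a / 2 ^ b.toNat ≤ a := Int.ediv_le_self _ h1
    rw [BitVec.ushiftRight_eq', BitVec.toNat_ushiftRight, toNat_ofInt_nonneg h1 (by omega),
      toNat_ofInt_nonneg h4 (by omega), toNat_ofInt_nonneg (by omega) (by omega),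
      Nat.shiftRight_eq_div_pow, toNat_ediv' h1 (by positivity)]
    congr 1
  | lt =>
    obtain ⟨h1, h3, h4, h5⟩ := h
    simp only [AOp.bin, BinOp.apply, AOp.ev, toInt_ofInt_fits Λ h1 h3, toInt_ofInt_fits Λ h4 h5]
    split_ifs
    · rw [← BitVec.ofInt_natCast]; rfl
    · rw [← BitVec.ofInt_natCast]; rfl
  | hi =>
    obtain ⟨h4, h5⟩ := h
    simp only [AOp.bin, BinOp.apply, AOp.ev]
    apply BitVec.eq_of_toNat_eq
    have h1 : 0 ≤ a % 2 ^ Λ.w := Int.emod_nonneg _ (by positivity)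
    have h3 : a % 2 ^ Λ.w < 2 ^ Λ.w := Int.emod_lt_of_pos _ (by positivity)
    have : 0 ≤ a % 2 ^ Λ.w / b := Int.ediv_nonneg h1 h4
    have : a % 2 ^ Λ.w / b ≤ a % 2 ^ Λ.w := Int.ediv_le_self _ h1
    rw [BitVec.toNat_udiv, toNat_ofInt_nonneg h4 (by omega),
      toNat_ofInt_nonneg (a := a % 2 ^ Λ.w / b) (by omega) (by omega),
      toNat_ediv' h1 h4, BitVec.toNat_ofInt]
    push_cast
    rfl

/-- All registers except the temporary ones with number at least `d` agree. -/
def Keeps {w : ℕ} (d : ℕ) (τ τ' : State w) : Prop :=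
  ∀ r, (r % 2 = 0 ∨ r < 2 * d + 1) → τ'.reg r = τ.reg r

lemma setReg_reg {w : ℕ} (τ : State w) (r : ℕ) (x : BitVec w) (r' : ℕ) :
    (τ.setReg r x).reg r' = if r' = r then x else τ.reg r' := by
  simp [State.setReg, Function.update_apply]

lemma setReg_mem {w : ℕ} (τ : State w) (r : ℕ) (x : BitVec w) : (τ.setReg r x).mem = τ.mem := rfl

lemma adjust_exec (Λ : Layout) (k d : ℕ) (i : ℤ) (τ : State Λ.w)
    (hi : τ.reg (2 * d + 1) = BitVec.ofInt Λ.w i)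
    (h0 : k = 32 → τ.reg 0 = BitVec.ofInt Λ.w Λ.roff) :
    ∃ τ' t, Exec (adjust k d) τ t τ' ∧ t ≤ 6 ∧ τ'.mem = τ.mem ∧ Keeps d τ τ' ∧
      τ'.reg (2 * d + 1) = BitVec.ofInt Λ.w (addr Λ.roff k i) := by
  unfold adjust addr
  split_ifs with h h'
  · exact ⟨τ, 1, .skip _, by norm_num, rfl, fun _ _ => rfl, hi⟩
  · refine ⟨_, 1, .op _ _ _ _ _, by norm_num, rfl, fun r hr => ?_, ?_⟩
    · rw [setReg_reg, if_neg (by omega)]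
    · rw [setReg_reg, if_pos rfl, hi, h0 h', ofInt_sub]; rfl
  · refine ⟨_, _, .seq (.const _ _ _) (.seq (.op _ _ _ _ _) (.seq (.const _ _ _)
      (.seq (.op _ _ _ _ _) (.seq (.const _ _ _) (.op _ _ _ _ _))))), by norm_num, rfl,
      fun r hr => ?_, ?_⟩
    · simp only [setReg_reg]
      split_ifs <;> first | omega | rfl
    · have hc : ∀ k : ℕ, BitVec.ofNat Λ.w k = BitVec.ofInt Λ.w (k : ℤ) :=
        fun k => (BitVec.ofInt_natCast _ _).symm
      have hne : ¬ 2 * d + 1 = 2 * d + 3 := by omega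
      simp only [setReg_reg, BinOp.apply, hi, ofInt_sub, BitVec.ofInt_add, BitVec.ofInt_mul, hc,
        if_true, if_neg hne, Nat.cast_zero, Nat.cast_ofNat]

lemma Rel.keeps {Λ : Layout} {σ : St} {τ τ' : State Λ.w} {d : ℕ} (h : Rel Λ σ τ)
    (hk : Keeps d τ τ') (hm : τ'.mem = τ.mem) : Rel Λ σ τ' :=
  ⟨fun r => by rw [hk (2 * r) (by omega), h.1], fun k i hki => by rw [hm, h.2 k i hki]⟩

lemma Keeps.trans {w : ℕ} {d d' : ℕ} {τ τ' τ'' : State w} (h : Keeps d τ τ') (h' : Keeps d' τ' τ'')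
    (hd : d ≤ d') : Keeps d τ τ'' :=
  fun r hr => by rw [h' r (by omega), h r hr]

lemma Ex.comp_exec (Λ : Layout) (σ : St) (e : Ex) : ∀ (d : ℕ) (τ : State Λ.w), Rel Λ σ τ →
    e.sf Λ σ → ∃ τ' t, Exec (e.comp d) τ t τ' ∧ t ≤ e.cost ∧ τ'.mem = τ.mem ∧ Keeps d τ τ' ∧
      τ'.reg (2 * d + 1) = BitVec.ofInt Λ.w (e.ev Λ σ) := by
  induction e with
  | num k =>
    intro d τ hr hs
    refine ⟨_, 1, .const _ _ _, le_rfl, rfl, fun r hr => ?_, ?_⟩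
    · rw [setReg_reg, if_neg (by omega)]
    · rw [setReg_reg, if_pos rfl, Ex.ev, BitVec.ofInt_natCast]
  | v r =>
    intro d τ hr hs
    refine ⟨_, 1, .op _ _ _ _ _, le_rfl, rfl, fun r hr => ?_, ?_⟩
    · rw [setReg_reg, if_neg (by omega)]
    · rw [setReg_reg, if_pos rfl, hr.1]; simp [BinOp.apply, Ex.ev]
  | op o a b iha ihb =>
    intro d τ hr hs
    obtain ⟨τ₁, t₁, x₁, c₁, m₁, k₁, v₁⟩ := iha d τ hr hs.1
    obtain ⟨τ₂, t₂, x₂, c₂, m₂, k₂, v₂⟩ := ihb (d + 1) τ₁ (hr.keeps k₁ m₁) hs.2.1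
    refine ⟨_, _, .seq x₁ (.seq x₂ (.op _ _ _ _ _)), by simp [Ex.cost]; omega, ?_,
      fun r hr => ?_, ?_⟩
    · rw [setReg_mem, m₂, m₁]
    · rw [setReg_reg, if_neg (by omega), k₂ r (by omega), k₁ r (by omega)]
    · rw [setReg_reg, if_pos rfl, k₂ (2 * d + 1) (by omega), v₁,
        show 2 * d + 3 = 2 * (d + 1) + 1 by ring, v₂]
      exact AOp.bin_apply Λ o _ _ hs.2.2
  | ld k e ih =>
    intro d τ hr hs
    obtain ⟨τ₁, t₁, x₁, c₁, m₁, k₁, v₁⟩ := ih d τ hr hs.1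
    have r₁ := hr.keeps k₁ m₁
    obtain ⟨τ₂, t₂, x₂, c₂, m₂, k₂, v₂⟩ := adjust_exec Λ k d _ τ₁ v₁
      (fun h => by rw [← hs.2.2 h]; exact r₁.1 0)
    have r₂ := r₁.keeps k₂ m₂
    refine ⟨_, _, .seq x₁ (.seq x₂ (.load _ _ _)), by simp [Ex.cost]; omega, ?_,
      fun r hr => ?_, ?_⟩
    · rw [setReg_mem, m₂, m₁]
    · rw [setReg_reg, if_neg (by omega), k₂ r (by omega), k₁ r (by omega)]
    · rw [setReg_reg, if_pos rfl, v₂, r₂.2 k _ hs.2.1]; rfl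

lemma Rel.setv {Λ : Layout} {σ : St} {τ : State Λ.w} (h : Rel Λ σ τ) (r : ℕ) (z : ℤ) (c : ℕ) :
    Rel Λ (σ.setv r z c) (τ.setReg (2 * r) (BitVec.ofInt Λ.w z)) := by
  refine ⟨fun r' => ?_, h.2⟩
  rw [setReg_reg, St.setv_var]
  by_cases hr : r' = r
  · simp [hr]
  · rw [if_neg (by omega), if_neg hr, h.1]

/-- This is where injectivity of the address map enters: a store changes no other usable cell. -/
lemma Rel.setm {Λ : Layout} {σ : St} {τ : State Λ.w} (h : Rel Λ σ τ) (k : ℕ) (i z : ℤ) (c : ℕ)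
    (hk : Λ.ok k i) :
    Rel Λ (σ.setm k i z c)
      (τ.setMem (BitVec.ofInt Λ.w (addr Λ.roff k i)) (BitVec.ofInt Λ.w z)) := by
  refine ⟨h.1, fun k' i' hk' => ?_⟩
  simp only [State.setMem, Function.update_apply, St.setm_mem]
  by_cases hh : k' = k ∧ i' = i
  · obtain ⟨rfl, rfl⟩ := hh; simp
  · rw [if_neg (fun he => hh (Λ.inj _ _ _ _ hk' hk he)), h.2 _ _ hk']
    by_cases hkk : k' = k
    · subst hkk
      simp only [true_and] at hh
      simp [hh]
    · simp [hkk]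

lemma Rel.tick {Λ : Layout} {σ : St} {τ : State Λ.w} (h : Rel Λ σ τ) (c : ℕ) :
    Rel Λ (σ.tick c) τ := h

lemma keeps_setReg {w : ℕ} {d r : ℕ} (τ : State w) (x : BitVec w)
    (h : r % 2 = 1 ∧ 2 * d + 1 ≤ r) : Keeps d τ (τ.setReg r x) :=
  fun r' hr' => by rw [setReg_reg, if_neg (by omega)]

/-- The temporary registers with number less than `d` agree. -/
def KeepsTemps {w : ℕ} (d : ℕ) (τ τ' : State w) : Prop :=
  ∀ j < d, τ'.reg (2 * j + 1) = τ.reg (2 * j + 1)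

lemma Keeps.temps {w : ℕ} {d : ℕ} {τ τ' : State w} (h : Keeps d τ τ') : KeepsTemps d τ τ' :=
  fun j hj => h _ (by omega)

lemma KeepsTemps.trans {w : ℕ} {d d' : ℕ} {τ τ' τ'' : State w} (h : KeepsTemps d τ τ')
    (h' : KeepsTemps d' τ' τ'') (hd : d ≤ d') : KeepsTemps d τ τ'' :=
  fun r hr => by rw [h' r (by omega), h r hr]

lemma or_self' {w : ℕ} (x : BitVec w) : BinOp.or.apply x x = x := by simp [BinOp.apply]

lemma ofInt_ne_zero (Λ : Layout) {z : ℤ} (h1 : -Λ.half ≤ z) (h2 : z < Λ.half) :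
    BitVec.ofInt Λ.w z = 0#Λ.w ↔ z = 0 := by
  constructor
  · intro h
    refine ofInt_inj_of_fits Λ h1 h2 (by have := Λ.half_pos; omega) Λ.half_pos ?_
    rw [h]; simp
  · rintro rfl; simp

/-- The compiled program simulates the abstract one. -/
lemma Sm.comp_exec (Λ : Layout) (s : Sm) : ∀ (d : ℕ) (Q : St → Prop) (σ : St) (τ : State Λ.w),
    Rel Λ σ τ → s.wp Λ Q σ → ∃ σ' τ' t, Exec (s.comp d) τ t τ' ∧ σ.time + t ≤ σ'.time ∧
      Rel Λ σ' τ' ∧ KeepsTemps d τ τ' ∧ Q σ' := by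
  induction s with
  | nop =>
    intro d Q σ τ hr h
    exact ⟨_, τ, 1, .skip _, le_rfl, hr.tick 1, fun _ _ => rfl, h⟩
  | asg r e =>
    intro d Q σ τ hr h
    obtain ⟨τ₁, t₁, x₁, c₁, m₁, k₁, v₁⟩ := Ex.comp_exec Λ σ e d τ hr h.1
    refine ⟨_, _, _, .seq x₁ (.op _ _ _ _ _), ?_, ?_, ?_, h.2⟩
    · simp only [St.setv_time]; omega
    · rw [or_self', v₁]
      exact (hr.keeps k₁ m₁).setv _ _ _
    · intro j hj
      rw [setReg_reg, if_neg (by omega), k₁ _ (by omega)]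
  | st k i e =>
    intro d Q σ τ hr h
    obtain ⟨hi, he, ha, hq⟩ := h
    obtain ⟨τ₁, t₁, x₁, c₁, m₁, k₁, v₁⟩ := Ex.comp_exec Λ σ e d τ hr he
    have r₁ := hr.keeps k₁ m₁
    obtain ⟨τ₂, t₂, x₂, c₂, m₂, k₂, v₂⟩ := Ex.comp_exec Λ σ i (d + 1) τ₁ r₁ hi
    have r₂ := r₁.keeps k₂ m₂
    obtain ⟨τ₃, t₃, x₃, c₃, m₃, k₃, v₃⟩ := adjust_exec Λ k (d + 1) _ τ₂ v₂
      (fun h => by rw [← ha.2 h]; exact r₂.1 0)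
    have r₃ := r₂.keeps k₃ m₃
    refine ⟨_, _, _, .seq x₁ (.seq x₂ (.seq x₃ (.store _ _ _))), ?_, ?_, ?_, hq⟩
    · simp only [St.setm_time]; omega
    · have h3 : 2 * d + 3 = 2 * (d + 1) + 1 := by ring
      rw [h3, v₃, k₃ (2 * d + 1) (by omega), k₂ (2 * d + 1) (by omega), v₁]
      exact r₃.setm _ _ _ _ ha.1
    · intro j hj
      simp only [State.setMem]
      rw [k₃ _ (by omega), k₂ _ (by omega), k₁ _ (by omega)]
  | sq a b iha ihb =>
    intro d Q σ τ hr h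
    obtain ⟨σ₁, τ₁, t₁, x₁, c₁, r₁, k₁, q₁⟩ := iha d _ σ τ hr h
    obtain ⟨σ₂, τ₂, t₂, x₂, c₂, r₂, k₂, q₂⟩ := ihb d _ σ₁ τ₁ r₁ q₁
    exact ⟨σ₂, τ₂, _, .seq x₁ x₂, by omega, r₂, k₁.trans k₂ le_rfl, q₂⟩
  | cond e a iha =>
    intro d Q σ τ hr h
    obtain ⟨he, hl, hu, ht, hf⟩ := h
    obtain ⟨τ₁, t₁, x₁, c₁, m₁, k₁, v₁⟩ := Ex.comp_exec Λ σ e d τ hr he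
    have r₁ := hr.keeps k₁ m₁
    by_cases hz : e.ev Λ σ = 0
    · refine ⟨_, τ₁, _, .seq x₁ (.ite_false (by rw [v₁, hz]; simp) (.skip _)), ?_,
        r₁.tick _, k₁.temps, hf hz⟩
      simp only [St.tick_time]; omega
    · obtain ⟨σ₂, τ₂, t₂, x₂, c₂, r₂, k₂, q₂⟩ := iha d _ _ τ₁ (r₁.tick _) (ht hz)
      refine ⟨σ₂, τ₂, _, .seq x₁ (.ite_true ?_ x₂), ?_, r₂, k₁.temps.trans k₂ le_rfl, q₂⟩
      · rw [v₁, Ne, ofInt_ne_zero Λ hl hu]; exact hz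
      · simp only [St.tick_time] at c₂; omega
  | rep r e s ih =>
    intro d Q σ τ hr h
    obtain ⟨he, hl, hu, hq⟩ := h
    obtain ⟨τ₁, t₁, x₁, c₁, m₁, k₁, v₁⟩ := Ex.comp_exec Λ σ e d τ hr he
    have r₁ := hr.keeps k₁ m₁
    have h3 : 2 * d + 3 = 2 * (d + 1) + 1 := by ring
    -- Invariant of the machine loop: its two private temporaries hold the number of remaining
    -- rounds and the next index.
    have key : ∀ (n : ℕ) (i : ℤ) (σ : St) (τ : State Λ.w), (n : ℤ) < Λ.half → Rel Λ σ τ →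
        τ.reg (2 * d + 1) = BitVec.ofInt Λ.w n → τ.reg (2 * d + 3) = BitVec.ofInt Λ.w i →
        wpRep (s.wp Λ) r Q n i σ → ∃ σ' τ' t,
        Exec (.loop (2 * d + 1) (.seq (.op .or (2 * r) (2 * d + 3) (2 * d + 3))
        (.seq (s.comp (d + 3)) (.seq (.const (2 * d + 5) 1)
        (.seq (.op .add (2 * d + 3) (2 * d + 3) (2 * d + 5))
        (.op .sub (2 * d + 1) (2 * d + 1) (2 * d + 5))))))) τ t τ' ∧ σ.time + t ≤ σ'.time ∧
        Rel Λ σ' τ' ∧ KeepsTemps d τ τ' ∧ Q σ' := by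
      intro n
      induction n with
      | zero =>
        intro i σ τ _ hr hn hi h
        exact ⟨_, τ, 1, Exec.loop_stop (by rw [hn]; simp), le_rfl, hr.tick _, fun _ _ => rfl, h⟩
      | succ n ihn =>
        intro i σ τ hlt hr hn hi h
        have hp := Λ.half_pos
        have rA := hr.setv r i 0
        rw [← hi] at rA
        obtain ⟨σ₂, τ₂, t₂, x₂, c₂, r₂, k₂, q₂⟩ := ih (d + 3) _ _ _ rA h
        have e1 : τ₂.reg (2 * d + 1) = BitVec.ofInt Λ.w (n + 1 : ℕ) := by
          rw [k₂ d (by omega), setReg_reg, if_neg (by omega), hn]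
        have e3 : τ₂.reg (2 * d + 3) = BitVec.ofInt Λ.w i := by
          rw [h3, k₂ (d + 1) (by omega), setReg_reg, if_neg (by omega), ← h3, hi]
        obtain ⟨σ₃, τ₃, t₃, x₃, c₃, r₃, k₃, q₃⟩ := ihn (i + 1) (σ₂.tick 5)
          (((τ₂.setReg (2 * d + 5) (BitVec.ofNat Λ.w 1)).setReg (2 * d + 3)
            (BitVec.ofInt Λ.w (i + 1))).setReg (2 * d + 1) (BitVec.ofInt Λ.w n))
          (by push_cast at hlt; omega)
          (Rel.keeps (d := d) (r₂.tick 5) (((keeps_setReg _ _ (by omega)).trans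
            (keeps_setReg _ _ (by omega)) le_rfl).trans (keeps_setReg _ _ (by omega)) le_rfl) rfl)
          (by rw [setReg_reg, if_pos rfl])
          (by rw [setReg_reg, if_neg (by omega), setReg_reg, if_pos rfl]) q₂
        have xA := Exec.op τ .or (2 * r) (2 * d + 3) (2 * d + 3)
        rw [or_self'] at xA
        have xB := Exec.op (τ₂.setReg (2 * d + 5) (BitVec.ofNat Λ.w 1)) .add (2 * d + 3)
          (2 * d + 3) (2 * d + 5)
        have eB : BinOp.add.apply ((τ₂.setReg (2 * d + 5) (BitVec.ofNat Λ.w 1)).reg (2 * d + 3))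
            ((τ₂.setReg (2 * d + 5) (BitVec.ofNat Λ.w 1)).reg (2 * d + 5)) =
            BitVec.ofInt Λ.w (i + 1) := by
          rw [setReg_reg, setReg_reg, if_neg (by omega), if_pos rfl, e3, BinOp.apply,
            ← BitVec.ofInt_natCast, ← BitVec.ofInt_add]; rfl
        rw [eB] at xB
        have xC := Exec.op ((τ₂.setReg (2 * d + 5) (BitVec.ofNat Λ.w 1)).setReg (2 * d + 3)
          (BitVec.ofInt Λ.w (i + 1))) .sub (2 * d + 1) (2 * d + 1) (2 * d + 5)
        have eC : BinOp.sub.apply (((τ₂.setReg (2 * d + 5) (BitVec.ofNat Λ.w 1)).setReg (2 * d + 3)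
            (BitVec.ofInt Λ.w (i + 1))).reg (2 * d + 1))
            (((τ₂.setReg (2 * d + 5) (BitVec.ofNat Λ.w 1)).setReg (2 * d + 3)
            (BitVec.ofInt Λ.w (i + 1))).reg (2 * d + 5)) = BitVec.ofInt Λ.w n := by
          rw [setReg_reg, setReg_reg, if_neg (by omega), if_neg (by omega), setReg_reg,
            if_neg (by omega), setReg_reg, if_pos rfl, e1, BinOp.apply,
            ← BitVec.ofInt_natCast, ← ofInt_sub]; push_cast; congr 1; ring
        rw [eC] at xC
        refine ⟨σ₃, τ₃, _, .loop_step ?_ (.seq xA (.seq x₂ (.seq (.const _ _ _)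
          (.seq xB xC)))) x₃, ?_, r₃, ?_, q₃⟩
        · rw [hn, Ne, ofInt_ne_zero Λ (by omega) (by omega)]; omega
        · simp only [St.setv_time, St.tick_time] at c₂ c₃; omega
        · intro j hj
          rw [k₃ j hj, setReg_reg, if_neg (by omega), setReg_reg, if_neg (by omega), setReg_reg,
            if_neg (by omega), k₂ j (by omega), setReg_reg, if_neg (by omega)]
    obtain ⟨σ₂, τ₂, t₂, x₂, c₂, r₂, k₂, q₂⟩ := key (e.ev Λ σ).toNat 0 (σ.tick (e.cost + 1))
      (τ₁.setReg (2 * d + 3) (BitVec.ofNat Λ.w 0)) (by omega)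
      (Rel.keeps (r₁.tick _) (d := d) (keeps_setReg _ _ (by omega)) rfl)
      (by rw [setReg_reg, if_neg (by omega), v₁, Int.toNat_of_nonneg hl])
      (by rw [setReg_reg, if_pos rfl]; simp) hq
    refine ⟨σ₂, τ₂, _, .seq x₁ (.seq (.const _ _ _) x₂), ?_, r₂, ?_, q₂⟩
    · simp only [St.tick_time] at c₂; omega
    · refine k₁.temps.trans (KeepsTemps.trans (d := d) ?_ k₂ le_rfl) le_rfl
      exact (keeps_setReg _ _ (by omega)).temps

/-! ## The dyadic table -/

/-- Indicator as an integer. -/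
def ind (p : Prop) [Decidable p] : ℤ := if p then 1 else 0

lemma ind_congr {p q : Prop} [Decidable p] [Decidable q] (h : p ↔ q) : ind p = ind q := by
  unfold ind; simp [h]

lemma ind_and {p q : Prop} [Decidable p] [Decidable q] : ind (p ∧ q) = ind p * ind q := by
  unfold ind; by_cases hp : p <;> by_cases hq : q <;> simp [hp, hq]

/-- An initial segment of the integers is a disjoint union of dyadic intervals. -/
lemma ind_lt_eq_sum (L : ℕ) : ∀ x A : ℤ, 0 ≤ x → x < 2 ^ L → 0 ≤ A → A < 2 ^ L →
    ind (x < A) = ∑ l ∈ Finset.range L, (A / 2 ^ l) % 2 * ind (A / 2 ^ l = x / 2 ^ l + 1) := by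
  induction L with
  | zero =>
    intro x A h1 h2 h3 h4
    simp at h2 h4
    have : ¬ x < A := by omega
    simp [ind, this]
  | succ L ih =>
    intro x A h1 h2 h3 h4
    -- Halving both numbers: `x < A` holds if already `x / 2 < A / 2`, and otherwise only if `A` is
    -- odd and `A = x + 1`. The latter is the term of level 0.
    rw [Finset.sum_range_succ']
    have e : ∀ (z : ℤ) (l : ℕ), z / 2 ^ (l + 1) = z / 2 / 2 ^ l := by
      intro z l
      rw [pow_succ', Int.ediv_ediv_of_nonneg (by norm_num)]
    simp only [e]
    rw [← ih (x / 2) (A / 2) (by omega) (by rw [pow_succ] at h2; omega) (by omega)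
      (by rw [pow_succ] at h4; omega)]
    simp only [pow_zero, Int.ediv_one, ind]
    split_ifs <;> omega

/-- Division with remainder by `A` is a bijection from numbers below `A * B` to pairs. This turns
the single counter of a loop into nested sums over its digits. -/
lemma sum_range_mul_mod_div {M : Type*} [AddCommMonoid M] (A B : ℕ) (g : ℕ → ℕ → M) :
    ∑ t ∈ Finset.range (A * B), g (t % A) (t / A) =
      ∑ i ∈ Finset.range A, ∑ j ∈ Finset.range B, g i j := by
  rw [Finset.sum_comm]
  induction B with
  | zero => simp
  | succ B ih =>
    rw [mul_add, mul_one, Finset.sum_range_add, ih, Finset.sum_range_succ]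
    congr 1
    refine Finset.sum_congr rfl fun i hi => ?_
    have hi := Finset.mem_range.1 hi
    rw [Nat.mul_add_mod, Nat.mod_eq_of_lt hi, Nat.mul_add_div (by omega), Nat.div_eq_of_lt hi,
      add_zero]

/-- The key of the update number `t` for a product of intervals `[A₁, A₀)`. -/
def evKey (L : ℕ) (X : ℤ) : List (ℤ × ℤ) → ℤ → ℤ → ℤ
  | [], _, key => key
  | A :: r, t, key => evKey L X r (t / (2 * L))
      ((key * X + t % (2 * L) / 2) * X +
        (A.1 + t % (2 * L) % 2 * (A.2 - A.1)) / 2 ^ (t % (2 * L) / 2).toNat)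

/-- The weight of the update number `t` for a product of intervals `[A₁, A₀)`. -/
def evWt (L : ℕ) : List (ℤ × ℤ) → ℤ → ℤ → ℤ
  | [], _, wt => wt
  | A :: r, t, wt => evWt L r (t / (2 * L))
      (wt * ((A.1 + t % (2 * L) % 2 * (A.2 - A.1)) / 2 ^ (t % (2 * L) / 2).toNat % 2) *
        (1 - 2 * (t % (2 * L) % 2)))

/-- The key of the lookup number `t` for a point. -/
def quKey (L : ℕ) (X : ℤ) : List ℤ → ℤ → ℤ → ℤ
  | [], _, key => key
  | x :: r, t, key => quKey L X r (t / L)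
      ((key * X + t % L) * X + (x / 2 ^ (t % L).toNat + 1))

/-- Uniqueness of the last two digits in base `X`; the leading part is unrestricted, so it can be
the whole key built so far. -/
lemma digits_inj {X a b c a' b' c' : ℤ} (hb : 0 ≤ b ∧ b < X) (hb' : 0 ≤ b' ∧ b' < X)
    (hc : 0 ≤ c ∧ c < X) (hc' : 0 ≤ c' ∧ c' < X) :
    (a * X + b) * X + c = (a' * X + b') * X + c' ↔ a = a' ∧ b = b' ∧ c = c' := by
  have key : ∀ u v r s : ℤ, 0 ≤ r ∧ r < X → 0 ≤ s ∧ s < X → u * X + r = v * X + s →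
      u = v ∧ r = s := by
    intro u v r s hr hs h
    have : u = v := by
      by_contra hne
      rcases lt_or_gt_of_ne hne with hl | hl
      · nlinarith [mul_le_mul_of_nonneg_right (show u + 1 ≤ v by omega) (show 0 ≤ X by omega)]
      · nlinarith [mul_le_mul_of_nonneg_right (show v + 1 ≤ u by omega) (show 0 ≤ X by omega)]
    subst this
    exact ⟨rfl, by linarith⟩
  constructor
  · intro h
    obtain ⟨h1, h2⟩ := key _ _ _ _ hc hc' h
    obtain ⟨h3, h4⟩ := key _ _ _ _ hb hb' h1
    exact ⟨h3, h4, h2⟩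
  · rintro ⟨rfl, rfl, rfl⟩; rfl

/-- The factor of one coordinate in the correctness of the dyadic table. -/
lemma sum_one_digit (L : ℕ) (X : ℤ) (hL : (L : ℤ) < X) (hX : 2 ^ L < X) (A : ℤ × ℤ) (x : ℤ)
    (hx : 0 ≤ x ∧ x < 2 ^ L) (h1 : 0 ≤ A.1 ∧ A.1 < 2 ^ L) (h2 : 0 ≤ A.2 ∧ A.2 < 2 ^ L)
    (key key' : ℤ) :
    ∑ l' ∈ Finset.range L, ∑ d ∈ Finset.range (2 * L),
      ((A.1 + (d : ℤ) % 2 * (A.2 - A.1)) / 2 ^ ((d : ℤ) / 2).toNat % 2) * (1 - 2 * ((d : ℤ) % 2)) *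
      ind ((key * X + (d : ℤ) / 2) * X +
        (A.1 + (d : ℤ) % 2 * (A.2 - A.1)) / 2 ^ ((d : ℤ) / 2).toNat =
        (key' * X + (l' : ℤ)) * X + (x / 2 ^ (l' : ℤ).toNat + 1)) =
    ind (key = key') * (ind (x < A.1) - ind (x < A.2)) := by
  have hb : ∀ (z : ℤ) (l : ℕ), 0 ≤ z → z < 2 ^ L → 0 ≤ z / 2 ^ l ∧ z / 2 ^ l < 2 ^ L := by
    intro z l h h'
    exact ⟨Int.ediv_nonneg h (by positivity), (Int.ediv_le_self _ h).trans_lt h'⟩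
  have e1 : ∀ l' ∈ Finset.range L, ∑ d ∈ Finset.range (2 * L),
      ((A.1 + (d : ℤ) % 2 * (A.2 - A.1)) / 2 ^ ((d : ℤ) / 2).toNat % 2) * (1 - 2 * ((d : ℤ) % 2)) *
      ind ((key * X + (d : ℤ) / 2) * X +
        (A.1 + (d : ℤ) % 2 * (A.2 - A.1)) / 2 ^ ((d : ℤ) / 2).toNat =
        (key' * X + (l' : ℤ)) * X + (x / 2 ^ (l' : ℤ).toNat + 1)) =
      ind (key = key') * (A.1 / 2 ^ l' % 2 * ind (A.1 / 2 ^ l' = x / 2 ^ l' + 1) -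
        A.2 / 2 ^ l' % 2 * ind (A.2 / 2 ^ l' = x / 2 ^ l' + 1)) := by
    intro l' hl'
    have hl' := Finset.mem_range.1 hl'
    have e2 := sum_range_mul_mod_div 2 L (fun s l : ℕ =>
      ((A.1 + (s : ℤ) * (A.2 - A.1)) / 2 ^ l % 2) * (1 - 2 * (s : ℤ)) *
      ind ((key * X + (l : ℤ)) * X + (A.1 + (s : ℤ) * (A.2 - A.1)) / 2 ^ l =
        (key' * X + (l' : ℤ)) * X + (x / 2 ^ (l' : ℤ).toNat + 1)))
    have e4 : ∀ d : ℕ, (d : ℤ) / 2 = ((d / 2 : ℕ) : ℤ) := by intro d; push_cast; rfl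
    have e5 : ∀ d : ℕ, (d : ℤ) % 2 = ((d % 2 : ℕ) : ℤ) := by intro d; push_cast; rfl
    simp only [e4, e5, Int.toNat_natCast] at e2 ⊢
    rw [e2, Finset.sum_range_succ, Finset.sum_range_one]
    -- The level is itself a digit of the key, so an update and a lookup can meet only at equal
    -- levels.
    have e6 : ∀ (z : ℤ), 0 ≤ z ∧ z < 2 ^ L → ∀ l ∈ Finset.range L,
        ind ((key * X + (l : ℤ)) * X + z / 2 ^ l =
        (key' * X + (l' : ℤ)) * X + (x / 2 ^ l' + 1)) =
        if l = l' then ind (key = key') * ind (z / 2 ^ l' = x / 2 ^ l' + 1) else 0 := by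
      intro z hz l hl
      have hl := Finset.mem_range.1 hl
      have q1 := hb z l hz.1 hz.2
      have q2 := hb x l' hx.1 hx.2
      rw [ind_congr (digits_inj (by omega) (by omega) (by omega) (by omega))]
      split_ifs with h
      · subst h
        rw [← ind_and]
        exact ind_congr (by simp)
      · unfold ind
        rw [if_neg]
        rintro ⟨_, h', _⟩
        exact h (by exact_mod_cast h')
    have f1 : ∀ l ∈ Finset.range L, (A.1 / 2 ^ l % 2) *
        ind ((key * X + (l : ℤ)) * X + A.1 / 2 ^ l =
        (key' * X + (l' : ℤ)) * X + (x / 2 ^ l' + 1)) =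
        if l = l' then A.1 / 2 ^ l' % 2 *
          (ind (key = key') * ind (A.1 / 2 ^ l' = x / 2 ^ l' + 1)) else 0 := by
      intro l hl
      rw [e6 _ h1 l hl]
      split_ifs with h
      · rw [h]
      · simp
    have f2 : ∀ l ∈ Finset.range L, (A.2 / 2 ^ l % 2) *
        ind ((key * X + (l : ℤ)) * X + A.2 / 2 ^ l =
        (key' * X + (l' : ℤ)) * X + (x / 2 ^ l' + 1)) =
        if l = l' then A.2 / 2 ^ l' % 2 *
          (ind (key = key') * ind (A.2 / 2 ^ l' = x / 2 ^ l' + 1)) else 0 := by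
      intro l hl
      rw [e6 _ h2 l hl]
      split_ifs with h
      · rw [h]
      · simp
    have g1 := Finset.sum_congr rfl f1
    have g2 := Finset.sum_congr rfl f2
    rw [Finset.sum_ite_eq' , if_pos (Finset.mem_range.2 hl')] at g1 g2
    have r1 : A.1 + ((1 : ℕ) : ℤ) * (A.2 - A.1) = A.2 := by push_cast; ring
    have r0 : A.1 + ((0 : ℕ) : ℤ) * (A.2 - A.1) = A.1 := by push_cast; ring
    simp only [r1, r0]
    have m0 : (1 - 2 * ((0 : ℕ) : ℤ)) = 1 := by norm_num
    have m1 : (1 - 2 * ((1 : ℕ) : ℤ)) = -1 := by norm_num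
    simp only [m0, m1, mul_one, mul_neg, neg_mul, Finset.sum_neg_distrib]
    rw [g1, g2]; ring
  rw [Finset.sum_congr rfl e1, ← Finset.mul_sum, Finset.sum_sub_distrib,
    ind_lt_eq_sum L x A.1 hx.1 hx.2 h1.1 h1.2, ind_lt_eq_sum L x A.2 hx.1 hx.2 h2.1 h2.2]

/-- Correctness of the dyadic table. -/
lemma sum_table (L : ℕ) (X : ℤ) (hL : (L : ℤ) < X) (hX : 2 ^ L < X) :
    ∀ (dims : List ((ℤ × ℤ) × ℤ)),
    (∀ D ∈ dims, (0 ≤ D.2 ∧ D.2 < 2 ^ L) ∧ (0 ≤ D.1.1 ∧ D.1.1 < 2 ^ L) ∧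
      (0 ≤ D.1.2 ∧ D.1.2 < 2 ^ L)) → ∀ (key key' wt : ℤ),
    ∑ t' ∈ Finset.range (L ^ dims.length), ∑ t ∈ Finset.range ((2 * L) ^ dims.length),
      evWt L (dims.map Prod.fst) t wt *
      ind (evKey L X (dims.map Prod.fst) t key = quKey L X (dims.map Prod.snd) t' key') =
    wt * ind (key = key') * (dims.map fun D => ind (D.2 < D.1.1) - ind (D.2 < D.1.2)).prod := by
  intro dims
  induction dims with
  | nil => intro _ key key' wt; simp [evWt, evKey, quKey]
  | cons D r ih =>
    intro hD key key' wt
    have hD0 := hD D (by simp)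
    -- The lowest digits of both counters belong to the first dimension. The remaining digits are
    -- handled by induction for arbitrary keys and weight, which is why these are universally
    -- quantified.
    have ih := ih (fun D' h => hD D' (by simp [h]))
    have c1 : ∀ t : ℕ, (t : ℤ) / (2 * (L : ℤ)) = ((t / (2 * L) : ℕ) : ℤ) := by intro t; push_cast; rfl
    have c2 : ∀ t : ℕ, (t : ℤ) % (2 * (L : ℤ)) = ((t % (2 * L) : ℕ) : ℤ) := by intro t; push_cast; rfl
    have c3 : ∀ t : ℕ, (t : ℤ) / (L : ℤ) = ((t / L : ℕ) : ℤ) := by intro t; push_cast; rfl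
    have c4 : ∀ t : ℕ, (t : ℤ) % (L : ℤ) = ((t % L : ℕ) : ℤ) := by intro t; push_cast; rfl
    simp only [List.map_cons, evWt, evKey, quKey, List.length_cons, pow_succ', List.prod_cons,
      c1, c2, c3, c4]
    have s1 := fun t' : ℕ => sum_range_mul_mod_div (2 * L) ((2 * L) ^ r.length) (fun d t : ℕ =>
      evWt L (r.map Prod.fst) t
      (wt * ((D.1.1 + (d : ℤ) % 2 * (D.1.2 - D.1.1)) / 2 ^ ((d : ℤ) / 2).toNat % 2) *
        (1 - 2 * ((d : ℤ) % 2))) *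
      ind (evKey L X (r.map Prod.fst) t ((key * X + (d : ℤ) / 2) * X +
        (D.1.1 + (d : ℤ) % 2 * (D.1.2 - D.1.1)) / 2 ^ ((d : ℤ) / 2).toNat) =
        quKey L X (r.map Prod.snd) ((t' / L : ℕ) : ℤ)
        ((key' * X + ((t' % L : ℕ) : ℤ)) * X + (D.2 / 2 ^ (((t' % L : ℕ) : ℤ)).toNat + 1))))
    simp only [s1]
    have s2 := sum_range_mul_mod_div L (L ^ r.length) (fun l' t' : ℕ =>
      ∑ d ∈ Finset.range (2 * L), ∑ t ∈ Finset.range ((2 * L) ^ r.length),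
      evWt L (r.map Prod.fst) t
      (wt * ((D.1.1 + (d : ℤ) % 2 * (D.1.2 - D.1.1)) / 2 ^ ((d : ℤ) / 2).toNat % 2) *
        (1 - 2 * ((d : ℤ) % 2))) *
      ind (evKey L X (r.map Prod.fst) t ((key * X + (d : ℤ) / 2) * X +
        (D.1.1 + (d : ℤ) % 2 * (D.1.2 - D.1.1)) / 2 ^ ((d : ℤ) / 2).toNat) =
        quKey L X (r.map Prod.snd) (t' : ℤ)
        ((key' * X + (l' : ℤ)) * X + (D.2 / 2 ^ (l' : ℤ).toNat + 1))))
    rw [s2]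
    have s3 : ∀ l' : ℕ, ∑ t' ∈ Finset.range (L ^ r.length),
      ∑ d ∈ Finset.range (2 * L), ∑ t ∈ Finset.range ((2 * L) ^ r.length),
      evWt L (r.map Prod.fst) t
      (wt * ((D.1.1 + (d : ℤ) % 2 * (D.1.2 - D.1.1)) / 2 ^ ((d : ℤ) / 2).toNat % 2) *
        (1 - 2 * ((d : ℤ) % 2))) *
      ind (evKey L X (r.map Prod.fst) t ((key * X + (d : ℤ) / 2) * X +
        (D.1.1 + (d : ℤ) % 2 * (D.1.2 - D.1.1)) / 2 ^ ((d : ℤ) / 2).toNat) =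
        quKey L X (r.map Prod.snd) (t' : ℤ)
        ((key' * X + (l' : ℤ)) * X + (D.2 / 2 ^ (l' : ℤ).toNat + 1))) =
      wt * (r.map fun D => ind (D.2 < D.1.1) - ind (D.2 < D.1.2)).prod *
      ∑ d ∈ Finset.range (2 * L),
      ((D.1.1 + (d : ℤ) % 2 * (D.1.2 - D.1.1)) / 2 ^ ((d : ℤ) / 2).toNat % 2) *
        (1 - 2 * ((d : ℤ) % 2)) *
      ind ((key * X + (d : ℤ) / 2) * X +
        (D.1.1 + (d : ℤ) % 2 * (D.1.2 - D.1.1)) / 2 ^ ((d : ℤ) / 2).toNat =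
        (key' * X + (l' : ℤ)) * X + (D.2 / 2 ^ (l' : ℤ).toNat + 1)) := by
      intro l'
      rw [Finset.sum_comm, Finset.mul_sum]
      refine Finset.sum_congr rfl fun d _ => ?_
      rw [ih]; ring
    simp only [s3]
    rw [← Finset.mul_sum, sum_one_digit L X hL hX D.1 D.2 hD0.1 hD0.2.1 hD0.2.2]
    ring

/-! ## Lattice geometry in the coordinates `(φ × u, ψ × u)` -/

/-- The four functionals bounding a truncated tile, in the coordinates `(φ × u, ψ × u)`. -/
def lin (φ ψ : Pt) : ℕ → ℤ → ℤ → ℤ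
  | 0, a, _ => a
  | 1, _, b => b
  | 2, a, b => a * ψ.1 - b * φ.1
  | _, a, b => a * ψ.2 - b * φ.2

def fn (φ ψ : Pt) (k : ℕ) (u : Pt) : ℤ := lin φ ψ k (cross φ u) (cross ψ u)

/-- Cramer's rule: the sides of an axis-parallel box become bounds on linear functionals of the two
cross products. -/
lemma fn_two (φ ψ u : Pt) : fn φ ψ 2 u = cross φ ψ * u.1 := by
  simp only [fn, lin, cross]; ring

lemma fn_three (φ ψ u : Pt) : fn φ ψ 3 u = cross φ ψ * u.2 := by
  simp only [fn, lin, cross]; ring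

lemma lin_sub (φ ψ : Pt) (k : ℕ) (a b a' b' : ℤ) :
    lin φ ψ k (a - a') (b - b') = lin φ ψ k a b - lin φ ψ k a' b' := by
  unfold lin; split <;> ring

lemma cross_sub (φ u v : Pt) : cross φ (u - v) = cross φ u - cross φ v := by
  simp only [cross, Prod.fst_sub, Prod.snd_sub]; ring

lemma cross_self (φ : Pt) : cross φ φ = 0 := by simp only [cross]; ring

lemma cross_swap (φ ψ : Pt) : cross ψ φ = -cross φ ψ := by simp only [cross]; ring

section
variable {φ ψ : Pt}

lemma eq_of_cross (hd : 0 < cross φ ψ) {u v : Pt} (h1 : cross φ u = cross φ v)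
    (h2 : cross ψ u = cross ψ v) : u = v := by
  have e2 := fn_two φ ψ u
  have e2' := fn_two φ ψ v
  have e3 := fn_three φ ψ u
  have e3' := fn_three φ ψ v
  simp only [fn, h1, h2] at e2 e3 e2' e3'
  ext
  · exact mul_left_cancel₀ hd.ne' (e2.symm.trans e2')
  · exact mul_left_cancel₀ hd.ne' (e3.symm.trans e3')

/-- Lattice steps move the two coordinates independently: adding `ψ` changes only the first, by
`cross φ ψ`, and adding `φ` only the second, by its negative. -/
lemma exists_point {w : Pt} {A B : ℤ} (h1 : cross φ ψ ∣ A - cross φ w)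
    (h2 : cross φ ψ ∣ B - cross ψ w) : ∃ c, cross φ c = A ∧ cross ψ c = B ∧
      ∃ s t : ℤ, c - w = s • φ + t • ψ := by
  obtain ⟨t, ht⟩ := h1
  obtain ⟨s, hs⟩ := h2
  refine ⟨w + ((-s) • φ + t • ψ), ?_, ?_, -s, t, by simp⟩
  · simp only [cross, Prod.fst_add, Prod.snd_add, Prod.smul_fst, Prod.smul_snd, smul_eq_mul] at *
    linear_combination -ht
  · simp only [cross, Prod.fst_add, Prod.snd_add, Prod.smul_fst, Prod.smul_snd, smul_eq_mul] at *
    linear_combination -hs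

lemma latticeCongruent_iff (hd : 0 < cross φ ψ) (u v : Pt) : LatticeCongruent φ ψ u v ↔
    cross φ ψ ∣ cross φ u - cross φ v ∧ cross φ ψ ∣ cross ψ u - cross ψ v := by
  constructor
  · rintro ⟨s, t, h⟩
    rw [← cross_sub, ← cross_sub, h]
    refine ⟨⟨t, ?_⟩, ⟨-s, ?_⟩⟩ <;>
    · simp only [cross, Prod.fst_add, Prod.snd_add, Prod.smul_fst, Prod.smul_snd, smul_eq_mul]
      ring
  · rintro ⟨h1, h2⟩
    obtain ⟨c, c1, c2, c3⟩ := exists_point h1 h2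
    rwa [eq_of_cross hd c1 c2] at c3

/-- A coset restricted to bounds on the functionals contained in a set of indices `I`. -/
def InHull (φ ψ : Pt) (n : ℕ) (lo hi : ℕ → ℤ) (a b : ℤ) : Prop :=
  cross φ ψ ∣ a - lo 0 ∧ cross φ ψ ∣ b - lo 1 ∧
    ∀ k < n, lo k ≤ lin φ ψ k a b ∧ lin φ ψ k a b ≤ hi k

/-- `lo` and `hi` are the tight bounds of the functionals on `V`. -/
def IsHull (φ ψ : Pt) (V : Set Pt) (lo hi : ℕ → ℤ) : Prop :=
  ∀ k < 4, IsLeast (fn φ ψ k '' V) (lo k) ∧ IsGreatest (fn φ ψ k '' V) (hi k)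

lemma IsHull.le {V : Set Pt} {lo hi : ℕ → ℤ} (h : IsHull φ ψ V lo hi) {k : ℕ} (hk : k < 4) :
    lo k ≤ hi k := (h k hk).1.2 (h k hk).2.1

/-- The minima `lo 0` and `lo 1` may be attained at different points, but all points of `V` share
their residues, so the two minima together still identify the coset. -/
lemma coset_of_hull (hd : 0 < cross φ ψ) {V : Set Pt} {γ : Pt}
    (hV : ∀ v ∈ V, LatticeCongruent φ ψ v γ) {lo hi : ℕ → ℤ} (h : IsHull φ ψ V lo hi) (u : Pt) :
    LatticeCongruent φ ψ u γ ↔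
      cross φ ψ ∣ cross φ u - lo 0 ∧ cross φ ψ ∣ cross ψ u - lo 1 := by
  obtain ⟨v0, hv0, e0⟩ := (h 0 (by norm_num)).1.1
  obtain ⟨v1, hv1, e1⟩ := (h 1 (by norm_num)).1.1
  have c0 := (latticeCongruent_iff hd _ _).1 (hV v0 hv0)
  have c1 := (latticeCongruent_iff hd _ _).1 (hV v1 hv1)
  rw [latticeCongruent_iff hd, ← e0, ← e1]
  simp only [fn, lin]
  rw [← dvd_sub_left_iff c0.1, ← dvd_sub_left_iff c1.2]
  simp
where
  dvd_sub_left_iff {d x y z : ℤ} (h : d ∣ y - z) : (d ∣ x - z - (y - z)) ↔ d ∣ x - z := by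
    rw [dvd_sub_left h]

/-- The defining bounds of tile and box hold at the points of `V` where the functionals are
extremal, hence wherever the functionals lie between their extremes. So the unknown bounds may be
replaced by those read off from a list of points. -/
lemma mem_truncatedSubtile_iff (hd : 0 < cross φ ψ) {V : Set Pt}
    (hV : IsTruncatedSubtile φ ψ V) {lo hi : ℕ → ℤ} (h : IsHull φ ψ V lo hi) (u : Pt) :
    u ∈ V ↔ InHull φ ψ 4 lo hi (cross φ u) (cross ψ u) := by
  obtain ⟨U, γ, ⟨x₀, x₁, y₀, y₁, φ₀, φ₁, ψ₀, ψ₁, hU, -, -⟩, hVU⟩ := hV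
  have hc := coset_of_hull hd (V := V) (γ := γ) (fun v hv => by rw [hVU] at hv; exact hv.2) h u
  have hm : ∀ v ∈ V, v ∈ box x₀ x₁ y₀ y₁ ∧ v ∈ parallelogram φ ψ φ₀ φ₁ ψ₀ ψ₁ := by
    intro v hv
    rw [hVU, hU] at hv
    exact hv.1
  constructor
  · intro hu
    have hu' := hu
    rw [hVU] at hu'
    obtain ⟨h1, h2⟩ := hc.1 hu'.2
    exact ⟨h1, h2, fun k hk => ⟨(h k hk).1.2 ⟨u, hu, rfl⟩, (h k hk).2.2 ⟨u, hu, rfl⟩⟩⟩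
  · rintro ⟨h1, h2, h3⟩
    rw [hVU, hU]
    refine ⟨⟨?_, ?_⟩, hc.2 ⟨h1, h2⟩⟩
    · obtain ⟨v, hv, ev⟩ := (h 2 (by norm_num)).1.1
      obtain ⟨v', hv', ev'⟩ := (h 2 (by norm_num)).2.1
      obtain ⟨w, hw, ew⟩ := (h 3 (by norm_num)).1.1
      obtain ⟨w', hw', ew'⟩ := (h 3 (by norm_num)).2.1
      have b2 : lo 2 ≤ fn φ ψ 2 u ∧ fn φ ψ 2 u ≤ hi 2 := h3 2 (by norm_num)
      have b3 : lo 3 ≤ fn φ ψ 3 u ∧ fn φ ψ 3 u ≤ hi 3 := h3 3 (by norm_num)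
      rw [← ev, ← ev', fn_two, fn_two, fn_two] at b2
      rw [← ew, ← ew', fn_three, fn_three, fn_three] at b3
      refine ⟨(hm v hv).1.1.trans ?_, le_trans ?_ (hm v' hv').1.2.1,
        (hm w hw).1.2.2.1.trans ?_, le_trans ?_ (hm w' hw').1.2.2.2⟩
      · exact WithBot.coe_le_coe.2 (le_of_mul_le_mul_left b2.1 hd)
      · exact WithTop.coe_le_coe.2 (le_of_mul_le_mul_left b2.2 hd)
      · exact WithBot.coe_le_coe.2 (le_of_mul_le_mul_left b3.1 hd)
      · exact WithTop.coe_le_coe.2 (le_of_mul_le_mul_left b3.2 hd)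
    · obtain ⟨v, hv, ev⟩ := (h 0 (by norm_num)).1.1
      obtain ⟨v', hv', ev'⟩ := (h 0 (by norm_num)).2.1
      obtain ⟨w, hw, ew⟩ := (h 1 (by norm_num)).1.1
      obtain ⟨w', hw', ew'⟩ := (h 1 (by norm_num)).2.1
      have b0 : lo 0 ≤ cross φ u ∧ cross φ u ≤ hi 0 := h3 0 (by norm_num)
      have b1 : lo 1 ≤ cross ψ u ∧ cross ψ u ≤ hi 1 := h3 1 (by norm_num)
      rw [← ev, ← ev'] at b0
      rw [← ew, ← ew'] at b1
      exact ⟨(hm v hv).2.1.trans b0.1, b0.2.trans (hm v' hv').2.2.1,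
        (hm w hw).2.2.2.1.trans b1.1, b1.2.trans (hm w' hw').2.2.2.2⟩

lemma mem_subtile_iff (hd : 0 < cross φ ψ) {V : Set Pt}
    (hV : IsSubtile φ ψ V) {lo hi : ℕ → ℤ} (h : IsHull φ ψ V lo hi) (u : Pt) :
    u ∈ V ↔ InHull φ ψ 2 lo hi (cross φ u) (cross ψ u) := by
  obtain ⟨U, γ, ⟨φ₀, φ₁, ψ₀, ψ₁, hU⟩, hVU⟩ := hV
  have hc := coset_of_hull hd (V := V) (γ := γ) (fun v hv => by rw [hVU] at hv; exact hv.2) h u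
  have hm : ∀ v ∈ V, v ∈ parallelogram φ ψ φ₀ φ₁ ψ₀ ψ₁ := by
    intro v hv
    rw [hVU, hU] at hv
    exact hv.1
  constructor
  · intro hu
    have hu' := hu
    rw [hVU] at hu'
    obtain ⟨h1, h2⟩ := hc.1 hu'.2
    exact ⟨h1, h2, fun k hk => ⟨(h k (by omega)).1.2 ⟨u, hu, rfl⟩,
      (h k (by omega)).2.2 ⟨u, hu, rfl⟩⟩⟩
  · rintro ⟨h1, h2, h3⟩
    rw [hVU, hU]
    refine ⟨?_, hc.2 ⟨h1, h2⟩⟩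
    obtain ⟨v, hv, ev⟩ := (h 0 (by norm_num)).1.1
    obtain ⟨v', hv', ev'⟩ := (h 0 (by norm_num)).2.1
    obtain ⟨w, hw, ew⟩ := (h 1 (by norm_num)).1.1
    obtain ⟨w', hw', ew'⟩ := (h 1 (by norm_num)).2.1
    have b0 : lo 0 ≤ cross φ u ∧ cross φ u ≤ hi 0 := h3 0 (by norm_num)
    have b1 : lo 1 ≤ cross ψ u ∧ cross ψ u ≤ hi 1 := h3 1 (by norm_num)
    rw [← ev, ← ev'] at b0
    rw [← ew, ← ew'] at b1
    exact ⟨(hm v hv).1.trans b0.1, b0.2.trans (hm v' hv').2.1,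
      (hm w hw).2.2.1.trans b1.1, b1.2.trans (hm w' hw').2.2.2⟩

/-- First coordinate of a corner of a subtile, `e ∈ {0, 1}`. -/
def cornerA (φ ψ : Pt) (lo hi : ℕ → ℤ) (e : ℤ) : ℤ := lo 0 + e * (hi 0 + cross φ ψ - lo 0)

/-- Second coordinate of a corner of a subtile, `e ∈ {0, 1}`. -/
def cornerB (φ ψ : Pt) (lo hi : ℕ → ℤ) (e : ℤ) : ℤ := hi 1 + e * (lo 1 - cross φ ψ - hi 1)

/-- On a progression of step `d` the indicator of an interval jumps only at its first point and one
step beyond its last. -/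
lemma ind_diff {d l h a : ℤ} (hd : 0 < d) (hle : l ≤ h) (h1 : d ∣ a - l) (h2 : d ∣ h - l) :
    ind (l ≤ a ∧ a ≤ h) - ind (l ≤ a - d ∧ a - d ≤ h) = ind (a = l) - ind (a = h + d) := by
  obtain ⟨x, hx⟩ := h1
  obtain ⟨y, hy⟩ := h2
  obtain rfl : a = l + d * x := by linarith
  obtain rfl : h = l + d * y := by linarith
  have e1 : l ≤ l + d * x ↔ 0 ≤ x := by simp [hd]
  have e2 : l + d * x ≤ l + d * y ↔ x ≤ y := by simp [hd]
  have e3 : l ≤ l + d * x - d ↔ 1 ≤ x := by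
    rw [show l + d * x - d = l + d * (x - 1) by ring]; simp [hd]
  have e4 : l + d * x - d ≤ l + d * y ↔ x ≤ y + 1 := by
    rw [show l + d * x - d = l + d * (x - 1) by ring]; simp [hd]
  have e5 : l + d * x = l ↔ x = 0 := by simp [hd.ne']
  have e6 : l + d * x = l + d * y + d ↔ x = y + 1 := by
    rw [show l + d * y + d = l + d * (y + 1) by ring]; simp [hd.ne']
  have e7 : 0 ≤ y := by
    by_contra hc
    have : d * y < 0 := mul_neg_of_pos_of_neg hd (by omega)
    linarith
  simp only [e1, e2, e3, e4, e5, e6, ind]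
  split_ifs <;> omega

open Classical in
-- On the coset the indicator is a product of an interval in `φ × u` and one in `ψ × u`, so the
-- mixed difference is the product of two one-dimensional differences, each with two jumps.
lemma subtile_diff (hd : 0 < cross φ ψ) {S : Set Pt} (hS : IsSubtile φ ψ S) {lo hi : ℕ → ℤ}
    (h : IsHull φ ψ S lo hi) (u : Pt) :
    ind (u ∈ S) - ind (u - φ ∈ S) - ind (u - ψ ∈ S) + ind (u - φ - ψ ∈ S) =
    ∑ e₀ ∈ Finset.range 2, ∑ e₁ ∈ Finset.range 2, (1 - 2 * (e₀ : ℤ)) * (1 - 2 * (e₁ : ℤ)) *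
      ind (cross φ u = cornerA φ ψ lo hi e₀ ∧ cross ψ u = cornerB φ ψ lo hi e₁) := by
  set d := cross φ ψ with hdd
  have l0 : lo 0 ≤ hi 0 := h.le (by norm_num)
  have l1 : lo 1 ≤ hi 1 := h.le (by norm_num)
  obtain ⟨v', hv', ev'⟩ := (h 0 (by norm_num)).2.1
  obtain ⟨w', hw', ew'⟩ := (h 1 (by norm_num)).2.1
  have hv2 := (mem_subtile_iff hd hS h v').1 hv'
  have hw2 := (mem_subtile_iff hd hS h w').1 hw'
  simp only [fn, lin] at ev' ew'
  have d0 : d ∣ hi 0 - lo 0 := by rw [← ev']; exact hv2.1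
  have d1 : d ∣ hi 1 - lo 1 := by rw [← ew']; exact hw2.2.1
  have key : ∀ v : Pt, ind (v ∈ S) = ind (d ∣ cross φ v - lo 0 ∧ d ∣ cross ψ v - lo 1) *
      ind (lo 0 ≤ cross φ v ∧ cross φ v ≤ hi 0) * ind (lo 1 ≤ cross ψ v ∧ cross ψ v ≤ hi 1) := by
    intro v
    rw [← ind_and, ← ind_and]
    apply ind_congr
    rw [mem_subtile_iff hd hS h]
    constructor
    · rintro ⟨h1, h2, h3⟩
      exact ⟨⟨⟨h1, h2⟩, h3 0 (by norm_num)⟩, h3 1 (by norm_num)⟩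
    · rintro ⟨⟨⟨h1, h2⟩, h3⟩, h4⟩
      refine ⟨h1, h2, fun k hk => ?_⟩
      interval_cases k
      · exact h3
      · exact h4
  rw [key, key, key, key]
  -- Subtracting `ψ` lowers `φ × u` by `d`; subtracting `φ` raises `ψ × u` by `d`. The opposite
  -- signs explain the asymmetry between `cornerA` and `cornerB`.
  simp only [cross_sub, cross_self, cross_swap φ ψ, ← hdd, sub_zero, sub_neg_eq_add]
  set a := cross φ u
  set b := cross ψ u
  have c1 : ∀ x : ℤ, d ∣ x + d ↔ d ∣ x := fun x => by simp
  have c2 : ∀ x : ℤ, d ∣ x - d ↔ d ∣ x := fun x => by simp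
  have c3 : ∀ x y : ℤ, d ∣ x + d - y ↔ d ∣ x - y := fun x y => by
    rw [← c1 (x - y)]; ring_nf
  have c4 : ∀ x y : ℤ, d ∣ x - d - y ↔ d ∣ x - y := fun x y => by
    rw [← c2 (x - y)]; ring_nf
  simp only [c3, c4]
  simp only [Finset.sum_range_succ, Finset.sum_range_zero, Nat.cast_zero, Nat.cast_one, cornerA,
    cornerB, ind_and (p := a = _), ← hdd]
  have r1 : lo 0 + 1 * (hi 0 + d - lo 0) = hi 0 + d := by ring
  have r2 : hi 1 + 1 * (lo 1 - d - hi 1) = lo 1 - d := by ring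
  simp only [r1, r2, zero_mul, add_zero]
  by_cases hC : d ∣ a - lo 0 ∧ d ∣ b - lo 1
  · have i0 := ind_diff hd l0 hC.1 d0
    have i1 := ind_diff (l := lo 1) (h := hi 1) (a := b + d) hd l1 ((c3 _ _).2 hC.2) d1
    rw [add_sub_cancel_right] at i1
    have i2 : ind (b + d = lo 1) = ind (b = lo 1 - d) := ind_congr (by omega)
    have i3 : ind (b + d = hi 1 + d) = ind (b = hi 1) := ind_congr (by omega)
    rw [i2, i3] at i1
    have i4 : ind (d ∣ a - lo 0 ∧ d ∣ b - lo 1) = 1 := by simp [ind, hC]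
    rw [i4]
    linear_combination (ind (lo 1 ≤ b ∧ b ≤ hi 1) - ind (lo 1 ≤ b + d ∧ b + d ≤ hi 1)) * i0 -
      (ind (a = lo 0) - ind (a = hi 0 + d)) * i1
  -- Off the coset the left side is zero, and so is the right side, because all four corners have
  -- the residues of the coset.
  · have i4 : ind (d ∣ a - lo 0 ∧ d ∣ b - lo 1) = 0 := by simp [ind, hC]
    rw [i4]
    have z : ∀ A B : ℤ, d ∣ A - lo 0 → d ∣ B - lo 1 → ind (a = A) * ind (b = B) = 0 := by
      intro A B hA hB
      rw [← ind_and]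
      unfold ind
      rw [if_neg]
      rintro ⟨rfl, rfl⟩
      exact hC ⟨hA, hB⟩
    have z1 := z (lo 0) (hi 1) (by simp) d1
    have z2 := z (lo 0) (lo 1 - d) (by simp) ((c4 _ _).2 (by simp))
    have z3 := z (hi 0 + d) (hi 1) ((c3 _ _).2 d0) d1
    have z4 := z (hi 0 + d) (lo 1 - d) ((c3 _ _).2 d0) ((c4 _ _).2 (by simp))
    linear_combination -z1 + z2 + z3 - z4

open Classical in
/-- The second difference of the cross-correlation of a subtile and another set. -/
lemma correlation_diff (hd : 0 < cross φ ψ) {S : Set Pt} (hS : IsSubtile φ ψ S)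
    {lo hi : ℕ → ℤ} (h : IsHull φ ψ S lo hi) (V : Finset Pt) (hV : IsTruncatedSubtile φ ψ V)
    {lo' hi' : ℕ → ℤ} (h' : IsHull φ ψ V lo' hi') (q : Pt) :
    (∑ v ∈ V, ind (v + q ∈ S)) - (∑ v ∈ V, ind (v + (q - φ) ∈ S)) -
      (∑ v ∈ V, ind (v + (q - ψ) ∈ S)) + (∑ v ∈ V, ind (v + (q - φ - ψ) ∈ S)) =
    ∑ e₀ ∈ Finset.range 2, ∑ e₁ ∈ Finset.range 2, (1 - 2 * (e₀ : ℤ)) * (1 - 2 * (e₁ : ℤ)) *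
      ind (InHull φ ψ 4 lo' hi' (cornerA φ ψ lo hi e₀ - cross φ q)
        (cornerB φ ψ lo hi e₁ - cross ψ q)) := by
  have e1 : (∑ v ∈ V, ind (v + q ∈ S)) - (∑ v ∈ V, ind (v + (q - φ) ∈ S)) -
      (∑ v ∈ V, ind (v + (q - ψ) ∈ S)) + (∑ v ∈ V, ind (v + (q - φ - ψ) ∈ S)) =
      ∑ v ∈ V, (ind (v + q ∈ S) - ind (v + q - φ ∈ S) - ind (v + q - ψ ∈ S) +
        ind (v + q - φ - ψ ∈ S)) := by
    simp only [Finset.sum_add_distrib, Finset.sum_sub_distrib, add_sub_assoc]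
  rw [e1, Finset.sum_congr rfl fun v _ => subtile_diff hd hS h (v + q), Finset.sum_comm]
  refine Finset.sum_congr rfl fun e₀ he₀ => ?_
  rw [Finset.sum_comm]
  refine Finset.sum_congr rfl fun e₁ he₁ => ?_
  rw [← Finset.mul_sum]
  congr 1
  obtain ⟨v', hv', ev'⟩ := (h 0 (by norm_num)).2.1
  obtain ⟨w', hw', ew'⟩ := (h 1 (by norm_num)).2.1
  have hv2 := (mem_subtile_iff hd hS h v').1 hv'
  have hw2 := (mem_subtile_iff hd hS h w').1 hw'
  simp only [fn, lin] at ev' ew'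
  -- The corner coordinates have the residues of `S`, hence belong to an integer point `c`. Then `v
  -- + q` is the corner for exactly one `v`, namely `c - q`.
  obtain ⟨c, c1, c2, -⟩ := exists_point (φ := φ) (ψ := ψ) (w := v') (A := cornerA φ ψ lo hi e₀)
    (B := cornerB φ ψ lo hi e₁) (by
      unfold cornerA
      rw [ev']
      have := hv2.1
      rw [ev'] at this
      have h2 := Finset.mem_range.1 he₀
      interval_cases e₀
      · rw [← dvd_neg]; simpa using this
      · simp) (by
      have a1 := hw2.2.1
      have a2 := hv2.2.1
      rw [ew'] at a1
      have h2 := Finset.mem_range.1 he₁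
      unfold cornerB
      interval_cases e₁
      · simpa using dvd_sub a1 a2
      · rw [← dvd_neg]; convert dvd_add a2 (dvd_refl _) using 1; push_cast; ring)
  have e2 : ∀ v : Pt, ind (cross φ (v + q) = cornerA φ ψ lo hi e₀ ∧
      cross ψ (v + q) = cornerB φ ψ lo hi e₁) = if v = c - q then 1 else 0 := by
    intro v
    unfold ind
    congr 1
    rw [eq_iff_iff, ← c1, ← c2]
    constructor
    · rintro ⟨h1, h2⟩
      rw [← eq_of_cross hd h1 h2]; simp
    · rintro rfl; simp
  simp only [e2, Finset.sum_ite_eq']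
  have e3 := mem_truncatedSubtile_iff hd hV h' (c - q)
  rw [cross_sub, cross_sub, c1, c2, Finset.mem_coe] at e3
  unfold ind
  simp only [← e3]

end

/-! ## Updates of the table for one pair of strings -/

section
variable (φ ψ : Pt) (O : ℤ)

/-- The two thresholds for each functional in the update for a corner `(a, b)`. -/
def thr (lo hi : ℕ → ℤ) (a b : ℤ) (k : ℕ) : ℤ × ℤ :=
  (O + lin φ ψ k a b - lo k + 1, O + lin φ ψ k a b - hi k)

/-- The residues that the two cross products of a query must have. Adding `O` makes the dividends
nonnegative, as the remainder of the machine requires. -/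
def evBase (X : ℤ) (lo : ℕ → ℤ) (a b : ℤ) : ℤ :=
  (a - lo 0 + O) % cross φ ψ * X + (b - lo 1 + O) % cross φ ψ

def quBase (X : ℤ) (a b : ℤ) : ℤ := (a + O) % cross φ ψ * X + (b + O) % cross φ ψ

def dims : List ℕ := [0, 1, 2, 3]

/-- The key of the update number `t` for the pair with bounds `lo`, `hi` (of `V`) and
`lo'`, `hi'` (of `S`). -/
def pairKey (L : ℕ) (X : ℤ) (lo hi lo' hi' : ℕ → ℤ) (t : ℤ) : ℤ :=
  evKey L X (dims.map (thr φ ψ O lo hi (cornerA φ ψ lo' hi' (t % 2))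
    (cornerB φ ψ lo' hi' (t / 2 % 2)))) (t / 2 / 2)
    (evBase φ ψ O X lo (cornerA φ ψ lo' hi' (t % 2)) (cornerB φ ψ lo' hi' (t / 2 % 2)))

def pairWt (L : ℕ) (lo hi lo' hi' : ℕ → ℤ) (t : ℤ) : ℤ :=
  evWt L (dims.map (thr φ ψ O lo hi (cornerA φ ψ lo' hi' (t % 2))
    (cornerB φ ψ lo' hi' (t / 2 % 2)))) (t / 2 / 2) ((1 - 2 * (t % 2)) * (1 - 2 * (t / 2 % 2)))

def pointKey (L : ℕ) (X : ℤ) (a b : ℤ) (t : ℤ) : ℤ :=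
  quKey L X (dims.map fun k => lin φ ψ k a b + O) t (quBase φ ψ O X a b)

/-- The number of updates for a pair. -/
def pairCount (L : ℕ) : ℕ := 2 * (2 * (2 * L) ^ 4)

/-- What one pair contributes to the table. -/
def pairTab (L : ℕ) (X : ℤ) (lo hi lo' hi' : ℕ → ℤ) (key : ℤ) : ℤ :=
  ∑ t ∈ Finset.range (pairCount L), pairWt φ ψ O L lo hi lo' hi' t *
    ind (pairKey φ ψ O L X lo hi lo' hi' t = key)

end

open Classical in
-- The two lowest bits of the update counter choose the corner. For a fixed corner `sum_table`
-- produces the product of four interval indicators, and equality of the initial key digits supplies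
-- the two congruences.
lemma sum_pairTab {φ ψ : Pt} (hd : 0 < cross φ ψ) {O X B : ℤ} {L : ℕ} (hL : (L : ℤ) < X)
    (hX : 2 ^ L < X) (hO : 2 * O ≤ 2 ^ L) (hB : 2 * B + 1 < O) (hdX : cross φ ψ ≤ X)
    {lo hi lo' hi' : ℕ → ℤ} {a' b' : ℤ}
    (hlo : ∀ k < 4, |lo k| ≤ B) (hhi : ∀ k < 4, |hi k| ≤ B) (hlh : ∀ k < 4, lo k ≤ hi k)
    (hc : ∀ e₀ < 2, ∀ e₁ < 2, ∀ k < 4,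
      |lin φ ψ k (cornerA φ ψ lo' hi' (e₀ : ℕ)) (cornerB φ ψ lo' hi' (e₁ : ℕ))| ≤ B)
    (hq : ∀ k < 4, |lin φ ψ k a' b'| ≤ B) :
    ∑ t' ∈ Finset.range (L ^ 4),
      pairTab φ ψ O L X lo hi lo' hi' (pointKey φ ψ O L X a' b' (t' : ℕ)) =
    ∑ e₀ ∈ Finset.range 2, ∑ e₁ ∈ Finset.range 2, (1 - 2 * (e₀ : ℤ)) * (1 - 2 * (e₁ : ℤ)) *
      ind (InHull φ ψ 4 lo hi (cornerA φ ψ lo' hi' e₀ - a') (cornerB φ ψ lo' hi' e₁ - b')) := by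
  unfold pairTab pairCount pairKey pairWt pointKey
  have c1 : ∀ t : ℕ, (t : ℤ) / 2 = ((t / 2 : ℕ) : ℤ) := by intro t; push_cast; rfl
  have c2 : ∀ t : ℕ, (t : ℤ) % 2 = ((t % 2 : ℕ) : ℤ) := by intro t; push_cast; rfl
  simp only [c1, c2]
  have s1 := fun t' : ℕ => sum_range_mul_mod_div 2 (2 * (2 * L) ^ 4) (fun e₀ t : ℕ =>
    evWt L (dims.map (thr φ ψ O lo hi (cornerA φ ψ lo' hi' e₀)
    (cornerB φ ψ lo' hi' (t % 2 : ℕ)))) (t / 2 : ℕ) ((1 - 2 * (e₀ : ℤ)) * (1 - 2 * (t % 2 : ℕ))) *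
    ind (evKey L X (dims.map (thr φ ψ O lo hi (cornerA φ ψ lo' hi' e₀)
      (cornerB φ ψ lo' hi' (t % 2 : ℕ)))) (t / 2 : ℕ)
      (evBase φ ψ O X lo (cornerA φ ψ lo' hi' e₀) (cornerB φ ψ lo' hi' (t % 2 : ℕ))) =
      quKey L X (dims.map fun k => lin φ ψ k a' b' + O) t' (quBase φ ψ O X a' b')))
  have s2 := fun t' e₀ : ℕ => sum_range_mul_mod_div 2 ((2 * L) ^ 4) (fun e₁ t : ℕ =>
    evWt L (dims.map (thr φ ψ O lo hi (cornerA φ ψ lo' hi' e₀)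
    (cornerB φ ψ lo' hi' e₁))) t ((1 - 2 * (e₀ : ℤ)) * (1 - 2 * e₁)) *
    ind (evKey L X (dims.map (thr φ ψ O lo hi (cornerA φ ψ lo' hi' e₀)
      (cornerB φ ψ lo' hi' e₁))) t
      (evBase φ ψ O X lo (cornerA φ ψ lo' hi' e₀) (cornerB φ ψ lo' hi' e₁)) =
      quKey L X (dims.map fun k => lin φ ψ k a' b' + O) t' (quBase φ ψ O X a' b')))
  simp only [s1, s2]
  rw [Finset.sum_comm]
  refine Finset.sum_congr rfl fun e₀ he₀ => ?_
  rw [Finset.sum_comm]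
  refine Finset.sum_congr rfl fun e₁ he₁ => ?_
  have he₀ := Finset.mem_range.1 he₀
  have he₁ := Finset.mem_range.1 he₁
  set A := cornerA φ ψ lo' hi' e₀
  set Bc := cornerB φ ψ lo' hi' e₁
  have hab : ∀ k < 4, |lin φ ψ k A Bc| ≤ B := hc e₀ he₀ e₁ he₁
  have s3 := sum_table L X hL hX (dims.map fun k => (thr φ ψ O lo hi A Bc k, lin φ ψ k a' b' + O))
    (by
      intro D hD
      obtain ⟨k, hk, rfl⟩ := List.mem_map.1 hD
      have hk : k < 4 := by simp [dims] at hk; omega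
      have h1 := abs_le.1 (hab k hk)
      have h2 := abs_le.1 (hq k hk)
      have h3 := abs_le.1 (hlo k hk)
      have h4 := abs_le.1 (hhi k hk)
      simp only [thr]
      omega) (evBase φ ψ O X lo A Bc) (quBase φ ψ O X a' b') ((1 - 2 * (e₀ : ℤ)) * (1 - 2 * e₁))
  simp only [List.map_map, Function.comp_def, List.length_map] at s3
  rw [show dims.length = 4 from rfl] at s3
  rw [s3, mul_assoc]
  congr 1
  -- Seen from the query, the closed interval for `corner - query` is a half-open interval, a
  -- difference of two initial segments. The `+ 1` in the first threshold makes the end belonging to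
  -- `lo` inclusive.
  have r1 : ∀ k < 4, ind (lin φ ψ k a' b' + O < (thr φ ψ O lo hi A Bc k).1) -
      ind (lin φ ψ k a' b' + O < (thr φ ψ O lo hi A Bc k).2) =
      ind (lo k ≤ lin φ ψ k (A - a') (Bc - b') ∧ lin φ ψ k (A - a') (Bc - b') ≤ hi k) := by
    intro k hk
    have h5 := hlh k hk
    rw [lin_sub]
    simp only [thr, ind]
    split_ifs <;> omega
  have hm : ∀ z, 0 ≤ z % cross φ ψ ∧ z % cross φ ψ < X := fun z =>
    ⟨Int.emod_nonneg _ hd.ne', (Int.emod_lt_of_pos _ hd).trans_le hdX⟩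
  have r2 : ind (evBase φ ψ O X lo A Bc = quBase φ ψ O X a' b') =
      ind (cross φ ψ ∣ A - a' - lo 0 ∧ cross φ ψ ∣ Bc - b' - lo 1) := by
    apply ind_congr
    unfold evBase quBase
    have := digits_inj (a := 0) (a' := 0) (hm (A - lo 0 + O)) (hm (a' + O)) (hm (Bc - lo 1 + O))
      (hm (b' + O))
    simp only [zero_mul, zero_add, true_and] at this
    rw [this, Int.emod_eq_emod_iff_emod_sub_eq_zero, Int.emod_eq_emod_iff_emod_sub_eq_zero,
      ← Int.dvd_iff_emod_eq_zero, ← Int.dvd_iff_emod_eq_zero]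
    have q1 : A - lo 0 + O - (a' + O) = A - a' - lo 0 := by ring
    have q2 : Bc - lo 1 + O - (b' + O) = Bc - b' - lo 1 := by ring
    rw [q1, q2]
  rw [r2]
  simp only [dims, List.map_cons, List.map_nil, List.prod_cons, List.prod_nil]
  rw [r1 0 (by norm_num), r1 1 (by norm_num), r1 2 (by norm_num), r1 3 (by norm_num), mul_one,
    ← ind_and, ← ind_and, ← ind_and, ← ind_and]
  apply ind_congr
  constructor
  · rintro ⟨⟨h1, h2⟩, h3, h4, h5, h6⟩
    refine ⟨h1, h2, fun k hk => ?_⟩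
    interval_cases k <;> assumption
  · rintro ⟨h1, h2, h3⟩
    exact ⟨⟨h1, h2⟩, h3 0 (by norm_num), h3 1 (by norm_num), h3 2 (by norm_num), h3 3 (by norm_num)⟩

/-! ### Size of the keys. -/

/-- Each dimension appends two digits in base `X`, a level and a dyadic prefix. -/
lemma evKey_bound {L : ℕ} {X : ℤ} (hL : (L : ℤ) < X) : ∀ (l : List (ℤ × ℤ)) (t key Y : ℤ),
    (∀ A ∈ l, (0 ≤ A.1 ∧ A.1 < X) ∧ (0 ≤ A.2 ∧ A.2 < X)) → 0 ≤ t → t < (2 * L) ^ l.length →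
    0 ≤ key → key < Y → 0 ≤ evKey L X l t key ∧ evKey L X l t key < Y * X ^ (2 * l.length) := by
  intro l
  induction l with
  | nil => intro t key Y _ _ _ h1 h2; simpa [evKey] using ⟨h1, h2⟩
  | cons A r ih =>
    intro t key Y hA ht0 ht h1 h2
    have hA0 := hA A (by simp)
    have hLp : 0 < L := by
      rcases Nat.eq_zero_or_pos L with h | h
      · subst h; simp at ht; omega
      · exact h
    have hX : 0 < X := by omega
    have m0 := Int.emod_nonneg t (b := 2 * (L : ℤ)) (by omega)
    have m1 := Int.emod_lt_of_pos t (b := 2 * (L : ℤ)) (by omega)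
    set dg := t % (2 * (L : ℤ))
    have hz : ∀ z : ℤ, 0 ≤ z ∧ z < X → ∀ j : ℕ, 0 ≤ z / 2 ^ j ∧ z / 2 ^ j < X := fun z h j =>
      ⟨Int.ediv_nonneg h.1 (by positivity), (Int.ediv_le_self _ h.1).trans_lt h.2⟩
    have hs : 0 ≤ A.1 + dg % 2 * (A.2 - A.1) ∧ A.1 + dg % 2 * (A.2 - A.1) < X := by
      rcases Int.emod_two_eq_zero_or_one dg with h | h <;> rw [h] <;> simp <;> omega
    have hs' := hz _ hs (dg / 2).toNat
    have hst : ∀ k z Y : ℤ, 0 ≤ k → k < Y → 0 ≤ z ∧ z < X → 0 ≤ k * X + z ∧ k * X + z < Y * X := by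
      intro k z Y hk hk' hz
      constructor
      · have := mul_nonneg hk hX.le; omega
      · have := mul_le_mul_of_nonneg_right (show k + 1 ≤ Y by omega) hX.le
        rw [add_mul] at this; omega
    have k1 := hst key (dg / 2) Y h1 h2 (by omega)
    have k2 := hst _ _ _ k1.1 k1.2 hs'
    have := ih (t / (2 * L)) _ _ (fun B hB => hA B (by simp [hB])) (Int.ediv_nonneg ht0 (by omega))
      (by
        rw [List.length_cons, pow_succ] at ht
        exact Int.ediv_lt_of_lt_mul (by omega) ht) k2.1 k2.2
    rw [evKey]
    refine ⟨this.1, this.2.trans_eq ?_⟩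
    rw [List.length_cons]; ring

lemma quKey_bound {L : ℕ} {X : ℤ} (hL : (L : ℤ) < X) : ∀ (l : List ℤ) (t key Y : ℤ),
    (∀ x ∈ l, 0 ≤ x ∧ x + 1 < X) → 0 ≤ t → t < (L : ℤ) ^ l.length →
    0 ≤ key → key < Y → 0 ≤ quKey L X l t key ∧ quKey L X l t key < Y * X ^ (2 * l.length) := by
  intro l
  induction l with
  | nil => intro t key Y _ _ _ h1 h2; simpa [quKey] using ⟨h1, h2⟩
  | cons x r ih =>
    intro t key Y hA ht0 ht h1 h2
    have hA0 := hA x (by simp)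
    have hLp : 0 < L := by
      rcases Nat.eq_zero_or_pos L with h | h
      · subst h; simp at ht; omega
      · exact h
    have hX : 0 < X := by omega
    have m0 := Int.emod_nonneg t (b := (L : ℤ)) (by omega)
    have m1 := Int.emod_lt_of_pos t (b := (L : ℤ)) (by omega)
    set dg := t % (L : ℤ)
    have hs' : 0 ≤ x / 2 ^ dg.toNat + 1 ∧ x / 2 ^ dg.toNat + 1 < X := by
      have : 0 ≤ x / 2 ^ dg.toNat := Int.ediv_nonneg hA0.1 (by positivity)
      have : x / 2 ^ dg.toNat ≤ x := Int.ediv_le_self _ hA0.1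
      omega
    have hst : ∀ k z Y : ℤ, 0 ≤ k → k < Y → 0 ≤ z ∧ z < X → 0 ≤ k * X + z ∧ k * X + z < Y * X := by
      intro k z Y hk hk' hz
      constructor
      · have := mul_nonneg hk hX.le; omega
      · have := mul_le_mul_of_nonneg_right (show k + 1 ≤ Y by omega) hX.le
        rw [add_mul] at this; omega
    have k1 := hst key dg Y h1 h2 (by omega)
    have k2 := hst _ _ _ k1.1 k1.2 hs'
    have := ih (t / L) _ _ (fun B hB => hA B (by simp [hB])) (Int.ediv_nonneg ht0 (by omega))
      (by
        rw [List.length_cons, pow_succ] at ht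
        exact Int.ediv_lt_of_lt_mul (by omega) ht) k2.1 k2.2
    rw [quKey]
    refine ⟨this.1, this.2.trans_eq ?_⟩
    rw [List.length_cons]; ring

/-! ## The program -/

instance : Add Ex := ⟨.op .add⟩
instance : Sub Ex := ⟨.op .sub⟩
instance : Mul Ex := ⟨.op .mul⟩
instance : Div Ex := ⟨.op .div⟩
instance : Mod Ex := ⟨.op .mod⟩
instance (k : ℕ) : OfNat Ex k := ⟨.num k⟩

section
variable (Λ : Layout) (σ : St) (a b : Ex)
@[simp] lemma ev_add : (a + b).ev Λ σ = a.ev Λ σ + b.ev Λ σ := rfl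
@[simp] lemma ev_sub : (a - b).ev Λ σ = a.ev Λ σ - b.ev Λ σ := rfl
@[simp] lemma ev_mul : (a * b).ev Λ σ = a.ev Λ σ * b.ev Λ σ := rfl
@[simp] lemma ev_div : (a / b).ev Λ σ = a.ev Λ σ / b.ev Λ σ := rfl
@[simp] lemma ev_mod : (a % b).ev Λ σ = a.ev Λ σ % b.ev Λ σ := rfl
@[simp] lemma ev_lt : (Ex.op .lt a b).ev Λ σ = if a.ev Λ σ < b.ev Λ σ then 1 else 0 := rfl
@[simp] lemma ev_shr : (Ex.op .shr a b).ev Λ σ = a.ev Λ σ / 2 ^ (b.ev Λ σ).toNat := rfl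
@[simp] lemma ev_hi : (Ex.op .hi a b).ev Λ σ = a.ev Λ σ % 2 ^ Λ.w / b.ev Λ σ := rfl
@[simp] lemma ev_lit (k : ℕ) [k.AtLeastTwo] :
    Ex.ev Λ σ (ofNat(k) : Ex) = (ofNat(k) : ℤ) := rfl
@[simp] lemma ev_zero : Ex.ev Λ σ (0 : Ex) = 0 := rfl
@[simp] lemma ev_one : Ex.ev Λ σ (1 : Ex) = 1 := rfl
@[simp] lemma ev_v (r : ℕ) : (Ex.v r).ev Λ σ = σ.var r := rfl
@[simp] lemma ev_ld (k : ℕ) : (Ex.ld k a).ev Λ σ = σ.mem k (a.ev Λ σ) := rfl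
@[simp] lemma sf_add : (a + b).sf Λ σ ↔ a.sf Λ σ ∧ b.sf Λ σ := by
  show _ ∧ _ ∧ True ↔ _; simp
@[simp] lemma sf_sub : (a - b).sf Λ σ ↔ a.sf Λ σ ∧ b.sf Λ σ := by
  show _ ∧ _ ∧ True ↔ _; simp
@[simp] lemma sf_mul : (a * b).sf Λ σ ↔ a.sf Λ σ ∧ b.sf Λ σ := by
  show _ ∧ _ ∧ True ↔ _; simp
@[simp] lemma sf_div : (a / b).sf Λ σ ↔ a.sf Λ σ ∧ b.sf Λ σ ∧ 0 ≤ a.ev Λ σ ∧ a.ev Λ σ < Λ.half ∧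
    0 ≤ b.ev Λ σ ∧ b.ev Λ σ < Λ.half := Iff.rfl
@[simp] lemma sf_mod : (a % b).sf Λ σ ↔ a.sf Λ σ ∧ b.sf Λ σ ∧ 0 ≤ a.ev Λ σ ∧ a.ev Λ σ < Λ.half ∧
    0 ≤ b.ev Λ σ ∧ b.ev Λ σ < Λ.half := Iff.rfl
@[simp] lemma sf_shr : (Ex.op .shr a b).sf Λ σ ↔ a.sf Λ σ ∧ b.sf Λ σ ∧ 0 ≤ a.ev Λ σ ∧
    a.ev Λ σ < Λ.half ∧ 0 ≤ b.ev Λ σ ∧ b.ev Λ σ < Λ.half := Iff.rfl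
@[simp] lemma sf_lt : (Ex.op .lt a b).sf Λ σ ↔ a.sf Λ σ ∧ b.sf Λ σ ∧ -Λ.half ≤ a.ev Λ σ ∧
    a.ev Λ σ < Λ.half ∧ -Λ.half ≤ b.ev Λ σ ∧ b.ev Λ σ < Λ.half := Iff.rfl
@[simp] lemma sf_hi : (Ex.op .hi a b).sf Λ σ ↔ a.sf Λ σ ∧ b.sf Λ σ ∧
    0 ≤ b.ev Λ σ ∧ b.ev Λ σ < Λ.half := Iff.rfl
@[simp] lemma sf_lit (k : ℕ) [k.AtLeastTwo] : Ex.sf Λ σ (ofNat(k) : Ex) := trivial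
@[simp] lemma sf_zero : Ex.sf Λ σ (0 : Ex) := trivial
@[simp] lemma sf_one : Ex.sf Λ σ (1 : Ex) := trivial
@[simp] lemma sf_v (r : ℕ) : (Ex.v r).sf Λ σ := trivial
@[simp] lemma sf_ld (k : ℕ) :
    (Ex.ld k a).sf Λ σ ↔ a.sf Λ σ ∧ Λ.Acc σ k (a.ev Λ σ) := Iff.rfl
@[simp] lemma cost_add : (a + b).cost = a.cost + b.cost + 1 := rfl
@[simp] lemma cost_sub : (a - b).cost = a.cost + b.cost + 1 := rfl
@[simp] lemma cost_mul : (a * b).cost = a.cost + b.cost + 1 := rfl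
@[simp] lemma cost_div : (a / b).cost = a.cost + b.cost + 1 := rfl
@[simp] lemma cost_mod : (a % b).cost = a.cost + b.cost + 1 := rfl
@[simp] lemma cost_op (o : AOp) : (Ex.op o a b).cost = a.cost + b.cost + 1 := rfl
@[simp] lemma cost_lit (k : ℕ) [k.AtLeastTwo] : Ex.cost (ofNat(k) : Ex) = 1 := rfl
@[simp] lemma cost_zero : Ex.cost (0 : Ex) = 1 := rfl
@[simp] lemma cost_one : Ex.cost (1 : Ex) = 1 := rfl
@[simp] lemma cost_v (r : ℕ) : (Ex.v r).cost = 1 := rfl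
@[simp] lemma cost_ld (k : ℕ) : (Ex.ld k a).cost = a.cost + 7 := rfl

variable (Q : St → Prop)
@[simp] lemma wp_asg (r : ℕ) : (Sm.asg r a).wp Λ Q σ ↔
    a.sf Λ σ ∧ Q (σ.setv r (a.ev Λ σ) (a.cost + 1)) := Iff.rfl
@[simp] lemma wp_st (k : ℕ) : (Sm.st k a b).wp Λ Q σ ↔ a.sf Λ σ ∧ b.sf Λ σ ∧
    Λ.Acc σ k (a.ev Λ σ) ∧ Q (σ.setm k (a.ev Λ σ) (b.ev Λ σ) (a.cost + b.cost + 7)) := Iff.rfl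
@[simp] lemma wp_cond (s : Sm) : (Sm.cond a s).wp Λ Q σ ↔ a.sf Λ σ ∧ -Λ.half ≤ a.ev Λ σ ∧
    a.ev Λ σ < Λ.half ∧ (a.ev Λ σ ≠ 0 → s.wp Λ Q (σ.tick (a.cost + 1))) ∧
    (a.ev Λ σ = 0 → Q (σ.tick (a.cost + 2))) := Iff.rfl
end

/-- Sequential composition of a list of statements. -/
def blk : List Sm → Sm
  | [] => .nop
  | s :: l => .sq s (blk l)

@[simp] lemma wp_blk_nil (Λ : Layout) (Q : St → Prop) (σ : St) :
    (blk []).wp Λ Q σ ↔ Q (σ.tick 1) := Iff.rfl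
@[simp] lemma wp_blk_cons (Λ : Layout) (s : Sm) (l : List Sm) (Q : St → Prop) (σ : St) :
    (blk (s :: l)).wp Λ Q σ ↔ s.wp Λ ((blk l).wp Λ Q) σ := Iff.rfl

/-- Index of the point `(x, y)` in the arrays indexed by points. -/
def pidxE (x y : Ex) : Ex := (x + .v 28) * .v 29 + (y + .v 28)

/-- Variable 8 is doubled as long as it is at most `n`, so it ends as the power `E` of two above `n`
and variable 9 as its exponent; offsets and bases are powers of `E`. The arrays: 0 input and output;
1 lengths; 2 characters; 3–6 lower and 7–10 upper bounds of the functionals; 11 points of the second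
family; 12 occupied blocks; 13 successors and 14 lengths of the linked lists; 15 dyadic table; 16
correlations; 17 quadrant counts; 32 list heads by character. -/
def initP : Sm := blk [
  .asg 1 (.ld 0 0), .asg 2 (.ld 0 1), .asg 3 (.ld 0 2), .asg 4 (.ld 0 3), .asg 5 (.ld 0 4),
  .asg 6 (.ld 0 5), .asg 7 (.v 3 * .v 6 - .v 4 * .v 5), .asg 8 1, .asg 9 0,
  .rep 17 (.v 2) (blk [.asg 20 (.op .lt (.v 8) (.v 2 + 1)), .asg 8 (.v 8 + .v 8 * .v 20),
    .asg 9 (.v 9 + .v 20)]),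
  .asg 9 (7 * .v 9), .asg 28 (.v 8 * .v 8), .asg 29 (.v 28 * .v 28), .asg 10 (.v 29 * .v 28),
  .asg 11 (.v 29 * .v 29)]

/-- Minimum and maximum without branching. The bounds are stored shifted by `O` so that the initial
zero of a cell is neutral. -/
def hullStep (k : ℕ) : Sm := blk [
  .st (3 + k) (.v 15) (.ld (3 + k) (.v 15) +
    .op .lt (.v (22 + k) - .v 10) (.ld (3 + k) (.v 15)) *
      (.v (22 + k) - .v 10 - .ld (3 + k) (.v 15))),
  .st (7 + k) (.v 15) (.ld (7 + k) (.v 15) +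
    .op .lt (.ld (7 + k) (.v 15)) (.v (22 + k) + .v 10) *
      (.v (22 + k) + .v 10 - .ld (7 + k) (.v 15)))]

def functionalsP : Sm := blk [
  .asg 22 (.v 3 * .v 21 - .v 4 * .v 20), .asg 23 (.v 5 * .v 21 - .v 6 * .v 20),
  .asg 24 (.v 22 * .v 5 - .v 23 * .v 3), .asg 25 (.v 22 * .v 6 - .v 23 * .v 4)]

def hullP : Sm := blk [functionalsP, blk (dims.map hullStep)]

/-- Variable 16 is the weight of a point in array 11: 0 for the first family, 1 for the second. -/
def pointP : Sm := blk [
  .asg 20 (.ld 0 (.v 14)), .asg 21 (.ld 0 (.v 14 + 1)), .st 2 (.v 15) (.ld 0 (.v 14 + 2)),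
  .asg 14 (.v 14 + 3), .st 11 (pidxE (.v 20) (.v 21)) (.ld 11 (pidxE (.v 20) (.v 21)) + .v 16),
  hullP]

def stringP : Sm := blk [
  .asg 19 (.ld 0 (.v 14)), .asg 14 (.v 14 + 1), .st 1 (.v 15) (.v 19),
  .rep 18 (.v 19) pointP, .asg 15 (.v 15 + 1)]

def parseP : Sm := blk [
  .asg 14 7, .asg 12 (.ld 0 6), .asg 15 0, .asg 16 0, .rep 17 (.v 12) stringP,
  .asg 13 (.ld 0 (.v 14)), .asg 14 (.v 14 + 1), .asg 16 1, .rep 17 (.v 13) stringP,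
  .asg 30 (.ld 0 (.v 14)), .asg 14 (.v 14 + 1)]

/-- Variable 32 becomes `X ^ 11`, half the length of a block. Blocks met by a character are flagged;
their numbers are reduced modulo the number of strings plus one, so one number remains unflagged.
Its start goes to variable 0. -/
def flagP : Sm := blk [
  .asg 31 (.v 12 + .v 13 + 1),
  .asg 32 (.v 11 * .v 11), .asg 32 (.v 32 * .v 32), .asg 32 (.v 32 * .v 32 * .v 11 * .v 11 * .v 11),
  .rep 17 (.v 12 + .v 13)
    (.st 12 (.op .hi (.ld 2 (.v 17) + .v 32) (2 * .v 32) % .v 31) 1),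
  .rep 17 (.v 31)
    (.asg 0 (.v 0 + (1 - .ld 12 (.v 17)) * (.v 17 * (2 * .v 32) - .v 0)))]

/-- Each nonempty string is pushed to the front of the list of its character. Indices are stored
plus one, so that zero is the empty list. -/
def chainP : Sm :=
  .rep 17 (.v 12) (.cond (.ld 1 (.v 17)) (blk [
    .asg 20 (.ld 2 (.v 17)), .asg 21 (.ld 32 (.v 20)), .st 13 (.v 17 + 1) (.v 21),
    .st 14 (.v 17 + 1) (.ld 14 (.v 21) + 1), .st 32 (.v 20) (.v 17 + 1)]))

/-- One digit of the counter gives a sign (variable 58) and a level (variable 59); the sign selects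
the threshold by interpolating between the two. -/
def dimStep (k : ℕ) : Sm := blk [
  .asg 58 (.v 34 % (2 * .v 9)), .asg 34 (.v 34 / (2 * .v 9)), .asg 59 (.v 58 / 2),
  .asg 58 (.v 58 % 2),
  .asg 60 (.v 10 + .v (52 + k) - .v (44 + k) + 1 + .v 58 * (.v (44 + k) - .v (48 + k) - 1)),
  .asg 60 (.op .shr (.v 60) (.v 59)),
  .asg 57 ((.v 57 * .v 11 + .v 59) * .v 11 + .v 60),
  .asg 56 (.v 56 * (.v 60 % 2) * (1 - 2 * .v 58))]

def updateP : Sm := blk [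
  .asg 34 (.v 33), .asg 35 (.v 34 % 2), .asg 34 (.v 34 / 2), .asg 36 (.v 34 % 2),
  .asg 34 (.v 34 / 2), .asg 52 (.v 40 + .v 35 * .v 41), .asg 53 (.v 42 + .v 36 * .v 43),
  .asg 54 (.v 52 * .v 5 - .v 53 * .v 3), .asg 55 (.v 52 * .v 6 - .v 53 * .v 4),
  .asg 56 ((1 - 2 * .v 35) * (1 - 2 * .v 36)),
  .asg 57 ((.v 52 - .v 44 + .v 10) % .v 7 * .v 11 + (.v 53 - .v 45 + .v 10) % .v 7),
  blk (dims.map dimStep), .st 15 (.v 57) (.ld 15 (.v 57) + .v 56)]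

def loadHullP (k : ℕ) : Sm := blk [
  .asg (44 + k) (.ld (3 + k) (.v 22) + .v 10), .asg (48 + k) (.ld (7 + k) (.v 22) - .v 10)]

/-- Variables 40–43 hold one value and an increment for each corner coordinate, so that a bit of the
update counter selects the corner by a multiplication. -/
def pairP : Sm := blk [
  .asg 40 (.ld 3 (.v 15) + .v 10), .asg 41 (.ld 7 (.v 15) - .v 10 + .v 7 - .v 40),
  .asg 42 (.ld 8 (.v 15) - .v 10), .asg 43 (.ld 4 (.v 15) + .v 10 - .v 7 - .v 42),
  blk (dims.map loadHullP),
  .rep 33 (2 * (2 * (2 * .v 9 * (2 * .v 9) * (2 * .v 9) * (2 * .v 9)))) updateP]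

def pairsP : Sm :=
  .rep 17 (.v 13) (blk [
    .asg 15 (.v 12 + .v 17),
    .cond (.ld 1 (.v 15)) (blk [
      .asg 21 (.ld 32 (.ld 2 (.v 15))),
      .rep 18 (.ld 14 (.v 21)) (blk [.asg 22 (.v 21 - 1), .asg 21 (.ld 13 (.v 21)), pairP])])])

def lookStep (k : ℕ) : Sm := blk [
  .asg 59 (.v 34 % .v 9), .asg 34 (.v 34 / .v 9),
  .asg 57 ((.v 57 * .v 11 + .v 59) * .v 11 + (.op .shr (.v (22 + k) + .v 10) (.v 59) + 1))]

def lookupP : Sm := blk [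
  .asg 34 (.v 33), .asg 57 (.v 27), blk (dims.map lookStep),
  .asg 26 (.v 26 + .ld 15 (.v 57))]

/-- Points are visited with increasing first and, within a column, decreasing second coordinate.
Then both recursions, for correlations and for quadrant counts, read only values already stored or
zeros. -/
def queryP : Sm :=
  .rep 17 (2 * .v 2 * (2 * .v 2)) (blk [
    .asg 20 (.v 17 / (2 * .v 2) - .v 2), .asg 21 (.v 2 - 1 - .v 17 % (2 * .v 2)),
    functionalsP, .asg 26 0,
    .asg 27 ((.v 22 + .v 10) % .v 7 * .v 11 + (.v 23 + .v 10) % .v 7),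
    .rep 33 (.v 9 * .v 9 * .v 9 * .v 9) lookupP,
    .st 16 (pidxE (.v 20) (.v 21)) (.v 26 + .ld 16 (pidxE (.v 20 - .v 3) (.v 21 - .v 4)) +
      .ld 16 (pidxE (.v 20 - .v 5) (.v 21 - .v 6)) -
      .ld 16 (pidxE (.v 20 - .v 3 - .v 5) (.v 21 - .v 4 - .v 6))),
    .st 17 (pidxE (.v 20) (.v 21)) (.ld 11 (pidxE (.v 20) (.v 21)) +
      .ld 17 (pidxE (.v 20 - 1) (.v 21)) + .ld 17 (pidxE (.v 20) (.v 21 + 1)) -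
      .ld 17 (pidxE (.v 20 - 1) (.v 21 + 1)))])

def outputP : Sm :=
  .rep 17 (.v 30) (blk [
    .asg 20 (.ld 0 (.v 14)), .asg 21 (.ld 0 (.v 14 + 1)), .asg 14 (.v 14 + 2),
    .st 0 (.v 17) (.ld 17 (pidxE (.v 20 + .v 1 - 1) (.v 21)) - .ld 17 (pidxE (.v 20 - 1) (.v 21)) -
      .ld 17 (pidxE (.v 20 + .v 1 - 1) (.v 21 + .v 1)) + .ld 17 (pidxE (.v 20 - 1) (.v 21 + .v 1)) -
      .ld 16 (pidxE (.v 20) (.v 21)))])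

def mainP : Sm := blk [initP, parseP, flagP, chainP, pairsP, queryP, outputP]

/-! ## The standing assumptions on the parameters -/

structure Env where
  Λ : Layout
  m : ℕ
  n : ℕ
  ℓ : ℕ
  φ : Pt
  ψ : Pt
  m_pos : 1 ≤ m
  m_le : m ≤ n
  n_two : 2 ≤ n
  n_lt : n < 2 ^ ℓ
  ℓ_eq : ℓ = Nat.log 2 n + 1
  φ1 : 0 ≤ φ.1 ∧ φ.1 ≤ n
  φ2 : -n ≤ φ.2 ∧ φ.2 < 0
  ψ1 : 0 < ψ.1 ∧ ψ.1 ≤ n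
  ψ2 : 0 ≤ ψ.2 ∧ ψ.2 ≤ n
  ok : ∀ k i, 1 ≤ k → k ≤ 31 → 0 ≤ i → i < ((2 ^ ℓ) ^ 8) ^ 10 → Λ.ok k i
  ok0 : ∀ i, 0 ≤ i → i < (2 ^ ℓ) ^ 8 → Λ.ok 0 i
  half : ((2 ^ ℓ) ^ 8) ^ 13 ≤ Λ.half

namespace Env
variable (V : Env)

/-- All sizes are powers of `E > n`. Functionals are at most `B`, so adding `O > 2B + 1` makes all
thresholds and query values nonnegative and below `2 ^ L = E ^ 7`, which in turn is below the base
`X` of the keys. -/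
def E : ℤ := 2 ^ V.ℓ
def O : ℤ := V.E ^ 6
def X : ℤ := V.E ^ 8
/-- A bound for the functionals. -/
def B : ℤ := V.E ^ 5
def L : ℕ := 7 * V.ℓ
def d : ℤ := cross V.φ V.ψ

/-- The variables that are constant after the initialization. -/
structure Glob (σ : St) : Prop where
  v1 : σ.var 1 = V.m
  v2 : σ.var 2 = V.n
  v3 : σ.var 3 = V.φ.1
  v4 : σ.var 4 = V.φ.2
  v5 : σ.var 5 = V.ψ.1
  v6 : σ.var 6 = V.ψ.2
  v7 : σ.var 7 = V.d
  v9 : σ.var 9 = V.L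
  v10 : σ.var 10 = V.O
  v11 : σ.var 11 = V.X
  v28 : σ.var 28 = V.E ^ 2
  v29 : σ.var 29 = V.E ^ 4

variable {V}
lemma Glob.frame {σ σ' : St} (h : V.Glob σ)
    (hf : ∀ r ∈ [1, 2, 3, 4, 5, 6, 7, 9, 10, 11, 28, 29], σ'.var r = σ.var r) : V.Glob σ' := by
  simp only [List.forall_mem_cons] at hf
  obtain ⟨h1, h2, h3, h4, h5, h6, h7, h9, h10, h11, h28, h29, -⟩ := hf
  constructor
  · rw [h1, h.v1]
  · rw [h2, h.v2]
  · rw [h3, h.v3]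
  · rw [h4, h.v4]
  · rw [h5, h.v5]
  · rw [h6, h.v6]
  · rw [h7, h.v7]
  · rw [h9, h.v9]
  · rw [h10, h.v10]
  · rw [h11, h.v11]
  · rw [h28, h.v28]
  · rw [h29, h.v29]

variable (V)
lemma ℓ_ge : 2 ≤ V.ℓ := by
  by_contra h
  have := V.n_lt
  have := V.n_two
  have : 2 ^ V.ℓ ≤ 2 ^ 1 := Nat.pow_le_pow_right (by norm_num) (by omega)
  omega

lemma E_ge : 4 ≤ V.E := by
  have := pow_le_pow_right₀ (a := (2 : ℤ)) (by norm_num) V.ℓ_ge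
  exact this

lemma n_lt_E : (V.n : ℤ) < V.E := by unfold E; exact_mod_cast V.n_lt

/-- As `E ≥ 4`, one more power of `E` absorbs a factor 4. Chains of these inequalities let linear
arithmetic compare all the bounds. -/
lemma E_pow_succ (k : ℕ) : 4 * V.E ^ k ≤ V.E ^ (k + 1) := by
  rw [pow_succ]
  have h := V.E_ge
  have : 0 ≤ V.E ^ k := by positivity
  nlinarith

lemma E2_ge : 16 ≤ V.E ^ 2 := by have := V.E_ge; nlinarith
lemma E_le_E2 : 4 * V.E ≤ V.E ^ 2 := by have := V.E_ge; nlinarith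
lemma E3_le : 4 * V.E ^ 2 ≤ V.E ^ 3 := V.E_pow_succ 2
lemma E4_le : 4 * V.E ^ 3 ≤ V.E ^ 4 := V.E_pow_succ 3
lemma B_le : 4 * V.E ^ 4 ≤ V.B := V.E_pow_succ 4
lemma O_le : 4 * V.B ≤ V.O := V.E_pow_succ 5
lemma O_le' : 4 * V.O ≤ V.E ^ 7 := V.E_pow_succ 6
lemma X_le : 4 * V.E ^ 7 ≤ V.X := V.E_pow_succ 7
lemma X_ge : 65536 ≤ V.X := by
  have := V.E_ge
  have := V.E2_ge; have := V.E3_le; have := V.E4_le; have := V.B_le; have := V.O_le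
  have := V.O_le'; have := V.X_le
  omega

lemma X_half : V.X ^ 13 ≤ V.Λ.half := V.half

lemma X_lt_half : V.X * V.X < V.Λ.half := by
  have h := V.X_half
  have h1 := V.X_ge
  have : V.X * V.X < V.X ^ 13 := by
    rw [← sq]
    exact pow_lt_pow_right₀ (by omega) (by norm_num)
  omega

lemma X_lt_half' : V.X < V.Λ.half := by
  have := V.X_lt_half
  have := V.X_ge
  nlinarith

lemma two_pow_L : (2 : ℤ) ^ V.L = V.E ^ 7 := by
  unfold L E; rw [← pow_mul, mul_comm]

lemma ℓ_lt_E : (V.ℓ : ℤ) < V.E := by unfold E; exact_mod_cast Nat.lt_two_pow_self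
lemma L_lt : (V.L : ℤ) < V.E ^ 3 := by
  have h := V.ℓ_lt_E
  have := V.E_le_E2; have := V.E3_le
  unfold L; push_cast; omega
lemma L_pos : 0 < V.L := by have := V.ℓ_ge; unfold L; omega

lemma d_pos : 0 < V.d := by
  have h1 := V.φ1; have h2 := V.φ2; have h3 := V.ψ1; have h4 := V.ψ2
  unfold d cross
  nlinarith [mul_nonneg h1.1 h4.1, mul_pos h3.1 (neg_pos.2 h2.2)]

lemma d_lt : V.d ≤ 2 * V.E ^ 2 := by
  have h1 := V.φ1; have h2 := V.φ2; have h3 := V.ψ1; have h4 := V.ψ2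
  have hn := V.n_lt_E
  have a1 : V.φ.1 * V.ψ.2 ≤ V.E * V.E := mul_le_mul (by omega) (by omega) h4.1 (by omega)
  have a2 : -V.φ.2 * V.ψ.1 ≤ V.E * V.E := mul_le_mul (by omega) (by omega) (by omega) (by omega)
  unfold d cross
  nlinarith

lemma acc {σ : St} {k : ℕ} {i : ℤ} (h1 : 1 ≤ k) (h2 : k ≤ 31) (h3 : 0 ≤ i) (h4 : i < V.X ^ 10) :
    V.Λ.Acc σ k i := ⟨V.ok k i h1 h2 h3 h4, by omega⟩

lemma X_le_pow : V.X ≤ V.X ^ 10 := le_self_pow₀ (by have := V.X_ge; omega) (by norm_num)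

lemma acc' {σ : St} {k : ℕ} {i : ℤ} (h1 : 1 ≤ k) (h2 : k ≤ 31) (h3 : 0 ≤ i) (h4 : i < V.X) :
    V.Λ.Acc σ k i := V.acc h1 h2 h3 (h4.trans_le V.X_le_pow)

lemma acc0 {σ : St} {i : ℤ} (h3 : 0 ≤ i) (h4 : i < V.X) :
    V.Λ.Acc σ 0 i := ⟨V.ok0 i h3 h4, by omega⟩

end Env

/-! ### Verification of the table updates. -/

namespace Env
variable (V : Env)

lemma dimStep_wp {σ : St} (hg : V.Glob σ) (k : ℕ) {A : ℤ × ℤ}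
    (h1 : V.O + σ.var (52 + k) - σ.var (44 + k) + 1 = A.1)
    (h2 : V.O + σ.var (52 + k) - σ.var (48 + k) = A.2)
    (hA : (0 ≤ A.1 ∧ A.1 < V.X) ∧ (0 ≤ A.2 ∧ A.2 < V.X))
    (ht : 0 ≤ σ.var 34 ∧ σ.var 34 < V.Λ.half) (hk : k < 4) :
    (dimStep k).wp V.Λ (fun σ' => σ'.var 34 = σ.var 34 / (2 * V.L) ∧
      σ'.var 57 = (σ.var 57 * V.X + σ.var 34 % (2 * V.L) / 2) * V.X +
        (A.1 + σ.var 34 % (2 * V.L) % 2 * (A.2 - A.1)) / 2 ^ (σ.var 34 % (2 * V.L) / 2).toNat ∧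
      σ'.var 56 = σ.var 56 * ((A.1 + σ.var 34 % (2 * V.L) % 2 * (A.2 - A.1)) /
        2 ^ (σ.var 34 % (2 * V.L) / 2).toNat % 2) * (1 - 2 * (σ.var 34 % (2 * V.L) % 2)) ∧
      σ'.time ≤ σ.time + 100) σ := by
  have hX := V.X_lt_half'
  have hXg := V.X_ge
  have hL := V.L_pos
  have hL2 := V.L_lt
  have hE4 := V.E4_le; have hB := V.B_le; have hO := V.O_le; have hO' := V.O_le'
  have hX' := V.X_le
  have hE2 := V.E2_ge; have hE3 := V.E3_le
  have m0 := Int.emod_nonneg (σ.var 34) (b := 2 * (V.L : ℤ)) (by omega)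
  have m1 := Int.emod_lt_of_pos (σ.var 34) (b := 2 * (V.L : ℤ)) (by omega)
  have e9 := hg.v9
  have e10 := hg.v10
  have e11 := hg.v11
  have n1 : 52 + k ≠ 58 ∧ 52 + k ≠ 59 ∧ 52 + k ≠ 34 := by omega
  have n2 : 44 + k ≠ 58 ∧ 44 + k ≠ 59 ∧ 44 + k ≠ 34 := by omega
  have n3 : 48 + k ≠ 58 ∧ 48 + k ≠ 59 ∧ 48 + k ≠ 34 := by omega
  set dg := σ.var 34 % (2 * (V.L : ℤ)) with hdg
  have hsv : V.O + σ.var (52 + k) - σ.var (44 + k) + 1 +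
      dg % 2 * (σ.var (44 + k) - σ.var (48 + k) - 1) = A.1 + dg % 2 * (A.2 - A.1) := by
    rw [← h1, ← h2]; ring
  have hs : 0 ≤ A.1 + dg % 2 * (A.2 - A.1) ∧ A.1 + dg % 2 * (A.2 - A.1) < V.X := by
    rcases Int.emod_two_eq_zero_or_one dg with h | h <;> rw [h] <;> simp <;> omega
  have hq : 0 ≤ (A.1 + dg % 2 * (A.2 - A.1)) / 2 ^ (dg / 2).toNat ∧
      (A.1 + dg % 2 * (A.2 - A.1)) / 2 ^ (dg / 2).toNat < V.X :=
    ⟨Int.ediv_nonneg hs.1 (by positivity), (Int.ediv_le_self _ hs.1).trans_lt hs.2⟩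
  simp [dimStep, St.setv_var, e9, e10, e11, n1, n2, n3, ← hdg, hsv]
  omega

lemma dimSteps_wp (A : ℕ → ℤ × ℤ) : ∀ (ks : List ℕ) (σ : St), V.Glob σ → (∀ k ∈ ks, k < 4) →
    (∀ k ∈ ks, V.O + σ.var (52 + k) - σ.var (44 + k) + 1 = (A k).1 ∧
      V.O + σ.var (52 + k) - σ.var (48 + k) = (A k).2 ∧
      (0 ≤ (A k).1 ∧ (A k).1 < V.X) ∧ (0 ≤ (A k).2 ∧ (A k).2 < V.X)) →
    0 ≤ σ.var 34 ∧ σ.var 34 < V.Λ.half →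
    (blk (ks.map dimStep)).wp V.Λ (fun σ' =>
      σ'.var 57 = evKey V.L V.X (ks.map A) (σ.var 34) (σ.var 57) ∧
      σ'.var 56 = evWt V.L (ks.map A) (σ.var 34) (σ.var 56) ∧
      σ'.time ≤ σ.time + 100 * ks.length + 1) σ := by
  intro ks
  induction ks with
  | nil => intro σ _ _ _ _; simp [evKey, evWt]
  | cons k r ih =>
    intro σ hg hk hA ht
    obtain ⟨h1, h2, h3⟩ := hA k (by simp)
    rw [List.map_cons, wp_blk_cons]
    refine Sm.wp_mono _ ?_ (Sm.wp_frame _ (V.dimStep_wp hg k h1 h2 h3 ht (hk k (by simp))))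
    rintro σ₁ ⟨⟨p1, p2, p3, p4⟩, hf⟩
    have hv : ∀ r, r ∉ [58, 34, 59, 58, 60, 60, 57, 56] → σ₁.var r = σ.var r := hf.1
    refine Sm.wp_mono _ ?_ (ih σ₁ (hg.frame fun r hr => hv r (by fin_cases hr <;> decide))
      (fun k hk' => hk k (by simp [hk'])) ?_ ?_)
    · rintro σ₂ ⟨q1, q2, q3⟩
      refine ⟨?_, ?_, ?_⟩
      · rw [q1, p1, p2]; simp [evKey]
      · rw [q2, p1, p3]; simp [evWt]
      · rw [List.length_cons]; omega
    · intro k' hk'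
      have h4 := hk k' (by simp [hk'])
      rw [hv (52 + k') (by simp; omega), hv (44 + k') (by simp; omega),
        hv (48 + k') (by simp; omega)]
      exact hA k' (by simp [hk'])
    · rw [p1]
      have := V.L_pos
      exact ⟨Int.ediv_nonneg ht.1 (by omega), (Int.ediv_le_self _ ht.1).trans_lt ht.2⟩

/-- The variables describing a pair of strings. -/
structure PairVars (lo hi lo' hi' : ℕ → ℤ) (σ : St) : Prop where
  v40 : σ.var 40 = lo' 0
  v41 : σ.var 41 = hi' 0 + V.d - lo' 0
  v42 : σ.var 42 = hi' 1
  v43 : σ.var 43 = lo' 1 - V.d - hi' 1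
  vlo : ∀ k < 4, σ.var (44 + k) = lo k
  vhi : ∀ k < 4, σ.var (48 + k) = hi k

/-- Bounds on the functionals for a pair of strings. -/
structure PairBounds (lo hi lo' hi' : ℕ → ℤ) : Prop where
  lo_le : ∀ k < 4, |lo k| ≤ V.B
  hi_le : ∀ k < 4, |hi k| ≤ V.B
  le : ∀ k < 4, lo k ≤ hi k
  corner : ∀ e₀ < 2, ∀ e₁ < 2, ∀ k < 4, |lin V.φ V.ψ k (cornerA V.φ V.ψ lo' hi' (e₀ : ℕ))
    (cornerB V.φ V.ψ lo' hi' (e₁ : ℕ))| ≤ V.B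

lemma pairCount_lt : (pairCount V.L : ℤ) < V.Λ.half := by
  have h := V.X_lt_half
  have hL := V.L_lt
  have hp := V.L_pos
  have hE := V.E_ge
  unfold pairCount
  push_cast
  have h1 : (2 * (V.L : ℤ)) ^ 4 ≤ (2 * V.E ^ 3) ^ 4 := by gcongr
  have h2 : V.X * V.X = V.E ^ 16 := by unfold X; ring
  have h3 : (2 * V.E ^ 3) ^ 4 = 16 * V.E ^ 12 := by ring
  have h4 : 64 * V.E ^ 12 ≤ V.E ^ 16 := by
    have e1 := V.E_pow_succ 12
    have e2 := V.E_pow_succ 13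
    have e3 := V.E_pow_succ 14
    have e4 := V.E_pow_succ 15
    have : 0 ≤ V.E ^ 12 := by positivity
    simp only [Nat.reduceAdd] at e1 e2 e3 e4
    omega
  omega

lemma updateP_wp {lo hi lo' hi' : ℕ → ℤ} (hb : V.PairBounds lo hi lo' hi') {σ : St}
    (hg : V.Glob σ) (hv : V.PairVars lo hi lo' hi' σ) {t : ℕ} (ht : t < pairCount V.L)
    (hvt : σ.var 33 = t) :
    updateP.wp V.Λ (fun σ' => σ'.mem = Function.update σ.mem 15 (Function.update (σ.mem 15)
      (pairKey V.φ V.ψ V.O V.L V.X lo hi lo' hi' t)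
      (σ.mem 15 (pairKey V.φ V.ψ V.O V.L V.X lo hi lo' hi' t) +
        pairWt V.φ V.ψ V.O V.L lo hi lo' hi' t)) ∧ σ'.time ≤ σ.time + 600) σ := by
  have hX := V.X_lt_half'
  have hXX := V.X_lt_half
  have hXg := V.X_ge
  have hE4 := V.E4_le; have hB := V.B_le; have hO := V.O_le; have hO' := V.O_le'
  have hX' := V.X_le
  have hE2 := V.E2_ge; have hE3 := V.E3_le
  have hd := V.d_pos
  have hd2 := V.d_lt
  have htc := V.pairCount_lt
  have hLX := V.L_lt
  have q1 : (t : ℤ) % 2 = ((t % 2 : ℕ) : ℤ) := by push_cast; rfl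
  have q2 : (t : ℤ) / 2 % 2 = ((t / 2 % 2 : ℕ) : ℤ) := by push_cast; rfl
  have hc : ∀ k < 4, |lin V.φ V.ψ k (cornerA V.φ V.ψ lo' hi' (t % 2))
      (cornerB V.φ V.ψ lo' hi' (t / 2 % 2))| ≤ V.B := by
    rw [q1, q2]
    exact hb.corner _ (by omega) _ (by omega)
  set A := cornerA V.φ V.ψ lo' hi' (t % 2) with hA
  set C := cornerB V.φ V.ψ lo' hi' (t / 2 % 2) with hC
  have c0 : |A| ≤ V.B := hc 0 (by norm_num)
  have c1 : |C| ≤ V.B := hc 1 (by norm_num)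
  have l0 := abs_le.1 (hb.lo_le 0 (by norm_num))
  have l1 := abs_le.1 (hb.lo_le 1 (by norm_num))
  have c0' := abs_le.1 c0
  have c1' := abs_le.1 c1
  have eA : σ.var 40 + (t : ℤ) % 2 * σ.var 41 = A := by rw [hv.v40, hv.v41, hA]; rfl
  have eC : σ.var 42 + (t : ℤ) / 2 % 2 * σ.var 43 = C := by rw [hv.v42, hv.v43, hC]; rfl
  have e44 : σ.var 44 = lo 0 := hv.vlo 0 (by norm_num)
  have e45 : σ.var 45 = lo 1 := hv.vlo 1 (by norm_num)
  unfold updateP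
  simp [St.setv_var, hvt, hg.v3, hg.v4, hg.v5, hg.v6, hg.v7, hg.v10, hg.v11, eA, eC, e44, e45]
  refine ⟨by omega, by omega, by omega, ?_⟩
  set σ₁ : St := (((((((((((σ.setv 34 (↑t) 2).setv 35 (↑t % 2) 4).setv 34 (↑t / 2) 4).setv 36
    (↑t / 2 % 2) 4).setv 34 (↑t / 2 / 2) 4).setv 52 A 6).setv 53 C 6).setv 54
    (A * V.ψ.1 - C * V.φ.1) 8).setv 55 (A * V.ψ.2 - C * V.φ.2) 8).setv 56
    ((1 - 2 * (↑t % 2)) * (1 - 2 * (↑t / 2 % 2))) 12).setv 57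
    ((A - lo 0 + V.O) % V.d * V.X + (C - lo 1 + V.O) % V.d) 18) with hσ₁
  have s34 : σ₁.var 34 = (t : ℤ) / 2 / 2 := by simp [hσ₁, St.setv_var]
  have s56 : σ₁.var 56 = (1 - 2 * ((t : ℤ) % 2)) * (1 - 2 * ((t : ℤ) / 2 % 2)) := by
    simp [hσ₁, St.setv_var]
  have s57 : σ₁.var 57 = evBase V.φ V.ψ V.O V.X lo A C := by
    simp [hσ₁, St.setv_var, evBase, Env.d]
  have sf : ∀ k < 4, σ₁.var (52 + k) = lin V.φ V.ψ k A C := by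
    intro k hk
    interval_cases k <;> simp [hσ₁, St.setv_var, lin]
  have so : ∀ r, r ∉ [34, 35, 36, 52, 53, 54, 55, 56, 57] → σ₁.var r = σ.var r := by
    intro r hr
    simp at hr
    simp [hσ₁, St.setv_var, hr]
  have sm : σ₁.mem = σ.mem := rfl
  have st : σ₁.time = σ.time + 76 := by simp [hσ₁, add_assoc]
  clear_value σ₁
  have hthr : ∀ k < 4, (0 ≤ (thr V.φ V.ψ V.O lo hi A C k).1 ∧
      (thr V.φ V.ψ V.O lo hi A C k).1 < V.X) ∧ (0 ≤ (thr V.φ V.ψ V.O lo hi A C k).2 ∧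
      (thr V.φ V.ψ V.O lo hi A C k).2 < V.X) := by
    intro k hk
    have h1 := abs_le.1 (hc k hk)
    have h2 := abs_le.1 (hb.lo_le k hk)
    have h3 := abs_le.1 (hb.hi_le k hk)
    simp only [thr]
    omega
  refine Sm.wp_mono _ ?_ (Sm.wp_frame _ (V.dimSteps_wp (thr V.φ V.ψ V.O lo hi A C) dims σ₁
    (hg.frame fun r hr => so r (by fin_cases hr <;> decide)) (by simp [dims]) ?_ ?_))
  · rintro σ₂ ⟨⟨p1, p2, p3⟩, hf⟩
    have hm : σ₂.mem = σ.mem := by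
      rw [← sm]; funext k; exact hf.2 k (by simp [dims, dimStep, blk, Sm.arrs])
    have hbase : 0 ≤ evBase V.φ V.ψ V.O V.X lo A C ∧
        evBase V.φ V.ψ V.O V.X lo A C < V.X * V.X := by
      have m1 := Int.emod_nonneg (A - lo 0 + V.O) hd.ne'
      have m2 := Int.emod_lt_of_pos (A - lo 0 + V.O) hd
      have m3 := Int.emod_nonneg (C - lo 1 + V.O) hd.ne'
      have m4 := Int.emod_lt_of_pos (C - lo 1 + V.O) hd
      unfold evBase
      simp only [Env.d] at m1 m2 m3 m4 hd hd2
      constructor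
      · positivity
      · have : (A - lo 0 + V.O) % cross V.φ V.ψ + 1 ≤ V.X := by omega
        have := mul_le_mul_of_nonneg_right this (show 0 ≤ V.X by omega)
        rw [add_mul] at this
        omega
    -- A base below `X ^ 2` followed by two digits for each of four functionals: the key is below `X
    -- ^ 10`, the size of the arrays.
    have hk := evKey_bound (L := V.L) (X := V.X) (by omega)
      (dims.map (thr V.φ V.ψ V.O lo hi A C)) ((t : ℤ) / 2 / 2)
      (evBase V.φ V.ψ V.O V.X lo A C) (V.X * V.X) (by
        intro D hD
        obtain ⟨k, hk, rfl⟩ := List.mem_map.1 hD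
        exact hthr k (by simp [dims] at hk; omega)) (by omega) (by
        have ht' : (t : ℤ) < pairCount V.L := by exact_mod_cast ht
        unfold pairCount at ht'
        rw [List.length_map, show dims.length = 4 from rfl]
        push_cast at ht'
        omega) hbase.1 hbase.2
    have e57 : σ₂.var 57 = pairKey V.φ V.ψ V.O V.L V.X lo hi lo' hi' t := by
      rw [p1, s34, s57]; rfl
    have e56 : σ₂.var 56 = pairWt V.φ V.ψ V.O V.L lo hi lo' hi' t := by
      rw [p2, s34, s56]; rfl
    have hacc : V.Λ.Acc σ₂ 15 (σ₂.var 57) := by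
      rw [p1, s34, s57]
      refine V.acc (by norm_num) (by norm_num) hk.1 (hk.2.trans_eq ?_)
      rw [List.length_map, show dims.length = 4 from rfl]; ring
    simp only [wp_blk_cons, wp_st, sf_v, sf_add, sf_ld, ev_v, ev_add, ev_ld, true_and, hacc,
      wp_blk_nil, St.tick_mem, St.tick_time, cost_v, cost_add, cost_ld, St.setm_time]
    rw [show dims.length = 4 from rfl] at p3
    refine ⟨?_, by omega⟩
    rw [e57, e56, St.setm, hm]
  · intro k hk
    have hk : k < 4 := by simp [dims] at hk; omega
    rw [sf k hk, so (44 + k) (by simp; omega), so (48 + k) (by simp; omega), hv.vlo k hk,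
      hv.vhi k hk]
    exact ⟨rfl, rfl, hthr k hk⟩
  · rw [s34]; omega

/-- Two arrays agree except on the table, which has increased by `f`. -/
def TabAdd (f : ℤ → ℤ) (σ σ' : St) : Prop :=
  (∀ k, k ≠ 15 → σ'.mem k = σ.mem k) ∧ ∀ i, σ'.mem 15 i = σ.mem 15 i + f i

lemma updateLoop_wp {lo hi lo' hi' : ℕ → ℤ} (hb : V.PairBounds lo hi lo' hi') {σ : St}
    (hg : V.Glob σ) (hv : V.PairVars lo hi lo' hi' σ) :
    (Sm.rep 33 (2 * (2 * (2 * .v 9 * (2 * .v 9) * (2 * .v 9) * (2 * .v 9)))) updateP).wp V.Λ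
      (fun σ' => TabAdd (pairTab V.φ V.ψ V.O V.L V.X lo hi lo' hi') σ σ' ∧
        σ'.time ≤ σ.time + 605 * pairCount V.L + 100) σ := by
  have hfr : ∀ σ' : St, (∀ r, r ∉ 33 :: updateP.vars → σ'.var r = σ.var r) → V.Glob σ' ∧
      V.PairVars lo hi lo' hi' σ' := by
    intro σ' h
    refine ⟨hg.frame fun r hr => h r (by fin_cases hr <;> decide), ?_⟩
    constructor
    · rw [h 40 (by decide), hv.v40]
    · rw [h 41 (by decide), hv.v41]
    · rw [h 42 (by decide), hv.v42]
    · rw [h 43 (by decide), hv.v43]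
    · intro k hk
      rw [← hv.vlo k hk]
      interval_cases k <;> exact h _ (by decide)
    · intro k hk
      rw [← hv.vhi k hk]
      interval_cases k <;> exact h _ (by decide)
  refine Sm.wp_rep (fun t σ' => (∀ r, r ∉ 33 :: updateP.vars → σ'.var r = σ.var r) ∧
    (∀ k, k ≠ 15 → σ'.mem k = σ.mem k) ∧
    (∀ i, σ'.mem 15 i = σ.mem 15 i + ∑ t ∈ Finset.range t,
      pairWt V.φ V.ψ V.O V.L lo hi lo' hi' t *
        ind (pairKey V.φ V.ψ V.O V.L V.X lo hi lo' hi' t = i)) ∧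
    σ'.time ≤ σ.time + 50 + 605 * t) (pairCount V.L) (by simp) ?_ V.pairCount_lt ?_ ?_ ?_
  · simp only [ev_mul, ev_v, ev_lit, hg.v9, pairCount]; push_cast; ring
  · refine ⟨fun _ _ => rfl, fun _ _ => rfl, by simp, ?_⟩
    simp only [St.tick_time, cost_mul, cost_v, cost_lit]; omega
  · rintro t ht σ₁ ⟨h1, h2, h3, h4⟩
    have h5 : ∀ r, r ∉ 33 :: updateP.vars → (σ₁.setv 33 t 0).var r = σ.var r := by
      intro r hr
      rw [St.setv_var, if_neg (by rintro rfl; simp at hr), h1 r hr]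
    obtain ⟨hg1, hv1⟩ := hfr _ h5
    refine Sm.wp_mono _ ?_ (Sm.wp_frame _ (V.updateP_wp hb hg1 hv1 ht (by simp [St.setv_var])))
    rintro σ₂ ⟨⟨p1, p2⟩, hf⟩
    refine ⟨fun r hr => ?_, fun k hk => ?_, fun i => ?_, ?_⟩
    · rw [St.tick_var, hf.1 r (by simp at hr; exact hr.2), h5 r hr]
    · rw [St.tick_mem, p1, Function.update_of_ne hk]; exact h2 k hk
    · rw [St.tick_mem, p1, Function.update_self, Finset.sum_range_succ, ← add_assoc, ← h3,
        Function.update_apply, St.setv_mem]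
      unfold ind
      split_ifs with e1 e2 e2
      · rw [e1]; ring
      · exact absurd e1.symm e2
      · exact absurd e2.symm e1
      · ring
    · simp only [St.tick_time, St.setv_time] at p2 ⊢; omega
  · rintro σ₁ ⟨h1, h2, h3, h4⟩
    exact ⟨⟨h2, fun i => h3 i⟩, by simp only [St.tick_time]; omega⟩

end Env

/-! ## Stored strings -/

/-- The last character, because reading a string overwrites one cell repeatedly; the default 0 is
the content of an untouched cell. -/
def listChr (L : StoredStr) : ℤ := L.foldl (fun _ p => p.2) 0

/-- For `|z| < O` the value `z - O` is negative and `z + O` positive, so an accumulator starting at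
0 acts as infinity of the appropriate sign. -/
def loStep (O z acc : ℤ) : ℤ := acc + (if z - O < acc then 1 else 0) * (z - O - acc)
def hiStep (O z acc : ℤ) : ℤ := acc + (if acc < z + O then 1 else 0) * (z + O - acc)

namespace Env
variable (V : Env)

/-- The value computed for the lower bound, shifted down by `O`. -/
def loRaw (k : ℕ) (L : StoredStr) : ℤ := L.foldl (fun acc p => loStep V.O (fn V.φ V.ψ k p.1) acc) 0
def hiRaw (k : ℕ) (L : StoredStr) : ℤ := L.foldl (fun acc p => hiStep V.O (fn V.φ V.ψ k p.1) acc) 0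

def lo (L : StoredStr) (k : ℕ) : ℤ := V.loRaw k L + V.O
def hi (L : StoredStr) (k : ℕ) : ℤ := V.hiRaw k L - V.O

/-- The arrays with the lengths, characters and bounds of the strings. -/
structure Strs (all : List StoredStr) (mem : ℕ → ℤ → ℤ) : Prop where
  len : ∀ g L, all[g]? = some L → mem 1 (g : ℕ) = L.length
  chr : ∀ g L, all[g]? = some L → mem 2 (g : ℕ) = listChr L
  lo : ∀ k < 4, ∀ g L, all[g]? = some L → mem (3 + k) (g : ℕ) = V.loRaw k L
  hi : ∀ k < 4, ∀ g L, all[g]? = some L → mem (7 + k) (g : ℕ) = V.hiRaw k L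

variable {V} in
lemma Strs.congr {all : List StoredStr} {mem mem' : ℕ → ℤ → ℤ} (h : V.Strs all mem)
    (he : ∀ k, 1 ≤ k → k ≤ 10 → mem' k = mem k) : V.Strs all mem' := by
  constructor
  · rw [he 1 (by norm_num) (by norm_num)]; exact h.len
  · rw [he 2 (by norm_num) (by norm_num)]; exact h.chr
  · intro k hk; rw [he (3 + k) (by omega) (by omega)]; exact h.lo k hk
  · intro k hk; rw [he (7 + k) (by omega) (by omega)]; exact h.hi k hk

/-- What is known about the input. -/
structure Inp (Vs Ss : List StoredStr) : Prop where
  num : ((Vs ++ Ss).length : ℤ) + 1 < V.X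
  len : ∀ L ∈ Vs ++ Ss, (L.length : ℤ) < V.X
  pts : ∀ L ∈ Vs ++ Ss, ∀ p ∈ L, (0 ≤ p.1.1 ∧ p.1.1 < V.n) ∧ 0 ≤ p.1.2 ∧ p.1.2 < V.n
  ok : ∀ L ∈ Vs ++ Ss, L ≠ [] → V.Λ.ok 32 (listChr L)

end Env

/-! ## The lists of strings with the same character -/

/-- The linked list with head `h` has the members `l`, stored with offset one. -/
def Chain (next : ℤ → ℤ) : ℤ → List ℕ → Prop
  | h, [] => h = 0
  | h, a :: l => h = a + 1 ∧ Chain next (next h) l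

lemma Chain.congr {next next' : ℤ → ℤ} : ∀ {l : List ℕ} {h : ℤ}, Chain next h l →
    (∀ a ∈ l, next' (a + 1) = next (a + 1)) → Chain next' h l := by
  intro l
  induction l with
  | nil => intro h hc _; exact hc
  | cons a l ih =>
    rintro h ⟨h1, h2⟩ he
    refine ⟨h1, ?_⟩
    have := he a (by simp)
    rw [h1] at h2 ⊢
    rw [this]
    exact ih h2 fun b hb => he b (by simp [hb])

/-- The members of `Vs` with number less than `i` and character `c`, in decreasing order. -/
def members (Vs : List StoredStr) (i : ℕ) (c : ℤ) : List ℕ :=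
  ((List.range i).filter fun j => (Vs.getD j [] ≠ [] ∧ listChr (Vs.getD j []) = c : Bool)).reverse

lemma members_succ (Vs : List StoredStr) (i : ℕ) (c : ℤ) : members Vs (i + 1) c =
    if Vs.getD i [] ≠ [] ∧ listChr (Vs.getD i []) = c then i :: members Vs i c
    else members Vs i c := by
  unfold members
  rw [List.range_succ, List.filter_append]
  split_ifs with h
  · simp only [List.filter_cons, decide_eq_true h, List.filter_nil, if_true, List.reverse_append,
      List.reverse_cons, List.reverse_nil, List.nil_append, List.singleton_append]
  · simp only [List.filter_cons, decide_eq_true_eq, if_neg h, List.filter_nil, List.append_nil]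

lemma mem_members {Vs : List StoredStr} {i : ℕ} {c : ℤ} {j : ℕ} : j ∈ members Vs i c ↔
    j < i ∧ Vs.getD j [] ≠ [] ∧ listChr (Vs.getD j []) = c := by
  simp [members]

/-- The linked lists of the first `i` strings. -/
def Chains (Λ : Layout) (Vs : List StoredStr) (i : ℕ) (mem : ℕ → ℤ → ℤ) : Prop :=
  ∀ c, Λ.ok 32 c → Chain (mem 13) (mem 32 c) (members Vs i c) ∧
    mem 14 (mem 32 c) = (members Vs i c).length

lemma Chain.head {next : ℤ → ℤ} {h : ℤ} {l : List ℕ} (hc : Chain next h l) :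
    h = 0 ∨ ∃ a ∈ l, h = a + 1 := by
  cases l with
  | nil => exact Or.inl hc
  | cons a l => exact Or.inr ⟨a, by simp, hc.1⟩

/-- Consequently the cells with index `i + 1` are still unused when string number `i` is pushed. -/
lemma head_le {next : ℤ → ℤ} {h : ℤ} {Vs : List StoredStr} {i : ℕ} {c : ℤ}
    (hc : Chain next h (members Vs i c)) : 0 ≤ h ∧ h ≤ i := by
  rcases hc.head with h0 | ⟨a, ha, h1⟩
  · omega
  · have := (mem_members.1 ha).1
    omega

namespace Env
variable (V : Env)

lemma chainP_wp {Vs Ss : List StoredStr} (hi : V.Inp Vs Ss) {σ : St}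
    (h0 : σ.var 0 = V.Λ.roff) (h12 : σ.var 12 = Vs.length) (hs : V.Strs (Vs ++ Ss) σ.mem)
    (h14 : σ.mem 14 = 0) (h32 : σ.mem 32 = 0) :
    chainP.wp V.Λ (fun σ' => Chains V.Λ Vs Vs.length σ'.mem ∧
      σ'.time ≤ σ.time + 100 * Vs.length + 10) σ := by
  have hX := V.X_lt_half'
  have hXg := V.X_ge
  have hnum := hi.num
  rw [List.length_append] at hnum
  push_cast at hnum
  refine Sm.wp_rep (fun i σ' => Chains V.Λ Vs i σ'.mem ∧ σ'.mem 14 0 = 0 ∧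
    (∀ k, 1 ≤ k → k ≤ 10 → σ'.mem k = σ.mem k) ∧ σ'.var 0 = σ.var 0 ∧
    σ'.time ≤ σ.time + 100 * i + 5) Vs.length (by simp) (by simpa using h12) (by omega) ?_ ?_ ?_
  · refine ⟨fun c _ => ?_, ?_, fun _ _ _ => rfl, rfl, ?_⟩
    · simp [members, Chain, h32, h14]
    · simp [h14]
    · simp
  · rintro i hin σ₁ ⟨hc, hz, hm, hv, ht⟩
    have hget : (Vs ++ Ss)[i]? = some Vs[i] := by
      rw [List.getElem?_append_left hin, List.getElem?_eq_getElem hin]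
    have hmem : Vs[i] ∈ Vs ++ Ss := List.mem_append_left _ (List.getElem_mem hin)
    have hlen := hi.len _ hmem
    have hs1 : V.Strs (Vs ++ Ss) σ₁.mem := hs.congr hm
    have e1 := hs1.len i _ hget
    have e2 := hs1.chr i _ hget
    have hgd : Vs.getD i [] = Vs[i] := by simp [hin]
    have a1 : ∀ τ : St, V.Λ.Acc τ 1 i := fun τ => V.acc' (by norm_num) (by norm_num) (by omega) (by omega)
    have a2 : ∀ τ : St, V.Λ.Acc τ 2 i := fun τ => V.acc' (by norm_num) (by norm_num) (by omega) (by omega)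
    simp only [wp_cond, sf_ld, sf_v, ev_v, ev_ld, St.setv_var, if_true, St.setv_mem, e1, a1,
      true_and, and_self]
    refine ⟨by omega, by omega, fun hne => ?_, fun heq => ?_⟩
    · have hne' : Vs[i] ≠ [] := by rintro h; simp [h] at hne
      have ok := hi.ok _ hmem hne'
      obtain ⟨hc1, hc2⟩ := hc _ ok
      have hh := head_le hc1
      have a32 : ∀ τ : St, τ.var 0 = σ₁.var 0 → V.Λ.Acc τ 32 (listChr Vs[i]) :=
        fun τ h => ⟨ok, fun _ => by rw [h, hv, h0]⟩
      have a13 : ∀ τ : St, V.Λ.Acc τ 13 (i + 1) :=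
        fun τ => V.acc' (by norm_num) (by norm_num) (by omega) (by omega)
      have a14 : ∀ τ : St, V.Λ.Acc τ 14 (i + 1) :=
        fun τ => V.acc' (by norm_num) (by norm_num) (by omega) (by omega)
      have a14' : ∀ τ : St, V.Λ.Acc τ 14 (σ₁.mem 32 (listChr Vs[i])) :=
        fun τ => V.acc' (by norm_num) (by norm_num) (by omega) (by omega)
      simp [St.setv_var, St.setm_mem, e2, a2, a32, a13, a14, a14']
      refine ⟨?_, ?_, ?_, hv, by omega⟩
      · intro c hokc
        obtain ⟨k1, k2⟩ := hc c hokc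
        simp only [St.setm_mem, if_true, if_false, Function.update_apply, Nat.reduceEqDiff,
          St.tick_mem, St.setv_mem]
        rw [members_succ, hgd]
        by_cases hcc : c = listChr Vs[i]
        · subst hcc
          rw [if_pos rfl, if_pos rfl, if_pos ⟨hne', rfl⟩]
          refine ⟨⟨rfl, ?_⟩, by rw [hc2]; simp⟩
          rw [Function.update_self]
          refine hc1.congr fun a ha => ?_
          have := (mem_members.1 ha).1
          rw [Function.update_of_ne (by omega)]
        -- The list of another character has its head and all its nodes at indices at most `i`, so
        -- the writes at `i + 1` do not affect it.
        · rw [if_neg hcc, if_neg (by rintro ⟨_, h⟩; exact hcc h.symm)]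
          have := head_le k1
          rw [if_neg (by omega)]
          refine ⟨k1.congr fun a ha => ?_, k2⟩
          have := (mem_members.1 ha).1
          rw [Function.update_of_ne (by omega)]
      · rw [Function.update_of_ne (by omega)]; exact hz
      · intro k hk1 hk2
        rw [if_neg (by omega), if_neg (by omega), if_neg (by omega)]
        exact hm k hk1 hk2
    · have hne' : Vs[i] = [] := by simpa using heq
      refine ⟨?_, hz, hm, hv, ?_⟩
      · intro c hokc
        rw [members_succ, hgd, if_neg (by simp [hne'])]
        exact hc c hokc
      · simp; omega
  · rintro σ₁ ⟨hc, hz, hm, hv, ht⟩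
    exact ⟨hc, by simp only [St.tick_time]; omega⟩

/-! ### Verification of the loop over all pairs of equal character. -/

/-- The number of steps allotted to one pair of strings. -/
def pairTime : ℕ := 605 * pairCount V.L + 500

lemma pairP_wp {Vs Ss : List StoredStr} (hi : V.Inp Vs Ss) {σ : St} (hg : V.Glob σ)
    (hs : V.Strs (Vs ++ Ss) σ.mem) {i j : ℕ} (hij : i < Vs.length) (hjj : j < Ss.length)
    (hb : V.PairBounds (V.lo Vs[i]) (V.hi Vs[i]) (V.lo Ss[j]) (V.hi Ss[j]))
    (h22 : σ.var 22 = i) (h15 : σ.var 15 = Vs.length + j) :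
    pairP.wp V.Λ (fun σ' => TabAdd (pairTab V.φ V.ψ V.O V.L V.X (V.lo Vs[i]) (V.hi Vs[i])
      (V.lo Ss[j]) (V.hi Ss[j])) σ σ' ∧ σ'.time ≤ σ.time + 605 * pairCount V.L + 400) σ := by
  have hXg := V.X_ge
  have hnum := hi.num
  rw [List.length_append] at hnum
  push_cast at hnum
  have hgeti : (Vs ++ Ss)[i]? = some Vs[i] := by
    rw [List.getElem?_append_left hij, List.getElem?_eq_getElem hij]
  have hgetj : (Vs ++ Ss)[Vs.length + j]? = some Ss[j] := by
    rw [List.getElem?_append_right (by omega), Nat.add_sub_cancel_left,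
      List.getElem?_eq_getElem hjj]
  have ai : ∀ (τ : St) (k : ℕ), 1 ≤ k → k ≤ 31 → V.Λ.Acc τ k i :=
    fun τ k h1 h2 => V.acc' h1 h2 (by omega) (by omega)
  have aj : ∀ (τ : St) (k : ℕ), 1 ≤ k → k ≤ 31 → V.Λ.Acc τ k (Vs.length + j) :=
    fun τ k h1 h2 => V.acc' h1 h2 (by omega) (by omega)
  have i0 := hs.lo 0 (by norm_num) i _ hgeti
  have i1 := hs.lo 1 (by norm_num) i _ hgeti
  have i2 := hs.lo 2 (by norm_num) i _ hgeti
  have i3 := hs.lo 3 (by norm_num) i _ hgeti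
  have i4 := hs.hi 0 (by norm_num) i _ hgeti
  have i5 := hs.hi 1 (by norm_num) i _ hgeti
  have i6 := hs.hi 2 (by norm_num) i _ hgeti
  have i7 := hs.hi 3 (by norm_num) i _ hgeti
  have j0 := hs.lo 0 (by norm_num) _ _ hgetj
  have j1 := hs.lo 1 (by norm_num) _ _ hgetj
  have j4 := hs.hi 0 (by norm_num) _ _ hgetj
  have j5 := hs.hi 1 (by norm_num) _ _ hgetj
  simp only [Nat.reduceAdd, Nat.cast_add] at i0 i1 i2 i3 i4 i5 i6 i7 j0 j1 j4 j5
  unfold pairP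
  simp only [dims, loadHullP, List.map_cons, List.map_nil, wp_blk_cons, wp_blk_nil, wp_asg, sf_add,
    sf_sub, sf_ld, sf_v, ev_v, ev_add, ev_sub, ev_ld, St.setv_var, St.setv_mem, St.tick_var,
    St.tick_mem, Nat.reduceEqDiff, Nat.reduceAdd, if_true, if_false, true_and, and_true, h15, h22,
    hg.v7, hg.v10, i0, i1, i2, i3, i4, i5, i6, i7, j0, j1, j4, j5]
  simp only [ai _ 3 (by norm_num) (by norm_num), ai _ 4 (by norm_num) (by norm_num),
    ai _ 5 (by norm_num) (by norm_num), ai _ 6 (by norm_num) (by norm_num),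
    ai _ 7 (by norm_num) (by norm_num), ai _ 8 (by norm_num) (by norm_num),
    ai _ 9 (by norm_num) (by norm_num), ai _ 10 (by norm_num) (by norm_num),
    aj _ 3 (by norm_num) (by norm_num), aj _ 4 (by norm_num) (by norm_num),
    aj _ 7 (by norm_num) (by norm_num), aj _ 8 (by norm_num) (by norm_num), true_and]
  refine Sm.wp_mono _ ?_ (V.updateLoop_wp hb (hg.frame ?_) ?_)
  · rintro σ₁ ⟨h1, h2⟩
    refine ⟨⟨h1.1, h1.2⟩, ?_⟩
    simp only [St.setv_time, St.tick_time, cost_add, cost_sub, cost_v, cost_ld] at h2 ⊢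
    omega
  · intro r hr
    fin_cases hr <;> simp [St.setv_var]
  · constructor
    · simp [St.setv_var, lo]
    · simp [St.setv_var, lo, Env.hi]
    · simp [St.setv_var, Env.hi]
    · simp [St.setv_var, lo, Env.hi]
    · intro k hk
      interval_cases k <;> simp [St.setv_var, lo]
    · intro k hk
      interval_cases k <;> simp [St.setv_var, Env.hi]

lemma TabAdd.trans {f g : ℤ → ℤ} {σ₁ σ₂ σ₃ : St} (h : TabAdd f σ₁ σ₂) (h' : TabAdd g σ₂ σ₃) :
    TabAdd (f + g) σ₁ σ₃ :=
  ⟨fun k hk => by rw [h'.1 k hk, h.1 k hk], fun i => by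
    rw [h'.2, h.2, Pi.add_apply]; ring⟩

/-- What the string `S` contributes to the table. -/
def stringTab (Vs : List StoredStr) (S : StoredStr) : ℤ → ℤ :=
  if S = [] then 0 else ((members Vs Vs.length (listChr S)).map fun i =>
    pairTab V.φ V.ψ V.O V.L V.X (V.lo (Vs.getD i [])) (V.hi (Vs.getD i [])) (V.lo S) (V.hi S)).sum

/-- The number of steps allotted to one string of the second family. -/
def stringTime (Vs : List StoredStr) (S : StoredStr) : ℕ :=
  if S = [] then 0 else (members Vs Vs.length (listChr S)).length * V.pairTime

lemma pairsP_wp {Vs Ss : List StoredStr} (hi : V.Inp Vs Ss) {σ : St} (hg : V.Glob σ)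
    (h0 : σ.var 0 = V.Λ.roff) (h12 : σ.var 12 = Vs.length) (h13 : σ.var 13 = Ss.length)
    (hs : V.Strs (Vs ++ Ss) σ.mem) (hc : Chains V.Λ Vs Vs.length σ.mem)
    (hb : ∀ L ∈ Vs, L ≠ [] → ∀ S ∈ Ss, S ≠ [] → V.PairBounds (V.lo L) (V.hi L) (V.lo S) (V.hi S)) :
    pairsP.wp V.Λ (fun σ' => TabAdd (Ss.map (V.stringTab Vs)).sum σ σ' ∧
      σ'.time ≤ σ.time + (Ss.map (V.stringTime Vs)).sum + 200 * Ss.length + 10) σ := by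
  have hX := V.X_lt_half'
  have hXg := V.X_ge
  have hnum := hi.num
  rw [List.length_append] at hnum
  push_cast at hnum
  have hmv : ∀ r ∈ [1, 2, 3, 4, 5, 6, 7, 9, 10, 11, 28, 29], r ∉ pairsP.vars := by decide
  refine Sm.wp_rep_list Ss (fun l σ' => TabAdd (l.map (V.stringTab Vs)).sum σ σ' ∧
    (∀ r, r ∉ pairsP.vars → σ'.var r = σ.var r) ∧
    σ'.time ≤ σ.time + (l.map (V.stringTime Vs)).sum + 200 * l.length + 5)
    (by simp) (by simpa using h13) (by omega) ?_ ?_ ?_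
  · refine ⟨⟨fun _ _ => rfl, fun _ => by simp⟩, fun _ _ => rfl, by simp⟩
  · rintro l₁ S l₂ hl σ₁ ⟨htab, hv, ht⟩
    have hlen : Ss.length = l₁.length + l₂.length + 1 := by rw [hl]; simp; omega
    have hj : l₁.length < Ss.length := by omega
    have hSj : Ss[l₁.length] = S := by simp [hl]
    have hSm : S ∈ Ss := by rw [hl]; simp
    have hSm' : S ∈ Vs ++ Ss := List.mem_append_right _ hSm
    have hgetj : (Vs ++ Ss)[Vs.length + l₁.length]? = some S := by
      rw [List.getElem?_append_right (by omega), Nat.add_sub_cancel_left,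
        List.getElem?_eq_getElem hj, hSj]
    have hs1 : V.Strs (Vs ++ Ss) σ₁.mem := hs.congr fun k _ hk => htab.1 k (by omega)
    have e1 := hs1.len _ _ hgetj
    have e2 := hs1.chr _ _ hgetj
    push_cast at e1 e2
    have hSl := hi.len S hSm'
    have v12 : σ₁.var 12 = Vs.length := by rw [hv 12 (by decide), h12]
    have aj : ∀ (τ : St) (k : ℕ), 1 ≤ k → k ≤ 31 → V.Λ.Acc τ k (Vs.length + l₁.length) :=
      fun τ k h1 h2 => V.acc' h1 h2 (by omega) (by omega)
    have m32 : σ₁.mem 32 = σ.mem 32 := htab.1 32 (by norm_num)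
    have m13 : σ₁.mem 13 = σ.mem 13 := htab.1 13 (by norm_num)
    have m14 : σ₁.mem 14 = σ.mem 14 := htab.1 14 (by norm_num)
    have p1 : ∀ r, r ∉ pairsP.vars → r ≠ 17 ∧ r ≠ 15 ∧ r ≠ 21 ∧ r ≠ 18 ∧ r ≠ 22 := by
      intro r hr
      refine ⟨?_, ?_, ?_, ?_, ?_⟩ <;> (rintro rfl; exact hr (by decide))
    rw [wp_blk_cons, wp_asg, wp_blk_cons, wp_cond]
    simp only [sf_add, sf_v, sf_ld, ev_add, ev_v, ev_ld, St.setv_var, St.setv_mem, if_true,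
      if_false, Nat.reduceEqDiff, v12, e1, true_and, and_self, wp_blk_nil,
      aj _ 1 (by norm_num) (by norm_num)]
    refine ⟨by omega, by omega, fun hne => ?_, fun heq => ?_⟩
    · have hne' : S ≠ [] := by rintro rfl; simp at hne
      have ok := hi.ok _ hSm' hne'
      obtain ⟨hc1, hc2⟩ := hc _ ok
      have hh := head_le hc1
      rw [wp_blk_cons, wp_asg, wp_blk_cons]
      simp only [sf_v, sf_ld, ev_v, ev_ld, St.setv_var, St.setv_mem, if_true,
        if_false, Nat.reduceEqDiff, true_and, and_self, St.tick_mem, St.tick_var, e2,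
        aj _ 2 (by norm_num) (by norm_num), m32]
      refine ⟨⟨ok, fun _ => ?_⟩, ?_⟩
      · simp [St.setv_var, hv 0 (by decide), h0]
      set σ₂ : St := ((((σ₁.setv 17 (l₁.length : ℤ) 0).setv 15 (Vs.length + l₁.length : ℤ)
        ((Ex.v 12 + Ex.v 17).cost + 1)).tick ((Ex.ld 1 (Ex.v 15)).cost + 1)).setv 21
        (σ.mem 32 (listChr S)) ((Ex.ld 32 (Ex.ld 2 (Ex.v 15))).cost + 1)) with hσ₂
      have w21 : σ₂.var 21 = σ.mem 32 (listChr S) := by simp [hσ₂, St.setv_var]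
      have w15 : σ₂.var 15 = Vs.length + l₁.length := by simp [hσ₂, St.setv_var]
      have wo : ∀ r, r ∉ pairsP.vars → σ₂.var r = σ.var r := by
        intro r hr
        have := p1 r hr
        rw [← hv r hr]
        simp [hσ₂, St.setv_var, this]
      have wm : σ₂.mem = σ₁.mem := rfl
      have wt : σ₂.time ≤ σ₁.time + 40 := by simp [hσ₂, add_assoc]
      clear_value σ₂
      have hml : ((members Vs Vs.length (listChr S)).length : ℤ) ≤ Vs.length := by
        have : (members Vs Vs.length (listChr S)).length ≤ Vs.length := by
          unfold members
          rw [List.length_reverse]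
          exact (List.length_filter_le _ _).trans (by simp)
        exact_mod_cast this
      -- The existential in the invariant is the part of the list still to be walked; variable 21 is
      -- its head.
      refine Sm.wp_rep_list (members Vs Vs.length (listChr S)) (fun l σ' =>
        TabAdd (l.map fun i => pairTab V.φ V.ψ V.O V.L V.X (V.lo (Vs.getD i []))
          (V.hi (Vs.getD i [])) (V.lo S) (V.hi S)).sum σ₂ σ' ∧
        (∀ r, r ∉ pairsP.vars → σ'.var r = σ.var r) ∧ σ'.var 15 = Vs.length + l₁.length ∧
        (∃ l', members Vs Vs.length (listChr S) = l ++ l' ∧ Chain (σ.mem 13) (σ'.var 21) l') ∧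
        σ'.time ≤ σ₂.time + 30 + V.pairTime * l.length) ?_ ?_ (by omega) ?_ ?_ ?_
      · simp only [sf_ld, sf_v, ev_v, true_and]
        exact V.acc' (by norm_num) (by norm_num) (by omega) (by omega)
      · simp only [ev_ld, ev_v, wm, m14, w21]; exact hc2
      · refine ⟨⟨fun _ _ => rfl, fun _ => by simp⟩, wo, w15, ⟨_, rfl, ?_⟩, ?_⟩
        · rw [St.tick_var, w21]; exact hc1
        · simp
      · rintro la i lb hla σ₃ ⟨t1, t2, t3, ⟨l', t4, t5⟩, t6⟩
        obtain rfl : i :: lb = l' := List.append_cancel_left (hla.symm.trans t4)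
        obtain ⟨t7, t8⟩ := t5
        have him : i ∈ members Vs Vs.length (listChr S) := by rw [hla]; simp
        obtain ⟨hin, hine, hich⟩ := mem_members.1 him
        have hgd : Vs.getD i [] = Vs[i] := by simp [hin]
        rw [hgd] at hine hich
        have n13 : σ₃.mem 13 = σ.mem 13 := by rw [t1.1 13 (by norm_num), wm, m13]
        rw [wp_blk_cons, wp_asg, wp_blk_cons, wp_asg, wp_blk_cons]
        simp only [sf_sub, sf_one, sf_v, sf_ld, ev_sub, ev_one, ev_v, ev_ld, St.setv_var,
          St.setv_mem, if_false, Nat.reduceEqDiff, true_and, and_self, t7,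
          n13]
        refine ⟨V.acc' (by norm_num) (by norm_num) (by omega) (by omega), ?_⟩
        have hso : ∀ (r : ℕ) (z₁ z₂ z₃ : ℤ) (c₁ c₂ c₃ : ℕ), r ∉ pairsP.vars →
            (((σ₃.setv 18 z₁ c₁).setv 22 z₂ c₂).setv 21 z₃ c₃).var r = σ.var r := by
          intro r z₁ z₂ z₃ c₁ c₂ c₃ hr
          have := p1 r hr
          rw [← t2 r hr]
          simp [St.setv_var, this]
        refine Sm.wp_mono _ ?_ (Sm.wp_frame _ (V.pairP_wp (i := i) (j := l₁.length) hi
          (hg.frame fun r hr => hso r _ _ _ _ _ _ (hmv r hr)) (hs.congr fun k _ hk => ?_) hin hj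
          (by rw [hSj]; exact hb _ (List.getElem_mem hin) hine S hSm hne') ?_ ?_))
        · rintro σ₄ ⟨⟨f1, f2⟩, hf⟩
          rw [wp_blk_nil]
          have t9 : TabAdd (pairTab V.φ V.ψ V.O V.L V.X (V.lo (Vs.getD i []))
              (V.hi (Vs.getD i [])) (V.lo S) (V.hi S)) σ₃ σ₄ := by
            rw [hgd, ← hSj]; exact f1
          refine ⟨?_, ?_, ?_, ?_, ?_⟩
          · rw [List.map_append, List.sum_append, List.map_singleton, List.sum_singleton]
            exact t1.trans t9
          · intro r hr
            have hr' : r ∉ pairP.vars := fun h => hr (by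
              have : ∀ r ∈ pairP.vars, r ∈ pairsP.vars := by decide
              exact this r h)
            rw [St.tick_var, St.tick_var, hf.1 r hr', hso r _ _ _ _ _ _ hr]
          · rw [St.tick_var, St.tick_var, hf.1 15 (by decide)]
            simpa [St.setv_var] using t3
          · refine ⟨lb, by rw [hla]; simp, ?_⟩
            rw [St.tick_var, St.tick_var, hf.1 21 (by decide)]
            rw [t7] at t8
            simpa [St.setv_var] using t8
          · rw [List.length_append, List.length_singleton, mul_add, mul_one]
            simp only [St.tick_time, St.setv_time, cost_sub, cost_v, cost_one, cost_ld] at f2 ⊢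
            unfold pairTime at t6 ⊢
            omega
        · rw [St.setv_mem, St.setv_mem, St.setv_mem, t1.1 k (by omega), wm]
          exact htab.1 k (by omega)
        · simp [St.setv_var]
        · simpa [St.setv_var] using t3
      · rintro σ₃ ⟨t1, t2, t3, t4, t5⟩
        rw [wp_blk_nil]
        refine ⟨?_, t2, ?_⟩
        · rw [List.map_append, List.sum_append, List.map_singleton, List.sum_singleton]
          have : TabAdd (V.stringTab Vs S) σ₁ σ₃ := by
            unfold stringTab
            rw [if_neg hne']
            exact ⟨fun k hk => by rw [t1.1 k hk, wm], fun i => by rw [t1.2 i, wm]⟩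
          exact htab.trans this
        · rw [List.map_append, List.sum_append, List.map_singleton, List.sum_singleton]
          simp only [St.tick_time, List.length_append, List.length_singleton]
          have : V.stringTime Vs S = V.pairTime * (members Vs Vs.length (listChr S)).length := by
            unfold stringTime; rw [if_neg hne', mul_comm]
          omega
    · have hne' : S = [] := by simpa using heq
      refine ⟨?_, ?_, ?_⟩
      · rw [List.map_append, List.sum_append, List.map_singleton, List.sum_singleton]
        have : V.stringTab Vs S = 0 := by unfold stringTab; rw [if_pos hne']
        rw [this, add_zero]
        exact htab
      · intro r hr
        have := p1 r hr
        rw [← hv r hr]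
        simp [St.setv_var, this]
      · simp; omega
  · rintro σ₁ ⟨h1, h2, h3⟩
    exact ⟨h1, by simp only [St.tick_time]; omega⟩

end Env

/-! ### Verification of the initialization. -/

namespace Env
variable (V : Env)

lemma initP_wp {σ : St} (h0 : σ.mem 0 0 = V.m) (h1 : σ.mem 0 1 = V.n) (h2 : σ.mem 0 2 = V.φ.1)
    (h3 : σ.mem 0 3 = V.φ.2) (h4 : σ.mem 0 4 = V.ψ.1) (h5 : σ.mem 0 5 = V.ψ.2) :
    initP.wp V.Λ (fun σ' => V.Glob σ' ∧ σ'.time ≤ σ.time + 100 * V.n + 300) σ := by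
  have hX := V.X_lt_half'
  have hXg := V.X_ge
  have hE2 := V.E2_ge; have hE3 := V.E3_le
  have hE4 := V.E4_le; have hB := V.B_le; have hO := V.O_le; have hO' := V.O_le'
  have hX' := V.X_le
  have hE := V.E_le_E2
  have hn := V.n_lt_E
  have hE' := V.E_ge
  have a0 : ∀ (τ : St) (i : ℤ), 0 ≤ i → i < 6 → V.Λ.Acc τ 0 i :=
    fun τ i h1 h2 => V.acc0 h1 (by omega)
  unfold initP
  simp only [wp_blk_cons, wp_asg, sf_ld, ev_ld, sf_zero, sf_one, sf_lit, ev_zero,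
    ev_one, ev_lit, sf_sub, sf_mul, ev_sub, ev_mul, sf_v, ev_v, St.setv_mem, St.setv_var,
    Nat.reduceEqDiff, if_true, if_false, h0, h1, h2, h3, h4, h5, true_and, and_true,
    a0 _ 0 (by norm_num) (by norm_num), a0 _ 1 (by norm_num) (by norm_num),
    a0 _ 2 (by norm_num) (by norm_num), a0 _ 3 (by norm_num) (by norm_num),
    a0 _ 4 (by norm_num) (by norm_num), a0 _ 5 (by norm_num) (by norm_num)]
  -- The language has only counted loops; `n` rounds suffice for all the doublings.
  have hlog : V.ℓ ≤ V.n := by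
    have := Nat.log_lt_self 2 (x := V.n) (by have := V.n_two; omega)
    have := V.ℓ_eq
    omega
  refine Sm.wp_rep (fun i σ' => (σ'.var 8 = 2 ^ min i V.ℓ ∧ σ'.var 9 = (min i V.ℓ : ℕ)) ∧
    (σ'.var 1 = V.m ∧ σ'.var 2 = V.n ∧ σ'.var 3 = V.φ.1 ∧ σ'.var 4 = V.φ.2 ∧ σ'.var 5 = V.ψ.1 ∧
      σ'.var 6 = V.ψ.2 ∧ σ'.var 7 = V.d) ∧ σ'.time ≤ σ.time + 100 * i + 100) V.n (by simp) ?_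
    (by omega) ?_ ?_ ?_
  · simp [St.setv_var]
  · simp [St.setv_var, d, cross, add_assoc]
  · rintro i hi σ₁ ⟨⟨h8, h9⟩, ⟨g1, g2, g3, g4, g5, g6, g7⟩, ht⟩
    have hle : (2 : ℤ) ^ min i V.ℓ ≤ V.E := pow_le_pow_right₀ (by norm_num) (min_le_right _ _)
    have hpos : (0 : ℤ) < 2 ^ min i V.ℓ := by positivity
    -- The doubling stops exactly at the exponent `Nat.log 2 n + 1`.
    have hiff : (2 : ℤ) ^ min i V.ℓ < V.n + 1 ↔ i < V.ℓ := by
      rw [Int.lt_add_one_iff]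
      norm_cast
      rw [← Nat.le_log_iff_pow_le (by norm_num) (by have := V.n_two; omega)]
      have := V.ℓ_eq
      omega
    simp [St.setv_var, h8, h9, g1, g2, g3, g4, g5, g6, g7, hiff]
    refine ⟨by omega, ?_, by omega⟩
    by_cases hil : i < V.ℓ
    · rw [if_pos hil, min_eq_left hil.le, min_eq_left (show i + 1 ≤ V.ℓ by omega), pow_succ]
      constructor
      · ring
      · omega
    · rw [if_neg hil, min_eq_right (show V.ℓ ≤ i by omega),
        min_eq_right (show V.ℓ ≤ i + 1 by omega)]
      constructor
      · ring
      · omega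
  · rintro σ₁ ⟨⟨h8, h9⟩, ⟨g1, g2, g3, g4, g5, g6, g7⟩, ht⟩
    rw [min_eq_right hlog] at h8 h9
    change σ₁.var 8 = V.E at h8
    simp only [wp_blk_cons, wp_blk_nil, wp_asg, sf_lit, sf_mul, ev_lit, ev_mul, sf_v, ev_v,
      St.setv_var, St.tick_var, Nat.reduceEqDiff, if_true, if_false, h8, h9, true_and]
    refine ⟨?_, ?_⟩
    · constructor <;> simp [St.setv_var, g1, g2, g3, g4, g5, g6, g7, L, O, X] <;> ring
    · simp; omega

end Env

/-! ### Reading the input and computing the bounds of the strings. -/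

/-- The cells of an array from `p` on hold the list. -/
def Seg (raw : ℤ → ℤ) : ℤ → List ℤ → Prop
  | _, [] => True
  | p, z :: l => raw p = z ∧ Seg raw (p + 1) l

lemma seg_append {raw : ℤ → ℤ} : ∀ {l l' : List ℤ} {p : ℤ},
    Seg raw p (l ++ l') ↔ Seg raw p l ∧ Seg raw (p + l.length) l' := by
  intro l
  induction l with
  | nil => intro l' p; simp [Seg]
  | cons a l ih =>
    intro l' p
    simp only [List.cons_append, Seg, ih, List.length_cons, and_assoc]
    rw [show p + 1 + (l.length : ℤ) = p + ((l.length + 1 : ℕ) : ℤ) by push_cast; ring]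

lemma loStep_eq (O z a : ℤ) : loStep O z a = if z - O < a then z - O else a := by
  unfold loStep; split_ifs <;> ring

lemma hiStep_eq (O z a : ℤ) : hiStep O z a = if a < z + O then z + O else a := by
  unfold hiStep; split_ifs <;> ring

namespace Env
variable (V : Env)

lemma fn_bound {u : Pt} (h1 : |u.1| ≤ V.n) (h2 : |u.2| ≤ V.n) {k : ℕ} (hk : k < 4) :
    |fn V.φ V.ψ k u| ≤ 2 * V.E ^ 3 := by
  have hn := V.n_lt_E
  have h3 := V.φ1; have h4 := V.φ2; have h5 := V.ψ1; have h6 := V.ψ2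
  have hd := V.d_pos; have hd2 := V.d_lt
  have hE := V.E_ge
  have hE3 := V.E3_le
  have hE2 := V.E2_ge
  have key : ∀ x y a b : ℤ, |x| ≤ V.n → |y| ≤ V.n → |a| ≤ V.n → |b| ≤ V.n →
      |a * y - b * x| ≤ 2 * V.E ^ 3 := by
    intro x y a b hx hy ha hb
    have e1 : |a * y| ≤ V.E * V.E := by rw [abs_mul]; gcongr <;> omega
    have e2 : |b * x| ≤ V.E * V.E := by rw [abs_mul]; gcongr <;> omega
    have := abs_sub (a * y) (b * x)
    have : V.E * V.E = V.E ^ 2 := by ring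
    omega
  have key2 : ∀ x : ℤ, |x| ≤ V.n → |V.d * x| ≤ 2 * V.E ^ 3 := by
    intro x hx
    rw [abs_mul, abs_of_pos hd]
    calc V.d * |x| ≤ (2 * V.E ^ 2) * V.E := by gcongr; omega
      _ = _ := by ring
  interval_cases k
  · exact key _ _ _ _ h1 h2 (by rw [abs_le]; omega) (by rw [abs_le]; omega)
  · exact key _ _ _ _ h1 h2 (by rw [abs_le]; omega) (by rw [abs_le]; omega)
  · rw [fn_two]; exact key2 _ h1
  · rw [fn_three]; exact key2 _ h2

lemma E3_le_O : 4 * V.E ^ 3 ≤ V.O := by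
  have hE4 := V.E4_le; have hB := V.B_le; have hO := V.O_le
  have : 0 < V.E ^ 3 := by have := V.E_ge; positivity
  omega

variable {V} in
lemma fold_bound {L : StoredStr}
    (h : ∀ p ∈ L, (0 ≤ p.1.1 ∧ p.1.1 < V.n) ∧ 0 ≤ p.1.2 ∧ p.1.2 < V.n) {k : ℕ} (hk : k < 4) :
    |V.loRaw k L| ≤ 2 * V.O ∧ |V.hiRaw k L| ≤ 2 * V.O := by
  have hO := V.E3_le_O
  have hE : 0 < V.E ^ 3 := by have := V.E_ge; positivity
  unfold loRaw hiRaw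
  induction L using List.reverseRecOn with
  | nil => simp; omega
  | append_singleton L p ih =>
    obtain ⟨ih1, ih2⟩ := ih fun p hp => h p (by simp [hp])
    have hp := h p (by simp)
    have hb := V.fn_bound (u := p.1) (by rw [abs_le]; omega) (by rw [abs_le]; omega) hk
    rw [abs_le] at hb ih1 ih2
    rw [List.foldl_append, List.foldl_append, List.foldl_cons, List.foldl_cons, List.foldl_nil,
      List.foldl_nil, abs_le, abs_le]
    rw [loStep_eq, hiStep_eq]
    constructor <;> split_ifs <;> omega

/-- Index of the point `u` in the arrays indexed by points. -/
def pidx (u : Pt) : ℤ := (u.1 + V.E ^ 2) * V.E ^ 4 + (u.2 + V.E ^ 2)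

lemma pidx_bound {u : Pt} (h1 : |u.1| ≤ V.E ^ 2) (h2 : |u.2| ≤ V.E ^ 2) :
    0 ≤ V.pidx u ∧ V.pidx u < V.X := by
  rw [abs_le] at h1 h2
  have hE4 := V.E4_le; have hB := V.B_le; have hO := V.O_le; have hO' := V.O_le'
  have hX' := V.X_le; have hE2 := V.E2_ge; have hE3 := V.E3_le
  unfold pidx
  have e1 : 0 ≤ (u.1 + V.E ^ 2) * V.E ^ 4 := mul_nonneg (by omega) (by omega)
  have e2 : (u.1 + V.E ^ 2) * V.E ^ 4 ≤ (2 * V.E ^ 2) * V.E ^ 4 :=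
    mul_le_mul_of_nonneg_right (by omega) (by omega)
  have e3 : (2 * V.E ^ 2) * V.E ^ 4 = 2 * V.O := by unfold O; ring
  omega

/-- The shifted second coordinate stays below `2 * E ^ 2`, less than the stride `E ^ 4`, so it
cannot carry into the first; the first coordinate needs no bound. -/
lemma pidx_inj {u v : Pt} (h2 : |u.2| < V.E ^ 2) (h2' : |v.2| < V.E ^ 2) :
    V.pidx u = V.pidx v ↔ u = v := by
  refine ⟨fun h => ?_, fun h => by rw [h]⟩
  rw [abs_lt] at h2 h2'
  have hE4 := V.E4_le; have hE2 := V.E2_ge; have hE3 := V.E3_le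
  unfold pidx at h
  have e1 : u.1 = v.1 := by
    rcases lt_trichotomy u.1 v.1 with hl | hl | hl
    · nlinarith
    · exact hl
    · nlinarith
  rw [e1] at h
  exact Prod.ext e1 (by omega)

lemma acc_pidx {σ : St} {k : ℕ} (h1 : 1 ≤ k) (h2 : k ≤ 31) {u : Pt} (h3 : |u.1| ≤ V.E ^ 2)
    (h4 : |u.2| ≤ V.E ^ 2) : V.Λ.Acc σ k (V.pidx u) :=
  V.acc' h1 h2 (V.pidx_bound h3 h4).1 (V.pidx_bound h3 h4).2

lemma n_le_E2 : 4 * (V.n : ℤ) ≤ V.E ^ 2 := by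
  have := V.n_lt_E; have := V.E_le_E2; omega

lemma functionalsP_wp {σ : St} (hg : V.Glob σ) {u : Pt} (h1 : σ.var 20 = u.1)
    (h2 : σ.var 21 = u.2) : functionalsP.wp V.Λ (fun σ' => (∀ k < 4, σ'.var (22 + k) =
      fn V.φ V.ψ k u) ∧ σ'.time ≤ σ.time + 50) σ := by
  unfold functionalsP
  simp only [wp_blk_cons, wp_blk_nil, wp_asg, sf_sub, sf_mul, sf_v, ev_sub, ev_mul, ev_v,
    St.setv_var, Nat.reduceEqDiff, if_true, if_false, h1, h2, hg.v3, hg.v4, hg.v5, hg.v6,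
    true_and, and_self]
  refine ⟨fun k hk => ?_, ?_⟩
  · interval_cases k <;> simp [St.setv_var, fn, lin, cross]
  · simp

lemma hullStep_wp {σ : St} (hg : V.Glob σ) {g : ℤ} (h15 : σ.var 15 = g) (hg0 : 0 ≤ g)
    (hgX : g < V.X) {k : ℕ} (hk : k < 4) {z : ℤ} (hz : σ.var (22 + k) = z) (hzb : |z| ≤ V.O)
    (hlo : |σ.mem (3 + k) g| ≤ 2 * V.O) (hhi : |σ.mem (7 + k) g| ≤ 2 * V.O) :
    (hullStep k).wp V.Λ (fun σ' => σ'.var = σ.var ∧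
      σ'.mem (3 + k) = Function.update (σ.mem (3 + k)) g (loStep V.O z (σ.mem (3 + k) g)) ∧
      σ'.mem (7 + k) = Function.update (σ.mem (7 + k)) g (hiStep V.O z (σ.mem (7 + k) g)) ∧
      σ'.time ≤ σ.time + 100) σ := by
  have hX := V.X_lt_half'
  have hO := V.O_le'
  have hX' := V.X_le
  rw [abs_le] at hzb hlo hhi
  have a1 : ∀ τ : St, V.Λ.Acc τ (3 + k) g := fun τ => V.acc' (by omega) (by omega) hg0 hgX
  have a2 : ∀ τ : St, V.Λ.Acc τ (7 + k) g := fun τ => V.acc' (by omega) (by omega) hg0 hgX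
  have n1 : 7 + k ≠ 3 + k := by omega
  have n2 : 3 + k ≠ 7 + k := by omega
  unfold hullStep
  simp [St.setm_mem, h15, hz, hg.v10, a1, a2, loStep, hiStep]
  omega

end Env

namespace Env
variable (V : Env)

lemma hullSteps_wp {g : ℤ} (hg0 : 0 ≤ g) (hgX : g < V.X) (z : ℕ → ℤ) (hzb : ∀ k < 4, |z k| ≤ V.O) :
    ∀ (ks : List ℕ) (σ : St), V.Glob σ → σ.var 15 = g → (∀ k ∈ ks, k < 4) → ks.Nodup →
    (∀ k < 4, σ.var (22 + k) = z k) →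
    (∀ k < 4, |σ.mem (3 + k) g| ≤ 2 * V.O ∧ |σ.mem (7 + k) g| ≤ 2 * V.O) →
    (blk (ks.map hullStep)).wp V.Λ (fun σ' => σ'.var = σ.var ∧
      (∀ k ∈ ks,
        σ'.mem (3 + k) = Function.update (σ.mem (3 + k)) g (loStep V.O (z k) (σ.mem (3 + k) g)) ∧
        σ'.mem (7 + k) = Function.update (σ.mem (7 + k)) g (hiStep V.O (z k) (σ.mem (7 + k) g))) ∧
      (∀ j, (∀ k ∈ ks, j ≠ 3 + k ∧ j ≠ 7 + k) → σ'.mem j = σ.mem j) ∧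
      σ'.time ≤ σ.time + 100 * ks.length + 1) σ := by
  intro ks
  induction ks with
  | nil => intro σ _ _ _ _ _ _; simp
  | cons k r ih =>
    intro σ hg h15 hk hnd hz hb
    have hk4 := hk k (by simp)
    have hks := hk
    rw [List.nodup_cons] at hnd
    rw [List.map_cons, wp_blk_cons]
    refine Sm.wp_mono _ ?_ (Sm.wp_frame _ (V.hullStep_wp hg h15 hg0 hgX hk4 (hz k hk4)
      (hzb k hk4) (hb k hk4).1 (hb k hk4).2))
    rintro σ₁ ⟨⟨p1, p2, p3, p4⟩, hf⟩
    have hm : ∀ j, j ≠ 3 + k → j ≠ 7 + k → σ₁.mem j = σ.mem j := by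
      intro j h1 h2
      exact hf.2 j (by simp [hullStep, blk, Sm.arrs, h1, h2])
    have hbnd : ∀ z' a : ℤ, |z'| ≤ V.O → |a| ≤ 2 * V.O →
        |loStep V.O z' a| ≤ 2 * V.O ∧ |hiStep V.O z' a| ≤ 2 * V.O := by
      intro z' a h1 h2
      rw [loStep_eq, hiStep_eq]
      rw [abs_le] at h1 h2
      constructor <;> split_ifs <;> rw [abs_le] <;> omega
    refine Sm.wp_mono _ ?_ (ih σ₁ (hg.frame fun r _ => by rw [p1]) (by rw [p1, h15])
      (fun k' hk' => hk k' (by simp [hk'])) hnd.2 (by rw [p1]; exact hz) ?_)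
    · rintro σ₂ ⟨q1, q2, q3, q4⟩
      refine ⟨by rw [q1, p1], ?_, ?_, by rw [List.length_cons]; omega⟩
      · intro k' hk'
        rcases List.mem_cons.1 hk' with rfl | hk''
        · have hne : ∀ j ∈ r, j ≠ k' := by rintro j hj rfl; exact hnd.1 hj
          rw [q3 _ fun k hk => ?_, q3 _ fun k hk => ?_]
          · exact ⟨p2, p3⟩
          · have := hne k hk; have := hks k (by simp [hk]); omega
          · have := hne k hk; have := hks k (by simp [hk]); omega
        · have hne : k' ≠ k := by intro h; exact hnd.1 (h ▸ hk'')
          have := hk k' (by simp [hk''])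
          have := q2 k' hk''
          rwa [hm (3 + k') (by omega) (by omega), hm (7 + k') (by omega) (by omega)] at this
      · intro j hj
        rw [q3 j fun k' hk' => hj k' (by simp [hk'])]
        exact hm j (hj k (by simp)).1 (hj k (by simp)).2
    · intro k' hk'
      by_cases h : k' = k
      · subst h
        rw [p2, p3, Function.update_self, Function.update_self]
        exact ⟨(hbnd _ _ (hzb k' hk4) (hb k' hk4).1).1, (hbnd _ _ (hzb k' hk4) (hb k' hk4).2).2⟩
      · rw [hm (3 + k') (by omega) (by omega), hm (7 + k') (by omega) (by omega)]
        exact hb k' hk'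

lemma hullP_wp {σ : St} (hg : V.Glob σ) {g : ℤ} (h15 : σ.var 15 = g) (hg0 : 0 ≤ g)
    (hgX : g < V.X) {u : Pt} (h20 : σ.var 20 = u.1) (h21 : σ.var 21 = u.2)
    (hx : (0 ≤ u.1 ∧ u.1 < V.n) ∧ 0 ≤ u.2 ∧ u.2 < V.n)
    (hb : ∀ k < 4, |σ.mem (3 + k) g| ≤ 2 * V.O ∧ |σ.mem (7 + k) g| ≤ 2 * V.O) :
    hullP.wp V.Λ (fun σ' => σ'.var 14 = σ.var 14 ∧
      (∀ k < 4, σ'.mem (3 + k) = Function.update (σ.mem (3 + k)) g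
          (loStep V.O (fn V.φ V.ψ k u) (σ.mem (3 + k) g)) ∧
        σ'.mem (7 + k) = Function.update (σ.mem (7 + k)) g
          (hiStep V.O (fn V.φ V.ψ k u) (σ.mem (7 + k) g))) ∧
      σ'.mem 2 = σ.mem 2 ∧ σ'.mem 11 = σ.mem 11 ∧ σ'.time ≤ σ.time + 460) σ := by
  have hO := V.E3_le_O
  have hE : 0 < V.E ^ 3 := by have := V.E_ge; positivity
  have hfb : ∀ k < 4, |fn V.φ V.ψ k u| ≤ V.O := fun k hk =>
    (V.fn_bound (by rw [abs_le]; omega) (by rw [abs_le]; omega) hk).trans (by omega)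
  unfold hullP
  rw [wp_blk_cons]
  refine Sm.wp_mono _ ?_ (Sm.wp_frame _ (V.functionalsP_wp hg h20 h21))
  rintro σ₁ ⟨⟨f1, f2⟩, hf⟩
  have fm : ∀ k, σ₁.mem k = σ.mem k := fun k => hf.2 k (by simp [functionalsP, blk, Sm.arrs])
  rw [wp_blk_cons]
  refine Sm.wp_mono _ ?_ (V.hullSteps_wp hg0 hgX (fun k => fn V.φ V.ψ k u) hfb dims σ₁
    (hg.frame fun r hr => hf.1 r (by fin_cases hr <;> decide)) (by rw [hf.1 15 (by decide), h15])
    (by simp [dims]) (by decide) f1 (by intro k hk; rw [fm, fm]; exact hb k hk))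
  rintro σ₂ ⟨q1, q2, q3, q4⟩
  refine ⟨?_, ?_, ?_, ?_, ?_⟩
  · rw [St.tick_var, q1, hf.1 14 (by decide)]
  · intro k hk
    have := q2 k (by simp [dims]; omega)
    rwa [fm, fm] at this
  · rw [St.tick_mem, q3 2 (by simp [dims]), fm]
  · rw [St.tick_mem, q3 11 (by simp [dims]), fm]
  · simp [dims] at q4 f2 ⊢; omega

lemma pointP_wp {σ : St} (hg : V.Glob σ) {p : ℤ} {x : Pt × ℤ} (h14 : σ.var 14 = p)
    (hraw : Seg (σ.mem 0) p [x.1.1, x.1.2, x.2]) (hp0 : 0 ≤ p) (hpX : p + 3 < V.X)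
    {g : ℤ} (h15 : σ.var 15 = g) (hg0 : 0 ≤ g) (hgX : g < V.X)
    (hx : (0 ≤ x.1.1 ∧ x.1.1 < V.n) ∧ 0 ≤ x.1.2 ∧ x.1.2 < V.n)
    (hb : ∀ k < 4, |σ.mem (3 + k) g| ≤ 2 * V.O ∧ |σ.mem (7 + k) g| ≤ 2 * V.O) :
    pointP.wp V.Λ (fun σ' => σ'.var 14 = p + 3 ∧
      σ'.mem 2 = Function.update (σ.mem 2) g x.2 ∧
      σ'.mem 11 = Function.update (σ.mem 11) (V.pidx x.1) (σ.mem 11 (V.pidx x.1) + σ.var 16) ∧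
      (∀ k < 4, σ'.mem (3 + k) = Function.update (σ.mem (3 + k)) g
          (loStep V.O (fn V.φ V.ψ k x.1) (σ.mem (3 + k) g)) ∧
        σ'.mem (7 + k) = Function.update (σ.mem (7 + k)) g
          (hiStep V.O (fn V.φ V.ψ k x.1) (σ.mem (7 + k) g))) ∧
      σ'.time ≤ σ.time + 600) σ := by
  obtain ⟨r1, r2, r3, -⟩ := hraw
  rw [show p + 1 + 1 = p + 2 by ring] at r3
  have hn := V.n_le_E2
  have hO := V.E3_le_O
  have hE : 0 < V.E ^ 3 := by have := V.E_ge; positivity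
  have a0 : ∀ τ : St, V.Λ.Acc τ 0 p := fun τ => V.acc0 (by omega) (by omega)
  have a1 : ∀ τ : St, V.Λ.Acc τ 0 (p + 1) := fun τ => V.acc0 (by omega) (by omega)
  have a2 : ∀ τ : St, V.Λ.Acc τ 0 (p + 2) := fun τ => V.acc0 (by omega) (by omega)
  have a3 : ∀ τ : St, V.Λ.Acc τ 2 g := fun τ => V.acc' (by norm_num) (by norm_num) hg0 hgX
  have a4 : ∀ τ : St, V.Λ.Acc τ 11 ((x.1.1 + V.E ^ 2) * V.E ^ 4 + (x.1.2 + V.E ^ 2)) :=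
    fun τ => V.acc_pidx (u := x.1) (by norm_num) (by norm_num) (by rw [abs_le]; omega)
      (by rw [abs_le]; omega)
  unfold pointP
  simp only [wp_blk_cons, wp_asg, wp_st, pidxE, sf_ld, ev_ld, sf_add, sf_mul, sf_lit,
    sf_one, sf_v, ev_v, ev_add, ev_mul, ev_lit, ev_one, St.setv_var, St.setv_mem, St.setm_mem,
    St.setm_var, Nat.reduceEqDiff, if_true, if_false, h14, h15, r1, r2, r3, a0, a1, a2, a3, a4,
    hg.v28, hg.v29, true_and, and_self]
  refine Sm.wp_mono _ ?_ (V.hullP_wp (u := x.1) (g := g) (hg.frame ?_) ?_ hg0 hgX ?_ ?_ hx ?_)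
  · rintro σ₁ ⟨q1, q2, q3, q4, q5⟩
    refine ⟨?_, ?_, ?_, ?_, ?_⟩
    · rw [St.tick_var, q1]; simp [St.setv_var]
    · rw [St.tick_mem, q3]; simp [St.setm_mem]
    · rw [St.tick_mem, q4]; simp [St.setm_mem, pidx]
    · intro k hk
      have := q2 k hk
      simp only [St.setm_mem, St.setv_mem] at this
      rwa [if_neg (by omega), if_neg (by omega), if_neg (by omega), if_neg (by omega)] at this
    · simp at q5 ⊢; omega
  · intro r hr
    fin_cases hr <;> simp [St.setv_var]
  · simp [St.setv_var, h15]
  · simp [St.setv_var]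
  · simp [St.setv_var]
  · intro k hk
    simp only [St.setm_mem, St.setv_mem]
    rw [if_neg (by omega), if_neg (by omega), if_neg (by omega), if_neg (by omega)]
    exact hb k hk

end Env

namespace Env
variable (V : Env)

/-- The number of points of `L` with index `i`. -/
def marks (L : StoredStr) (i : ℤ) : ℤ := (L.map fun p => ind (V.pidx p.1 = i)).sum

lemma length_encodeStr (L : StoredStr) : (encodeStr L).length = 3 * L.length + 1 := by
  unfold encodeStr
  induction L with
  | nil => rfl
  | cons a L ih => simp at ih ⊢; omega

lemma seg_points {raw : ℤ → ℤ} {p : ℤ} {l₁ l₂ : StoredStr} {x : Pt × ℤ}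
    (h : Seg raw p ((l₁ ++ x :: l₂).flatMap fun p => [p.1.1, p.1.2, p.2])) :
    Seg raw (p + 3 * l₁.length) [x.1.1, x.1.2, x.2] := by
  rw [List.flatMap_append, List.flatMap_cons, seg_append, seg_append] at h
  have hl : ((l₁.flatMap fun p => [p.1.1, p.1.2, p.2]).length : ℤ) = 3 * l₁.length := by
    have := length_encodeStr l₁
    simp [encodeStr] at this ⊢
    omega
  rw [← hl]
  exact h.2.1

/-- The arrays other than those written while reading strings, and the cells other than `g` of
the arrays that are indexed by strings, are unchanged. -/
def OffString (g : ℤ) (σ σ' : St) : Prop :=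
  (∀ k, 1 ≤ k → k ≤ 10 → ∀ i, i ≠ g → σ'.mem k i = σ.mem k i) ∧
    ∀ k, k = 0 ∨ 12 ≤ k → σ'.mem k = σ.mem k

/-- The cells `g` describe the string `L`. -/
structure StrAt (g : ℤ) (L : StoredStr) (mem : ℕ → ℤ → ℤ) : Prop where
  chr : mem 2 g = listChr L
  lo : ∀ k < 4, mem (3 + k) g = V.loRaw k L
  hi : ∀ k < 4, mem (7 + k) g = V.hiRaw k L

lemma stringP_wp {σ : St} (hg : V.Glob σ) {p : ℤ} {L : StoredStr} (h14 : σ.var 14 = p)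
    (hraw : Seg (σ.mem 0) p (encodeStr L)) (hp0 : 0 ≤ p)
    (hpX : p + (encodeStr L).length < V.X)
    {g : ℤ} (h15 : σ.var 15 = g) (hg0 : 0 ≤ g) (hgX : g < V.X)
    (hL : ∀ x ∈ L, (0 ≤ x.1.1 ∧ x.1.1 < V.n) ∧ 0 ≤ x.1.2 ∧ x.1.2 < V.n)
    (hz : ∀ k, 1 ≤ k → k ≤ 10 → σ.mem k g = 0) :
    stringP.wp V.Λ (fun σ' => σ'.var 14 = p + (encodeStr L).length ∧ σ'.var 15 = g + 1 ∧
      σ'.mem 1 g = L.length ∧ V.StrAt g L σ'.mem ∧ OffString g σ σ' ∧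
      (∀ i, σ'.mem 11 i = σ.mem 11 i + σ.var 16 * V.marks L i) ∧
      σ'.time ≤ σ.time + 700 * L.length + 100) σ := by
  have hX := V.X_lt_half'
  rw [length_encodeStr] at hpX ⊢
  push_cast at hpX ⊢
  obtain ⟨r1, hraw⟩ := hraw
  have a0 : ∀ τ : St, V.Λ.Acc τ 0 p := fun τ => V.acc0 (by omega) (by omega)
  have a1 : ∀ τ : St, V.Λ.Acc τ 1 g := fun τ => V.acc' (by norm_num) (by norm_num) hg0 hgX
  have hmv : ∀ r ∈ [1, 2, 3, 4, 5, 6, 7, 9, 10, 11, 28, 29], r ∉ stringP.vars := by decide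
  unfold stringP
  rw [wp_blk_cons, wp_asg, wp_blk_cons, wp_asg, wp_blk_cons, wp_st, wp_blk_cons]
  simp only [sf_ld, ev_ld, sf_add, sf_one, sf_v, ev_v, ev_add, ev_one, St.setv_var,
    Nat.reduceEqDiff, if_true, if_false, h14, h15, r1, a0, a1, true_and, and_self]
  refine Sm.wp_rep_list L (fun l σ' => σ'.var 14 = p + 1 + 3 * l.length ∧
    (∀ r, r ∉ stringP.vars → σ'.var r = σ.var r) ∧ σ'.var 15 = g ∧ σ'.mem 1 g = L.length ∧
    V.StrAt g l σ'.mem ∧ OffString g σ σ' ∧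
    (∀ i, σ'.mem 11 i = σ.mem 11 i + σ.var 16 * V.marks l i) ∧
    σ'.time ≤ σ.time + 700 * l.length + 50) (by simp) (by simp [St.setv_var]) (by omega) ?_ ?_ ?_
  · refine ⟨?_, ?_, ?_, ?_, ?_, ⟨?_, ?_⟩, ?_, ?_⟩
    · simp [St.setv_var]
    · intro r hr
      have : r ≠ 14 ∧ r ≠ 19 := by
        constructor <;> (rintro rfl; exact hr (by decide))
      simp [St.setv_var, this]
    · simp [St.setv_var, h15]
    · simp [St.setm_mem]
    -- Cells that are still zero are precisely the starting values of the folds for character and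
    -- bounds, so no initialization is required.
    · constructor
      · simpa [St.setm_mem, listChr] using hz 2 (by norm_num) (by norm_num)
      · intro k hk
        rw [St.tick_mem, St.setm_mem, if_neg (by omega)]
        exact hz (3 + k) (by omega) (by omega)
      · intro k hk
        rw [St.tick_mem, St.setm_mem, if_neg (by omega)]
        exact hz (7 + k) (by omega) (by omega)
    · intro k h1 h2 i hi
      rw [St.tick_mem, St.setm_mem]
      split_ifs with h
      · rw [Function.update_of_ne hi, h]; rfl
      · rfl
    · intro k hk
      rw [St.tick_mem, St.setm_mem, if_neg (by omega)]; rfl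
    · intro i; simp [St.setm_mem, marks]
    · simp
  · rintro l₁ x l₂ rfl σ₁ ⟨i1, i2, i3, i4, i5, i6, i7, i8⟩
    have hx := hL x (by simp)
    have hb : ∀ k < 4, |σ₁.mem (3 + k) g| ≤ 2 * V.O ∧ |σ₁.mem (7 + k) g| ≤ 2 * V.O := by
      intro k hk
      rw [i5.lo k hk, i5.hi k hk]
      exact V.fold_bound (fun q hq => hL q (by simp [hq])) hk
    have hseg := seg_points hraw
    rw [List.length_append, List.length_cons] at hpX
    push_cast at hpX
    refine Sm.wp_mono _ ?_ (Sm.wp_frame _ (V.pointP_wp (x := x) (g := g) (hg.frame ?_)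
      (p := p + 1 + 3 * l₁.length) ?_ ?_ (by omega) (by omega) ?_ hg0 hgX hx hb))
    · rintro σ₂ ⟨⟨q1, q2, q3, q4, q5⟩, hf⟩
      simp only [St.setv_mem] at q2 q3 q4
      have fm : ∀ k, k ∉ [2, 11, 3, 7, 4, 8, 5, 9, 6, 10] → σ₂.mem k = σ₁.mem k :=
        fun k hk => hf.2 k hk
      refine ⟨?_, ?_, ?_, ?_, ?_, ⟨?_, ?_⟩, ?_, ?_⟩
      · rw [St.tick_var, q1]; simp; ring
      · intro r hr
        have h18 : r ≠ 18 := by rintro rfl; exact hr (by decide)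
        rw [St.tick_var, hf.1 r (fun h => hr (by
            have : ∀ r ∈ pointP.vars, r ∈ stringP.vars := by decide
            exact this r h)), St.setv_var, if_neg h18, i2 r hr]
      · rw [St.tick_var, hf.1 15 (by decide)]; simp [St.setv_var, i3]
      · rw [St.tick_mem, fm 1 (by decide), i4]
      · constructor
        · rw [St.tick_mem, q2, Function.update_self]; simp [listChr]
        · intro k hk
          rw [St.tick_mem, (q4 k hk).1, Function.update_self, i5.lo k hk]
          simp [loRaw]
        · intro k hk
          rw [St.tick_mem, (q4 k hk).2, Function.update_self, i5.hi k hk]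
          simp [hiRaw]
      · intro k h1 h2 i hi
        rw [← i6.1 k h1 h2 i hi, St.tick_mem]
        rcases lt_or_ge k 3 with h | h
        · rcases (show k = 1 ∨ k = 2 by omega) with rfl | rfl
          · rw [fm 1 (by decide)]
          · rw [q2, Function.update_of_ne hi]
        · rcases lt_or_ge k 7 with h' | h'
          · obtain ⟨j, rfl⟩ := Nat.exists_eq_add_of_le h
            rw [(q4 j (by omega)).1, Function.update_of_ne hi]
          · obtain ⟨j, rfl⟩ := Nat.exists_eq_add_of_le h'
            rw [(q4 j (by omega)).2, Function.update_of_ne hi]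
      · intro k hk
        rw [St.tick_mem, fm k (by simp; omega)]
        exact i6.2 k hk
      · intro i
        have h16 : σ₁.var 16 = σ.var 16 := i2 16 (by decide)
        have hm : V.marks (l₁ ++ [x]) i = V.marks l₁ i + ind (V.pidx x.1 = i) := by
          simp [marks]
        rw [St.tick_mem, q3, hm, mul_add, ← add_assoc, ← i7, St.setv_var, if_neg (by norm_num),
          h16, Function.update_apply]
        unfold ind
        split_ifs with e1 e2 e2
        · rw [e1]; ring
        · exact absurd e1.symm e2
        · exact absurd e2.symm e1
        · ring
      · simp only [St.tick_time, St.setv_time, List.length_append, List.length_singleton] at q5 ⊢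
        omega
    · intro r hr
      have h18 : r ≠ 18 := by rintro rfl; revert hr; decide
      rw [St.setv_var, if_neg h18]
      exact i2 r (hmv r hr)
    · simp [St.setv_var, i1]
    · rw [St.setv_mem, i6.2 0 (by norm_num)]
      exact hseg
    · simp [St.setv_var, i3]
  · rintro σ₁ ⟨i1, i2, i3, i4, i5, i6, i7, i8⟩
    simp only [wp_blk_cons, wp_blk_nil, wp_asg, sf_add, sf_v, sf_one, ev_add, ev_v, ev_one, true_and]
    refine ⟨?_, ?_, i4, ⟨i5.1, i5.2, i5.3⟩, i6, i7, ?_⟩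
    · simp [St.setv_var, i1]; ring
    · simp [St.setv_var, i3]
    · simp; omega

end Env

namespace Env
variable (V : Env)

variable {V} in
lemma Strs.snoc {all : List StoredStr} {L : StoredStr} {mem mem' : ℕ → ℤ → ℤ}
    (h : V.Strs all mem)
    (he : ∀ k, 1 ≤ k → k ≤ 10 → ∀ i : ℤ, i ≠ (all.length : ℕ) → mem' k i = mem k i)
    (h1 : mem' 1 (all.length : ℕ) = L.length) (hL : V.StrAt (all.length : ℕ) L mem') :
    V.Strs (all ++ [L]) mem' := by
  have key : ∀ (g : ℕ) (L' : StoredStr), (all ++ [L])[g]? = some L' →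
      (g = all.length ∧ L' = L) ∨ (g ≠ all.length ∧ all[g]? = some L') := by
    intro g L' hg
    rcases lt_trichotomy g all.length with h | h | h
    · rw [List.getElem?_append_left h] at hg
      exact Or.inr ⟨h.ne, hg⟩
    · subst h
      simp at hg
      exact Or.inl ⟨rfl, hg.symm⟩
    · rw [List.getElem?_eq_none (by simp; omega)] at hg
      simp at hg
  have hne : ∀ g : ℕ, g ≠ all.length → (g : ℤ) ≠ (all.length : ℕ) := by intro g h; omega
  constructor
  · intro g L' hg
    rcases key g L' hg with ⟨rfl, rfl⟩ | ⟨hn, hg'⟩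
    · exact h1
    · rw [he 1 (by norm_num) (by norm_num) _ (hne g hn)]; exact h.len g L' hg'
  · intro g L' hg
    rcases key g L' hg with ⟨rfl, rfl⟩ | ⟨hn, hg'⟩
    · exact hL.chr
    · rw [he 2 (by norm_num) (by norm_num) _ (hne g hn)]; exact h.chr g L' hg'
  · intro k hk g L' hg
    rcases key g L' hg with ⟨rfl, rfl⟩ | ⟨hn, hg'⟩
    · exact hL.lo k hk
    · rw [he (3 + k) (by omega) (by omega) _ (hne g hn)]; exact h.lo k hk g L' hg'
  · intro k hk g L' hg
    rcases key g L' hg with ⟨rfl, rfl⟩ | ⟨hn, hg'⟩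
    · exact hL.hi k hk
    · rw [he (7 + k) (by omega) (by omega) _ (hne g hn)]; exact h.hi k hk g L' hg'

/-- The number of steps allotted to reading a family. -/
def famTime (Ls : List StoredStr) : ℕ := (Ls.map fun L => 700 * L.length + 200).sum

/-- The arrays after reading the strings in `all`. -/
structure Read (all : List StoredStr) (σ : St) : Prop where
  v15 : σ.var 15 = all.length
  strs : V.Strs all σ.mem
  zero : ∀ k, 1 ≤ k → k ≤ 10 → ∀ g : ℤ, all.length ≤ g → σ.mem k g = 0

lemma familyP_wp {σ : St} (hg : V.Glob σ) {p : ℤ} {D Ls : List StoredStr} {r : ℕ}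
    (hr : σ.var r = Ls.length)
    (h14 : σ.var 14 = p) (hraw : Seg (σ.mem 0) p (Ls.flatMap encodeStr)) (hp0 : 0 ≤ p)
    (hpX : p + (Ls.flatMap encodeStr).length < V.X) (hD : V.Read D σ)
    (hlen : (D.length : ℤ) + Ls.length < V.X)
    (hL : ∀ L ∈ Ls, ∀ x ∈ L, (0 ≤ x.1.1 ∧ x.1.1 < V.n) ∧ 0 ≤ x.1.2 ∧ x.1.2 < V.n) :
    (Sm.rep 17 (.v r) stringP).wp V.Λ (fun σ' => σ'.var 14 = p + (Ls.flatMap encodeStr).length ∧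
      V.Read (D ++ Ls) σ' ∧ (∀ k, k = 0 ∨ 12 ≤ k → σ'.mem k = σ.mem k) ∧
      (∀ i, σ'.mem 11 i = σ.mem 11 i + σ.var 16 * (Ls.map fun L => V.marks L i).sum) ∧
      (∀ r, r ∉ 17 :: stringP.vars → σ'.var r = σ.var r) ∧
      σ'.time ≤ σ.time + famTime Ls + 10) σ := by
  have hX := V.X_lt_half'
  have hmv : ∀ r ∈ [1, 2, 3, 4, 5, 6, 7, 9, 10, 11, 28, 29], r ∉ 17 :: stringP.vars := by decide
  refine Sm.wp_rep_list Ls (fun l σ' => σ'.var 14 = p + (l.flatMap encodeStr).length ∧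
      V.Read (D ++ l) σ' ∧ (∀ k, k = 0 ∨ 12 ≤ k → σ'.mem k = σ.mem k) ∧
      (∀ i, σ'.mem 11 i = σ.mem 11 i + σ.var 16 * (l.map fun L => V.marks L i).sum) ∧
      (∀ r, r ∉ 17 :: stringP.vars → σ'.var r = σ.var r) ∧
      σ'.time ≤ σ.time + famTime l + 5) (by simp) (by simpa using hr) (by omega) ?_ ?_ ?_
  · refine ⟨by simpa using h14, ?_, fun _ _ => rfl, by simp, fun _ _ => rfl,
      by simp [famTime]⟩
    rw [List.append_nil]
    exact ⟨hD.v15, hD.strs, hD.zero⟩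
  · rintro l₁ L l₂ rfl σ₁ ⟨i1, i2, i3, i4, i5, i6⟩
    rw [List.flatMap_append, List.flatMap_cons, seg_append, seg_append] at hraw
    rw [List.flatMap_append, List.flatMap_cons, List.length_append, List.length_append] at hpX
    rw [List.length_append, List.length_cons] at hlen
    push_cast at hpX hlen
    have h17 : ∀ r, r ∉ 17 :: stringP.vars → r ≠ 17 := by rintro r hr rfl; exact hr (by simp)
    refine Sm.wp_mono _ ?_ (Sm.wp_frame _ (V.stringP_wp (L := L)
      (p := p + (l₁.flatMap encodeStr).length) (g := (D ++ l₁).length) (hg.frame ?_) ?_ ?_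
      (by omega) (by omega) ?_ (by omega) ?_ (hL L (by simp)) ?_))
    · rintro σ₂ ⟨⟨q1, q2, q3, q4, q5, q6, q7⟩, hf⟩
      simp only [St.setv_mem] at q6
      refine ⟨?_, ⟨?_, ?_, ?_⟩, ?_, ?_, ?_, ?_⟩
      · rw [St.tick_var, q1]; simp; ring
      · rw [St.tick_var, q2]; simp; ring
      · rw [← List.append_assoc]
        exact i2.strs.snoc q5.1 q3 ⟨q4.1, q4.2, q4.3⟩
      · intro k hk1 hk2 g hg'
        rw [← List.append_assoc, List.length_append, List.length_singleton] at hg'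
        push_cast at hg'
        rw [St.tick_mem, q5.1 k hk1 hk2 g (by omega)]
        exact i2.zero k hk1 hk2 g (by omega)
      · intro k hk
        rw [St.tick_mem, q5.2 k hk]
        exact i3 k hk
      · intro i
        rw [St.tick_mem, q6, i4, List.map_append, List.sum_append, List.map_singleton,
          List.sum_singleton, St.setv_var, if_neg (by norm_num), i5 16 (by decide)]
        ring
      · intro r hr
        rw [St.tick_var, hf.1 r (fun h => hr (by simp [h])), St.setv_var, if_neg (h17 r hr),
          i5 r hr]
      · unfold famTime at i6 ⊢
        rw [List.map_append, List.sum_append, List.map_singleton, List.sum_singleton]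
        simp only [St.tick_time, St.setv_time] at q7 ⊢
        omega
    · intro r hr
      rw [St.setv_var, if_neg (h17 r (hmv r hr)), i5 r (hmv r hr)]
    · simp [St.setv_var, i1]
    · rw [St.setv_mem, i3 0 (by norm_num)]
      exact hraw.2.1
    · rw [St.setv_var, if_neg (by norm_num), i2.v15]
    · rw [List.length_append]; push_cast; omega
    · intro k hk1 hk2
      exact i2.zero k hk1 hk2 _ le_rfl
  · rintro σ₁ ⟨i1, i2, i3, i4, i5, i6⟩
    exact ⟨i1, ⟨i2.1, i2.2, i2.3⟩, i3, i4, i5, by simp only [St.tick_time]; omega⟩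

/-- The state after reading the input. -/
structure Parsed (Vs Ss : List StoredStr) (Qs : List Pt) (σ σ' : St) : Prop where
  v12 : σ'.var 12 = Vs.length
  v13 : σ'.var 13 = Ss.length
  v30 : σ'.var 30 = Qs.length
  v14 : 0 ≤ σ'.var 14 ∧ σ'.var 14 + 2 * Qs.length < V.X
  raw : Seg (σ'.mem 0) (σ'.var 14) (Qs.flatMap fun q => [q.1, q.2])
  strs : V.Strs (Vs ++ Ss) σ'.mem
  mark : ∀ i, σ'.mem 11 i = (Ss.map fun L => V.marks L i).sum
  mem : ∀ k, 12 ≤ k → σ'.mem k = σ.mem k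
  var : ∀ r, r ∉ parseP.vars → σ'.var r = σ.var r

lemma parseP_wp {Vs Ss : List StoredStr} {Qs : List Pt} {σ : St} (hg : V.Glob σ)
    (hi : V.Inp Vs Ss) (hraw : Seg (σ.mem 0) 0 (encodeInput V.m V.n V.φ V.ψ Vs Ss Qs))
    (hX : ((encodeInput V.m V.n V.φ V.ψ Vs Ss Qs).length : ℤ) < V.X)
    (hz : ∀ k, 1 ≤ k → k ≤ 11 → σ.mem k = 0) :
    parseP.wp V.Λ (fun σ' => V.Parsed Vs Ss Qs σ σ' ∧
      σ'.time ≤ σ.time + famTime Vs + famTime Ss + 100) σ := by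
  have hnum := hi.num
  rw [List.length_append] at hnum
  push_cast at hnum
  have hql : ((Qs.flatMap fun q => [q.1, q.2]).length : ℤ) = 2 * Qs.length := by
    rw [List.length_flatMap]; simp; ring
  unfold encodeInput encodeFamily encodePoints at hraw hX
  rw [seg_append, seg_append, seg_append] at hraw
  obtain ⟨⟨⟨-, s1, s2⟩, s3, s4⟩, s5, s6⟩ := hraw
  simp only [List.length_append, List.length_cons, List.length_nil] at hX s1 s2 s3 s4 s5 s6
  simp only [Nat.cast_add, Nat.cast_one, zero_add] at hX s1 s2 s3 s4 s5 s6
  norm_num only at hX s1 s2 s3 s4 s5 s6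
  rw [hql] at hX
  set lv : ℤ := ((Vs.flatMap encodeStr).length : ℤ) with hlv
  set ls : ℤ := ((Ss.flatMap encodeStr).length : ℤ) with hls
  have hlv0 : 0 ≤ lv := by omega
  have hls0 : 0 ≤ ls := by omega
  have a1 : ∀ τ : St, V.Λ.Acc τ 0 6 := fun τ => V.acc0 (by omega) (by omega)
  unfold parseP
  simp only [wp_blk_cons, wp_asg, sf_ld, ev_ld, sf_lit, ev_lit, sf_zero, ev_zero, St.setv_mem,
    s1, a1, true_and]
  refine Sm.wp_mono _ ?_ (V.familyP_wp (p := 7) (D := []) (Ls := Vs) (hg.frame ?_) ?_ ?_ s2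
    (by norm_num) (by omega) ⟨?_, ?_, ?_⟩ (by simp; omega) fun L hL => hi.pts L (by simp [hL]))
  · rintro σ₁ ⟨p1, p2, p3, p4, p5, p6⟩
    rw [← hlv] at p1
    rw [List.nil_append] at p2
    simp only [St.setv_mem] at p3 p4
    have p30 := p3 0 (by norm_num)
    rw [show (6 : ℤ) + (lv + 1) = 7 + lv by ring, ← p30] at s3
    rw [show (6 : ℤ) + (lv + 1) + 1 = 8 + lv by ring, ← p30] at s4
    have a2 : ∀ τ : St, V.Λ.Acc τ 0 (7 + lv) := fun τ => V.acc0 (by omega) (by omega)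
    simp only [wp_blk_cons, wp_asg, sf_ld, ev_ld, sf_v, ev_v, sf_add, ev_add, sf_one, ev_one, St.setv_var,
      Nat.reduceEqDiff, if_false, p1, a2, true_and, s3]
    have hv1 : ∀ r, r ∉ parseP.vars → σ₁.var r = σ.var r := by
      intro r hr
      have e : ∀ r ∈ 17 :: stringP.vars, r ∈ parseP.vars := by decide
      have e1 : r ≠ 14 ∧ r ≠ 12 ∧ r ≠ 15 ∧ r ≠ 16 := by
        refine ⟨?_, ?_, ?_, ?_⟩ <;> (rintro rfl; exact hr (by decide))
      rw [p5 r fun h => hr (e r h)]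
      simp [St.setv_var, e1]
    have hmv : ∀ r ∈ [1, 2, 3, 4, 5, 6, 7, 9, 10, 11, 28, 29], r ∉ parseP.vars := by decide
    have hs : ∀ (r : ℕ) (z₁ z₂ z₃ : ℤ) (c₁ c₂ c₃ : ℕ), r ∉ parseP.vars →
        (((σ₁.setv 13 z₁ c₁).setv 14 z₂ c₂).setv 16 z₃ c₃).var r = σ.var r := by
      intro r z₁ z₂ z₃ c₁ c₂ c₃ hr
      have e1 : r ≠ 14 ∧ r ≠ 13 ∧ r ≠ 16 := by
        refine ⟨?_, ?_, ?_⟩ <;> (rintro rfl; exact hr (by decide))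
      rw [← hv1 r hr]
      simp [St.setv_var, e1]
    refine Sm.wp_mono _ ?_ (V.familyP_wp (p := 8 + lv) (D := Vs) (Ls := Ss)
      (hg.frame fun r hr => hs r _ _ _ _ _ _ (hmv r hr)) ?_ ?_ s4
      (by omega) (by omega) ⟨?_, p2.2, p2.3⟩ (by omega) fun L hL => hi.pts L (by simp [hL]))
    · rintro σ₂ ⟨q1, q2, q3, q4, q5, q6⟩
      rw [← hls] at q1
      simp only [St.setv_mem] at q3 q4
      have q30 := q3 0 (by norm_num)
      rw [show (6 : ℤ) + (lv + 1) + (ls + 1) = 8 + lv + ls by ring, ← p30, ← q30] at s5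
      rw [show (6 : ℤ) + (lv + 1) + (ls + 1) + 1 = 8 + lv + ls + 1 by ring, ← p30, ← q30] at s6
      have a3 : ∀ τ : St, V.Λ.Acc τ 0 (8 + lv + ls) := fun τ => V.acc0 (by omega) (by omega)
      simp only [wp_blk_cons, wp_asg, sf_ld, ev_ld, sf_v, ev_v, sf_add, ev_add, sf_one, ev_one,
        St.setv_var, Nat.reduceEqDiff, if_false, q1, a3, true_and, s5, wp_blk_nil]
      refine ⟨⟨?_, ?_, ?_, ?_, ?_, ?_, ?_, ?_, ?_⟩, ?_⟩
      · simp only [St.tick_var, St.setv_var, Nat.reduceEqDiff, if_false]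
        rw [q5 12 (by decide)]
        simp only [St.setv_var, Nat.reduceEqDiff, if_false]
        rw [p5 12 (by decide)]
        simp [St.setv_var]
      · simp only [St.tick_var, St.setv_var, Nat.reduceEqDiff, if_false]
        rw [q5 13 (by decide)]
        simp [St.setv_var]
      · simp [St.setv_var]
      · simp [St.setv_var]; omega
      · simp only [St.tick_var, St.tick_mem, St.setv_mem, St.setv_var, if_true]
        exact s6
      · exact q2.2
      -- Array 11 received weight 0 from the first family and weight 1 from the second.
      · intro i
        rw [St.tick_mem, St.setv_mem, St.setv_mem, q4, p4, hz 11 (by norm_num) (by norm_num)]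
        simp [St.setv_var]
      · intro k hk
        rw [St.tick_mem, St.setv_mem, St.setv_mem, q3 k (by omega), p3 k (by omega)]
      · intro r hr
        have e : ∀ r ∈ 17 :: stringP.vars, r ∈ parseP.vars := by decide
        have e1 : r ≠ 14 ∧ r ≠ 30 := by
          refine ⟨?_, ?_⟩ <;> (rintro rfl; exact hr (by decide))
        rw [St.tick_var, St.setv_var, if_neg e1.1, St.setv_var, if_neg e1.2,
          q5 r fun h => hr (e r h), hs r _ _ _ _ _ _ hr]
      · simp only [St.tick_time, St.setv_time, cost_ld, cost_v, cost_add, cost_one, cost_lit,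
          cost_zero] at p6 q6 ⊢
        omega
    · simp [St.setv_var]
    · simp [St.setv_var]; ring
    · simp only [St.setv_var, Nat.reduceEqDiff, if_false]; exact p2.v15
  · intro r hr
    have e1 : r ≠ 14 ∧ r ≠ 12 ∧ r ≠ 15 ∧ r ≠ 16 := by
      refine ⟨?_, ?_, ?_, ?_⟩ <;> (rintro rfl; revert hr; decide)
    simp [St.setv_var, e1]
  · simp [St.setv_var]
  · simp [St.setv_var]
  · simp [St.setv_var]
  · constructor <;> simp
  · intro k hk1 hk2 g _
    rw [St.setv_mem, St.setv_mem, St.setv_mem, St.setv_mem, hz k hk1 (by omega)]; rfl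

end Env

/-! ## A block of addresses that is free of characters -/

/-- The number (modulo the number of blocks considered) of the block with the character. -/
def block (w : ℕ) (M : ℤ) (N : ℕ) (L : StoredStr) : ℤ :=
  (listChr L + M) % 2 ^ w / (2 * M) % (N + 1)

/-- The start of the last one among the first blocks that contains no character. -/
def freeOffset (w : ℕ) (M : ℤ) (all : List StoredStr) : ℕ → ℤ
  | 0 => 0
  | i + 1 => if ∃ L ∈ all, block w M all.length L = i then freeOffset w M all i else i * (2 * M)

/-- Pigeonhole: the strings take at most `all.length` of the `all.length + 1` block numbers. -/
lemma freeOffset_spec {w : ℕ} {M : ℤ} {all : List StoredStr} :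
    ∃ r : ℕ, r ≤ all.length ∧ (∀ L ∈ all, block w M all.length L ≠ r) ∧
      freeOffset w M all (all.length + 1) = r * (2 * M) := by
  have h1 : ∃ r : ℕ, r < all.length + 1 ∧ ∀ L ∈ all, block w M all.length L ≠ r := by
    by_contra! h
    have hsub : (Finset.range (all.length + 1)).image (fun r : ℕ => (r : ℤ)) ⊆
        (all.map (block w M all.length)).toFinset := by
      intro z hz
      simp only [Finset.mem_image, Finset.mem_range] at hz
      obtain ⟨r, hr, rfl⟩ := hz
      obtain ⟨L, hL, e⟩ := h r hr
      simp only [List.mem_toFinset, List.mem_map]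
      exact ⟨L, hL, e⟩
    have h2 := (Finset.card_le_card hsub).trans (List.toFinset_card_le _)
    rw [Finset.card_image_of_injective _ Nat.cast_injective] at h2
    simp at h2
  have key : ∀ n : ℕ, (∃ r : ℕ, r < n ∧ ∀ L ∈ all, block w M all.length L ≠ r) →
      ∃ r : ℕ, r < n ∧ (∀ L ∈ all, block w M all.length L ≠ r) ∧
        freeOffset w M all n = r * (2 * M) := by
    intro n
    induction n with
    | zero => rintro ⟨r, hr, _⟩; omega
    | succ n ih =>
      rintro ⟨r, hr, h⟩
      unfold freeOffset
      split_ifs with hu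
      · obtain ⟨L, hL, e⟩ := hu
        have : r ≠ n := by rintro rfl; exact h L hL e
        obtain ⟨r', h1, h2, h3⟩ := ih ⟨r, by omega, h⟩
        exact ⟨r', by omega, h2, h3⟩
      · push Not at hu
        exact ⟨n, by omega, hu, rfl⟩
  obtain ⟨r, h2, h3, h4⟩ := key _ h1
  exact ⟨r, by omega, h3, h4⟩

namespace Env
variable (V : Env)

lemma flagP_wp {Vs Ss : List StoredStr} (hi : V.Inp Vs Ss) {σ : St} (hg : V.Glob σ)
    (h0 : σ.var 0 = 0) (h12 : σ.var 12 = Vs.length) (h13 : σ.var 13 = Ss.length)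
    (hs : V.Strs (Vs ++ Ss) σ.mem) (hz : σ.mem 12 = 0) :
    flagP.wp V.Λ (fun σ' =>
      σ'.var 0 = freeOffset V.Λ.w (V.X ^ 11) (Vs ++ Ss) ((Vs ++ Ss).length + 1) ∧
      σ'.time ≤ σ.time + 200 * (Vs ++ Ss).length + 300) σ := by
  have hX := V.X_lt_half'
  have hXg := V.X_ge
  have hXh := V.X_half
  have hnum := hi.num
  set all := Vs ++ Ss with hall
  have hN : (Vs.length : ℤ) + Ss.length = all.length := by simp [hall]
  have hM : 2 * V.X ^ 11 < V.Λ.half := by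
    have : V.X ^ 13 = V.X ^ 11 * (V.X * V.X) := by ring
    have h1 : 0 < V.X ^ 11 := by positivity
    have h2 : 3 ≤ V.X * V.X := by nlinarith
    nlinarith
  have hM0 : 0 < V.X ^ 11 := by positivity
  set M := V.X ^ 11 with hMd
  unfold flagP
  rw [wp_blk_cons, wp_asg, wp_blk_cons, wp_asg, wp_blk_cons, wp_asg, wp_blk_cons, wp_asg,
    wp_blk_cons]
  simp only [sf_add, sf_mul, sf_v, sf_one, ev_add, ev_mul, ev_v, ev_one, St.setv_var,
    Nat.reduceEqDiff, if_true, if_false, true_and, h12, h13, hg.v11, hN]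
  rw [show V.X * V.X * (V.X * V.X) * (V.X * V.X * (V.X * V.X)) * V.X * V.X * V.X = M by
    rw [hMd]; ring]
  refine Sm.wp_rep (fun i σ' => σ'.var 0 = 0 ∧ σ'.var 31 = all.length + 1 ∧ σ'.var 32 = M ∧
    (∀ k, k ≠ 12 → σ'.mem k = σ.mem k) ∧
    (∀ j : ℕ, σ'.mem 12 j = if ∃ L ∈ all.take i, block V.Λ.w M all.length L = j then 1 else 0) ∧
    σ'.time ≤ σ.time + 100 * i + 100) all.length (by simp) (by simp [St.setv_var, h12, h13, hN])
    (by omega) ?_ ?_ ?_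
  · refine ⟨by simp [St.setv_var, h0], by simp [St.setv_var], by simp [St.setv_var],
      fun _ _ => rfl, by simp [hz], ?_⟩
    simp
  · rintro i hin σ₁ ⟨i1, i2, i3, i4, i5, i6⟩
    have hget : all[i]? = some all[i] := List.getElem?_eq_getElem hin
    have e2 := (hs.congr (mem' := σ₁.mem) fun k _ hk => i4 k (by omega)).chr i _ hget
    have a2 : ∀ τ : St, V.Λ.Acc τ 2 i :=
      fun τ => V.acc' (by norm_num) (by norm_num) (by omega) (by omega)
    set c := listChr all[i] with hc
    have hb0 : 0 ≤ (c + M) % 2 ^ V.Λ.w / (2 * M) ∧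
        (c + M) % 2 ^ V.Λ.w / (2 * M) < V.Λ.half := by
      have p : (0 : ℤ) < 2 ^ V.Λ.w := by positivity
      have m1 := Int.emod_nonneg (c + M) p.ne'
      have m2 := Int.emod_lt_of_pos (c + M) p
      refine ⟨Int.ediv_nonneg m1 (by omega), Int.ediv_lt_of_lt_mul (by omega) ?_⟩
      have h2 := V.Λ.two_half
      have h3 := V.Λ.half_pos
      nlinarith
    have hb : 0 ≤ block V.Λ.w M all.length all[i] ∧
        block V.Λ.w M all.length all[i] < all.length + 1 :=
      ⟨Int.emod_nonneg _ (by omega), Int.emod_lt_of_pos _ (by omega)⟩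
    have a12 : ∀ τ : St, V.Λ.Acc τ 12 (block V.Λ.w M all.length all[i]) :=
      fun τ => V.acc' (by norm_num) (by norm_num) hb.1 (by omega)
    have hbe : (c + M) % 2 ^ V.Λ.w / (2 * M) % (all.length + 1) =
      block V.Λ.w M all.length all[i] := rfl
    simp only [wp_st, sf_mod, sf_hi, sf_add, sf_ld, sf_v, sf_mul, sf_lit, ev_add, ev_v, ev_ld,
      ev_mod, ev_hi, ev_mul, ev_lit, sf_one, ev_one, St.setv_var, St.setv_mem, if_true, if_false,
      Nat.reduceEqDiff, i2, i3, e2, a2, hbe, a12, true_and, and_true]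
    refine ⟨⟨⟨by omega, hM⟩, hb0.1, hb0.2, by omega, by omega⟩, ?_⟩
    refine ⟨?_, ?_, ?_, ?_, ?_, ?_⟩
    · simp [St.setv_var, i1]
    · simp [St.setv_var, i2]
    · simp [St.setv_var, i3]
    · intro k hk
      rw [St.tick_mem, St.setm_mem, if_neg hk]
      exact i4 k hk
    · intro j
      rw [St.tick_mem, St.setm_mem, if_pos rfl, Function.update_apply, St.setv_mem, i5 j,
        List.take_succ_eq_append_getElem hin]
      simp only [List.mem_append, List.mem_singleton, or_and_right, exists_or, exists_eq_left]
      by_cases h1 : (j : ℤ) = block V.Λ.w M all.length all[i]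
      · rw [if_pos h1, if_pos (Or.inr h1.symm)]
      · rw [if_neg h1]
        have : ¬ block V.Λ.w M all.length all[i] = j := fun h => h1 h.symm
        simp only [this, or_false]
    · simp; omega
  · rintro σ₁ ⟨i1, i2, i3, i4, i5, i6⟩
    rw [List.take_length] at i5
    rw [wp_blk_cons]
    refine Sm.wp_rep (fun i σ' => σ'.var 0 = freeOffset V.Λ.w M all i ∧ σ'.var 32 = M ∧
      σ'.mem 12 = σ₁.mem 12 ∧ σ'.time ≤ σ.time + 100 * all.length + 110 + 50 * i)
      (all.length + 1) (by simp) (by simp [i2]) (by push_cast; omega) ?_ ?_ ?_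
    · exact ⟨by simp [i1, freeOffset], by simp [i3], rfl, by simp; omega⟩
    · rintro i hin σ₂ ⟨j1, j2, j3, j4⟩
      have a12 : ∀ τ : St, V.Λ.Acc τ 12 i :=
        fun τ => V.acc' (by norm_num) (by norm_num) (by omega) (by omega)
      simp only [wp_asg, sf_add, sf_mul, sf_sub, sf_one, sf_v, sf_ld, sf_lit, ev_add, ev_mul,
        ev_sub, ev_one, ev_v, ev_ld, ev_lit, St.setv_var, St.setv_mem, if_true, if_false,
        Nat.reduceEqDiff, a12, true_and, and_self, j1, j2, j3, i5, OfNat.zero_ne_ofNat]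
      refine ⟨?_, ?_, j3, ?_⟩
      · rw [St.tick_var, St.setv_var, if_pos rfl, freeOffset]
        split_ifs <;> ring
      · simp [St.setv_var, j2]
      · simp; omega
    · rintro σ₂ ⟨j1, j2, j3, j4⟩
      rw [wp_blk_nil]
      refine ⟨j1, ?_⟩
      simp only [St.tick_time]
      omega

end Env

/-! ### Verification of the table lookups. -/

namespace Env
variable (V : Env)

lemma lookStep_wp {σ : St} (hg : V.Glob σ) {k : ℕ} {f : ℤ} (hk : k < 4) (h : σ.var (22 + k) = f)
    (hf : |f| ≤ V.O) (ht : 0 ≤ σ.var 34 ∧ σ.var 34 < V.Λ.half) :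
    (lookStep k).wp V.Λ (fun σ' => σ'.var 34 = σ.var 34 / V.L ∧
      σ'.var 57 = (σ.var 57 * V.X + σ.var 34 % V.L) * V.X +
        ((f + V.O) / 2 ^ (σ.var 34 % V.L).toNat + 1) ∧
      σ'.time ≤ σ.time + 60) σ := by
  have hX := V.X_lt_half'
  have hL := V.L_pos
  have hL2 := V.L_lt
  have hE4 := V.E4_le; have hB := V.B_le; have hO := V.O_le; have hO' := V.O_le'
  have hX' := V.X_le
  have hE2 := V.E2_ge; have hE3 := V.E3_le
  have m0 := Int.emod_nonneg (σ.var 34) (b := (V.L : ℤ)) (by omega)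
  have m1 := Int.emod_lt_of_pos (σ.var 34) (b := (V.L : ℤ)) (by omega)
  have n1 : 22 + k ≠ 59 ∧ 22 + k ≠ 34 := by omega
  rw [abs_le] at hf
  simp [lookStep, St.setv_var, hg.v9, hg.v10, hg.v11, n1, h]
  omega

lemma lookSteps_wp (f : ℕ → ℤ) (hf : ∀ k < 4, |f k| ≤ V.O) : ∀ (ks : List ℕ) (σ : St), V.Glob σ →
    (∀ k ∈ ks, k < 4) → (∀ k < 4, σ.var (22 + k) = f k) →
    0 ≤ σ.var 34 ∧ σ.var 34 < V.Λ.half →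
    (blk (ks.map lookStep)).wp V.Λ (fun σ' =>
      σ'.var 57 = quKey V.L V.X (ks.map fun k => f k + V.O) (σ.var 34) (σ.var 57) ∧
      σ'.time ≤ σ.time + 60 * ks.length + 1) σ := by
  intro ks
  induction ks with
  | nil => intro σ _ _ _ _; simp [quKey]
  | cons k r ih =>
    intro σ hg hk h ht
    have hk4 := hk k (by simp)
    rw [List.map_cons, wp_blk_cons]
    refine Sm.wp_mono _ ?_ (Sm.wp_frame _ (V.lookStep_wp hg hk4 (h k hk4) (hf k hk4) ht))
    rintro σ₁ ⟨⟨p1, p2, p3⟩, hfr⟩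
    have hv : ∀ r, r ∉ [59, 34, 57] → σ₁.var r = σ.var r := hfr.1
    refine Sm.wp_mono _ ?_ (ih σ₁ (hg.frame fun r hr => hv r (by fin_cases hr <;> decide))
      (fun k hk' => hk k (by simp [hk'])) ?_ ?_)
    · rintro σ₂ ⟨q1, q2⟩
      refine ⟨?_, ?_⟩
      · rw [q1, p1, p2]; simp [quKey]
      · rw [List.length_cons]; omega
    · intro k hk
      rw [hv (22 + k) (by simp; omega)]
      exact h k hk
    · rw [p1]
      have := V.L_pos
      exact ⟨Int.ediv_nonneg ht.1 (by omega), (Int.ediv_le_self _ ht.1).trans_lt ht.2⟩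

lemma L4_lt : ((V.L ^ 4 : ℕ) : ℤ) < V.Λ.half := by
  have h := V.pairCount_lt
  unfold pairCount at h
  push_cast at h ⊢
  have : (0 : ℤ) ≤ (V.L : ℤ) ^ 4 := by positivity
  have e : (2 * (V.L : ℤ)) ^ 4 = 16 * (V.L : ℤ) ^ 4 := by ring
  omega

lemma lookupLoop_wp {σ : St} (hg : V.Glob σ) {q : Pt} (h1 : |q.1| ≤ V.n) (h2 : |q.2| ≤ V.n)
    (hf : ∀ k < 4, σ.var (22 + k) = fn V.φ V.ψ k q) (h26 : σ.var 26 = 0)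
    (h27 : σ.var 27 = quBase V.φ V.ψ V.O V.X (cross V.φ q) (cross V.ψ q)) :
    (Sm.rep 33 (.v 9 * .v 9 * .v 9 * .v 9) lookupP).wp V.Λ (fun σ' =>
      σ'.var 26 = ∑ t ∈ Finset.range (V.L ^ 4),
        σ.mem 15 (pointKey V.φ V.ψ V.O V.L V.X (cross V.φ q) (cross V.ψ q) t) ∧
      σ'.time ≤ σ.time + 305 * V.L ^ 4 + 20) σ := by
  have hXg := V.X_ge
  have hO := V.E3_le_O
  have hE : 0 < V.E ^ 3 := by have := V.E_ge; positivity
  have hX' := V.X_le; have hO' := V.O_le'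
  have hd := V.d_pos
  have hd2 := V.d_lt
  have hE4 := V.E4_le; have hB := V.B_le; have hO2 := V.O_le
  have hE2 := V.E2_ge; have hE3 := V.E3_le
  have hLX := V.L_lt
  have hfb : ∀ k < 4, |fn V.φ V.ψ k q| ≤ V.O := fun k hk =>
    (V.fn_bound h1 h2 hk).trans (by omega)
  have hvars : ∀ r ∈ [1, 2, 3, 4, 5, 6, 7, 9, 10, 11, 28, 29], r ∉ 33 :: lookupP.vars := by decide
  refine Sm.wp_rep (fun t σ' => (∀ r, r ∉ 33 :: lookupP.vars → σ'.var r = σ.var r) ∧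
    σ'.mem = σ.mem ∧ σ'.var 26 = ∑ t ∈ Finset.range t,
        σ.mem 15 (pointKey V.φ V.ψ V.O V.L V.X (cross V.φ q) (cross V.ψ q) t) ∧
    σ'.time ≤ σ.time + 305 * t + 15) (V.L ^ 4) (by simp) ?_ V.L4_lt ?_ ?_ ?_
  · simp only [ev_mul, ev_v, hg.v9]; push_cast; ring
  · exact ⟨fun _ _ => rfl, rfl, by simpa using h26, by simp⟩
  · rintro t ht σ₁ ⟨i1, i2, i3, i4⟩
    have ht' : (t : ℤ) < (V.L : ℤ) ^ 4 := by exact_mod_cast ht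
    have htH := V.L4_lt
    push_cast at htH
    unfold lookupP
    rw [wp_blk_cons, wp_asg, wp_blk_cons, wp_asg, wp_blk_cons]
    simp only [sf_v, ev_v, St.setv_var, if_true, if_false, Nat.reduceEqDiff, true_and,
      i1 27 (by decide), h27]
    have hv : ∀ (r : ℕ) (z₁ z₂ z₃ : ℤ) (c₁ c₂ c₃ : ℕ), r ∉ 33 :: lookupP.vars →
        (((σ₁.setv 33 z₁ c₁).setv 34 z₂ c₂).setv 57 z₃ c₃).var r = σ.var r := by
      intro r z₁ z₂ z₃ c₁ c₂ c₃ hr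
      have e1 : r ≠ 33 ∧ r ≠ 34 ∧ r ≠ 57 := by
        refine ⟨?_, ?_, ?_⟩ <;> (rintro rfl; exact hr (by decide))
      rw [← i1 r hr]
      simp [St.setv_var, e1]
    refine Sm.wp_mono _ ?_ (Sm.wp_frame _ (V.lookSteps_wp (fun k => fn V.φ V.ψ k q) hfb dims _
      (hg.frame fun r hr => hv r _ _ _ _ _ _ (hvars r hr)) (by simp [dims]) ?_ ?_))
    · rintro σ₂ ⟨⟨q1, q2⟩, hfr⟩
      have hm : σ₂.mem = σ.mem := by
        rw [← i2]
        funext k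
        exact hfr.2 k (by simp [dims, lookStep, blk, Sm.arrs])
      have e57 : σ₂.var 57 =
          pointKey V.φ V.ψ V.O V.L V.X (cross V.φ q) (cross V.ψ q) t := by
        rw [q1]
        simp only [St.setv_var, if_true, if_false, Nat.reduceEqDiff]
        rfl
      have hbase : 0 ≤ quBase V.φ V.ψ V.O V.X (cross V.φ q) (cross V.ψ q) ∧
          quBase V.φ V.ψ V.O V.X (cross V.φ q) (cross V.ψ q) < V.X * V.X := by
        have m1 := Int.emod_nonneg (cross V.φ q + V.O) hd.ne'
        have m2 := Int.emod_lt_of_pos (cross V.φ q + V.O) hd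
        have m3 := Int.emod_nonneg (cross V.ψ q + V.O) hd.ne'
        have m4 := Int.emod_lt_of_pos (cross V.ψ q + V.O) hd
        unfold quBase
        simp only [Env.d] at m1 m2 m3 m4 hd hd2
        constructor
        · positivity
        · have : (cross V.φ q + V.O) % cross V.φ V.ψ + 1 ≤ V.X := by omega
          have := mul_le_mul_of_nonneg_right this (show 0 ≤ V.X by omega)
          rw [add_mul] at this
          omega
      have hk := quKey_bound (L := V.L) (X := V.X) (by omega)
        (dims.map fun k => fn V.φ V.ψ k q + V.O) t
        (quBase V.φ V.ψ V.O V.X (cross V.φ q) (cross V.ψ q)) (V.X * V.X) (by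
          intro D hD
          obtain ⟨k, hk, rfl⟩ := List.mem_map.1 hD
          have := abs_le.1 (hfb k (by simp [dims] at hk; omega))
          omega) (by omega) (by simpa [dims] using ht') hbase.1 hbase.2
      have hacc : ∀ τ : St, V.Λ.Acc τ 15
          (pointKey V.φ V.ψ V.O V.L V.X (cross V.φ q) (cross V.ψ q) t) := by
        intro τ
        refine V.acc (by norm_num) (by norm_num) hk.1 (hk.2.trans_eq ?_)
        rw [List.length_map, show dims.length = 4 from rfl]; ring
      have e26 : σ₂.var 26 = σ₁.var 26 := by
        rw [hfr.1 26 (by decide)]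
        simp [St.setv_var]
      rw [wp_blk_cons, wp_asg, wp_blk_nil]
      simp only [sf_add, sf_v, sf_ld, ev_add, ev_v, ev_ld, e57, e26, hacc, true_and]
      refine ⟨?_, ?_, ?_, ?_⟩
      · intro r hr
        have e1 : r ≠ 26 := by rintro rfl; exact hr (by decide)
        rw [St.tick_var, St.tick_var, St.setv_var, if_neg e1,
          hfr.1 r (fun h => hr (by
            have : ∀ r ∈ (blk (dims.map lookStep)).vars, r ∈ 33 :: lookupP.vars := by decide
            exact this r h)), hv r _ _ _ _ _ _ hr]
      · exact hm
      · rw [St.tick_var, St.tick_var, St.setv_var, if_pos rfl, i3, hm, Finset.sum_range_succ]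
      · rw [show dims.length = 4 from rfl] at q2
        simp only [St.tick_time, St.setv_time, cost_v, cost_add, cost_ld] at q2 ⊢
        omega
    · intro k hk
      have := i1 (22 + k) (by interval_cases k <;> decide)
      rw [hf k hk] at this
      rw [← this]
      have e1 : 22 + k ≠ 33 ∧ 22 + k ≠ 34 ∧ 22 + k ≠ 57 := by omega
      simp [St.setv_var, e1]
    · simp [St.setv_var]; omega
  · rintro σ₁ ⟨i1, i2, i3, i4⟩
    exact ⟨i3, by simp only [St.tick_time]; omega⟩

/-! ## Filling the arrays indexed by points -/

/-- The point that is treated as number `i`. -/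
def pt (i : ℕ) : Pt := ((i : ℤ) / (2 * V.n) - V.n, V.n - 1 - (i : ℤ) % (2 * V.n))

def InRange (q : Pt) : Prop := (-(V.n : ℤ) ≤ q.1 ∧ q.1 < V.n) ∧ -(V.n : ℤ) ≤ q.2 ∧ q.2 < V.n

instance (q : Pt) : Decidable (V.InRange q) := by unfold InRange; infer_instance

lemma pt_inRange {i : ℕ} (hi : i < 2 * V.n * (2 * V.n)) : V.InRange (V.pt i) := by
  have hn : 0 < 2 * (V.n : ℤ) := by have := V.n_two; omega
  have m1 := Int.emod_nonneg (i : ℤ) hn.ne'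
  have m2 := Int.emod_lt_of_pos (i : ℤ) hn
  have d1 : 0 ≤ (i : ℤ) / (2 * V.n) := by positivity
  have d2 : (i : ℤ) / (2 * V.n) < 2 * V.n :=
    Int.ediv_lt_of_lt_mul hn (by exact_mod_cast hi)
  unfold InRange pt
  simp only
  omega

lemma exists_pt {q : Pt} (hq : V.InRange q) : ∃ j : ℕ, j < 2 * V.n * (2 * V.n) ∧ V.pt j = q ∧
    (j : ℤ) = (q.1 + V.n) * (2 * V.n) + (V.n - 1 - q.2) := by
  obtain ⟨⟨h1, h2⟩, h3, h4⟩ := hq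
  have hn : 0 < 2 * (V.n : ℤ) := by have := V.n_two; omega
  have h0 : 0 ≤ (q.1 + V.n) * (2 * V.n) + (V.n - 1 - q.2) := by
    have := mul_nonneg (show 0 ≤ q.1 + (V.n : ℤ) by omega) hn.le
    omega
  obtain ⟨j, hj⟩ := Int.eq_ofNat_of_zero_le h0
  refine ⟨j, ?_, ?_, hj.symm⟩
  · zify
    rw [← hj]
    have := mul_le_mul_of_nonneg_right (show q.1 + (V.n : ℤ) ≤ 2 * V.n - 1 by omega) hn.le
    rw [sub_mul] at this
    omega
  · unfold pt
    rw [← hj]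
    have e1 : ((q.1 + V.n) * (2 * V.n) + (V.n - 1 - q.2)) / (2 * (V.n : ℤ)) = q.1 + V.n := by
      rw [add_comm, Int.add_mul_ediv_right _ _ hn.ne', Int.ediv_eq_zero_of_lt (by omega) (by omega)]
      ring
    have e2 : ((q.1 + V.n) * (2 * V.n) + (V.n - 1 - q.2)) % (2 * (V.n : ℤ)) = V.n - 1 - q.2 := by
      rw [add_comm, Int.add_mul_emod_self_right, Int.emod_eq_of_lt (by omega) (by omega)]
    rw [e1, e2]
    ext <;> simp

open Classical in
/-- The array holds the values of `A` at the first `i` points, and `0` elsewhere. -/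
def Filled (A : Pt → ℤ) (i : ℕ) (arr : ℤ → ℤ) : Prop :=
  ∀ q : Pt, |q.1| ≤ V.E ^ 2 → |q.2| < V.E ^ 2 →
    arr (V.pidx q) = if ∃ j < i, V.pt j = q then A q else 0

variable {V}

lemma Filled.zero {A : Pt → ℤ} {arr : ℤ → ℤ} (h : arr = 0) : V.Filled A 0 arr := by
  intro q _ _
  simp [h]

lemma InRange.bound {q : Pt} (h : V.InRange q) : |q.1| ≤ V.E ^ 2 ∧ |q.2| < V.E ^ 2 := by
  have := V.n_le_E2
  have := V.n_two
  obtain ⟨h1, h2⟩ := h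
  rw [abs_le, abs_lt]
  omega

lemma Filled.step {A : Pt → ℤ} {i : ℕ} {arr : ℤ → ℤ} (h : V.Filled A i arr)
    (hi : i < 2 * V.n * (2 * V.n)) :
    V.Filled A (i + 1) (Function.update arr (V.pidx (V.pt i)) (A (V.pt i))) := by
  intro q h1 h2
  have hb := (V.pt_inRange hi).bound
  simp only [Function.update_apply, V.pidx_inj h2 hb.2]
  by_cases hq : q = V.pt i
  · rw [if_pos hq, if_pos ⟨i, by omega, hq.symm⟩, hq]
  · rw [if_neg hq, h q h1 h2]
    refine if_congr ⟨fun ⟨j, hj, e⟩ => ⟨j, by omega, e⟩, fun ⟨j, hj, e⟩ => ⟨j, ?_, e⟩⟩ rfl rfl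
    rcases Nat.lt_succ_iff_lt_or_eq.1 hj with h | h
    · exact h
    · subst h; exact absurd e.symm hq

/-- A point of the range that precedes point number `i` in the visiting order has a smaller number,
so it is already filled; a point outside the range is never written and reads as zero. -/
lemma Filled.read {A : Pt → ℤ} {i : ℕ} {arr : ℤ → ℤ} (h : V.Filled A i arr)
    {q : Pt} (h1 : |q.1| ≤ V.E ^ 2) (h2 : |q.2| < V.E ^ 2)
    (hlt : q.1 < (V.pt i).1 ∨ q.1 = (V.pt i).1 ∧ (V.pt i).2 < q.2)
    (h0 : ¬ V.InRange q → A q = 0) : arr (V.pidx q) = A q := by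
  rw [h q h1 h2]
  split_ifs with hd
  · rfl
  · by_contra hne
    have hr : V.InRange q := by
      by_contra hr
      exact hne (h0 hr).symm
    obtain ⟨j, hj, e, hj'⟩ := V.exists_pt hr
    refine hd ⟨j, ?_, e⟩
    have hn : 0 < 2 * (V.n : ℤ) := by have := V.n_two; omega
    have hi' := Int.mul_ediv_add_emod (i : ℤ) (2 * V.n)
    have m1 := Int.emod_nonneg (i : ℤ) hn.ne'
    obtain ⟨⟨r1, r2⟩, r3, r4⟩ := hr
    unfold pt at hlt
    simp only at hlt
    zify
    rw [hj', ← hi']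
    rcases hlt with hlt | ⟨hlt, hlt'⟩
    · have := mul_le_mul_of_nonneg_left
        (show q.1 + V.n + 1 ≤ (i : ℤ) / (2 * V.n) by omega) hn.le
      rw [mul_add, mul_one, mul_comm] at this
      omega
    · rw [hlt]
      have : ((i : ℤ) / (2 * V.n) - V.n + V.n) * (2 * V.n) = 2 * V.n * ((i : ℤ) / (2 * V.n)) := by
        ring
      omega

lemma Filled.final {A : Pt → ℤ} {arr : ℤ → ℤ} (h : V.Filled A (2 * V.n * (2 * V.n)) arr)
    {q : Pt} (h1 : |q.1| ≤ V.E ^ 2) (h2 : |q.2| < V.E ^ 2) (h0 : ¬ V.InRange q → A q = 0) :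
    arr (V.pidx q) = A q := by
  rw [h q h1 h2]
  split_ifs with hd
  · rfl
  · by_contra hne
    have hr : V.InRange q := by
      by_contra hr
      exact hne (h0 hr).symm
    obtain ⟨j, hj, e, -⟩ := V.exists_pt hr
    exact hd ⟨j, hj, e⟩

end Env

namespace Env
variable (V : Env)

lemma pidxE_eq {σ : St} (hg : V.Glob σ) (a b : Ex) :
    (pidxE a b).ev V.Λ σ = V.pidx (a.ev V.Λ σ, b.ev V.Λ σ) := by
  simp [pidxE, pidx, hg.v28, hg.v29]

lemma pidxE_sf {σ : St} (a b : Ex) :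
    (pidxE a b).sf V.Λ σ ↔ a.sf V.Λ σ ∧ b.sf V.Λ σ := by
  simp [pidxE]

lemma pidxE_cost (a b : Ex) : (pidxE a b).cost = a.cost + b.cost + 7 := by
  simp [pidxE]; ring

/-- What the values computed for all points have to satisfy. -/
structure Spec (F R : Pt → ℤ) (σ : St) : Prop where
  F_rec : ∀ q, V.InRange q → F q = ∑ t ∈ Finset.range (V.L ^ 4),
    σ.mem 15 (pointKey V.φ V.ψ V.O V.L V.X (cross V.φ q) (cross V.ψ q) t) +
      F (q.1 - V.φ.1, q.2 - V.φ.2) + F (q.1 - V.ψ.1, q.2 - V.ψ.2) -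
      F (q.1 - V.φ.1 - V.ψ.1, q.2 - V.φ.2 - V.ψ.2)
  F_zero : ∀ q, ¬ V.InRange q → F q = 0
  R_rec : ∀ q, V.InRange q → R q = σ.mem 11 (V.pidx q) + R (q.1 - 1, q.2) + R (q.1, q.2 + 1) -
    R (q.1 - 1, q.2 + 1)
  R_zero : ∀ q, (q.1 < -(V.n : ℤ) ∨ (V.n : ℤ) ≤ q.2) → R q = 0

lemma queryStore_wp {F R : Pt → ℤ} {σ : St} (hg : V.Glob σ) (hS : V.Spec F R σ) {i : ℕ}
    (hi : i < 2 * V.n * (2 * V.n)) (h20 : σ.var 20 = (V.pt i).1) (h21 : σ.var 21 = (V.pt i).2)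
    (h26 : σ.var 26 = ∑ t ∈ Finset.range (V.L ^ 4), σ.mem 15
      (pointKey V.φ V.ψ V.O V.L V.X (cross V.φ (V.pt i)) (cross V.ψ (V.pt i)) t))
    (hF : V.Filled F i (σ.mem 16)) (hR : V.Filled R i (σ.mem 17)) :
    (blk [.st 16 (pidxE (.v 20) (.v 21)) (.v 26 + .ld 16 (pidxE (.v 20 - .v 3) (.v 21 - .v 4)) +
      .ld 16 (pidxE (.v 20 - .v 5) (.v 21 - .v 6)) -
      .ld 16 (pidxE (.v 20 - .v 3 - .v 5) (.v 21 - .v 4 - .v 6))),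
    .st 17 (pidxE (.v 20) (.v 21)) (.ld 11 (pidxE (.v 20) (.v 21)) +
      .ld 17 (pidxE (.v 20 - 1) (.v 21)) + .ld 17 (pidxE (.v 20) (.v 21 + 1)) -
      .ld 17 (pidxE (.v 20 - 1) (.v 21 + 1)))]).wp V.Λ (fun σ' =>
      V.Filled F (i + 1) (σ'.mem 16) ∧ V.Filled R (i + 1) (σ'.mem 17) ∧
      σ'.time ≤ σ.time + 300) σ := by
  have hn := V.n_le_E2
  have hn2 := V.n_two
  have hr := V.pt_inRange hi
  obtain ⟨⟨r1, r2⟩, r3, r4⟩ := hr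
  have h3 := V.φ1; have h4 := V.φ2; have h5 := V.ψ1; have h6 := V.ψ2
  set q := V.pt i with hq
  have hg' : ∀ (k : ℕ) (j z : ℤ) (c : ℕ), V.Glob (σ.setm k j z c) :=
    fun k j z c => hg.frame fun _ _ => rfl
  -- The farthest access is at `q - φ - ψ`: its first coordinate can drop to `-3n`, while its second
  -- stays within `2n` in absolute value.
  have b : ∀ x y : ℤ, -(3 * V.n : ℤ) ≤ x → x < V.n → -(2 * V.n : ℤ) ≤ y → y ≤ 2 * V.n →
      |x| ≤ V.E ^ 2 ∧ |y| < V.E ^ 2 := by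
    intro x y _ _ _ _; rw [abs_le, abs_lt]; omega
  have acc : ∀ (τ : St) (k : ℕ) (x y : ℤ), 1 ≤ k → k ≤ 31 → -(3 * V.n : ℤ) ≤ x → x < V.n →
      -(2 * V.n : ℤ) ≤ y → y ≤ 2 * V.n → V.Λ.Acc τ k (V.pidx (x, y)) := by
    intro τ k x y hk1 hk2 h1 h2 h3 h4
    have := b x y h1 h2 h3 h4
    exact V.acc_pidx hk1 hk2 this.1 this.2.le
  have readF : ∀ x y : ℤ, -(3 * V.n : ℤ) ≤ x → x < V.n → -(2 * V.n : ℤ) ≤ y → y ≤ 2 * V.n →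
      (x < q.1 ∨ x = q.1 ∧ q.2 < y) → σ.mem 16 (V.pidx (x, y)) = F (x, y) := by
    intro x y h1 h2 h3 h4 h5
    have := b x y h1 h2 h3 h4
    exact hF.read this.1 this.2 h5 (hS.F_zero _)
  -- Quadrant counts need not vanish beyond every edge of the range. The neighbours used here can
  -- leave it only where the first coordinate is too small or the second too large, and there the
  -- counts are zero.
  have readR : ∀ x y : ℤ, q.1 - 1 ≤ x → x ≤ q.1 → q.2 ≤ y → y ≤ q.2 + 1 →
      (x < q.1 ∨ x = q.1 ∧ q.2 < y) → σ.mem 17 (V.pidx (x, y)) = R (x, y) := by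
    intro x y h1 h2 h3 h4 h5
    have := b x y (by omega) (by omega) (by omega) (by omega)
    refine hR.read this.1 this.2 h5 fun h => hS.R_zero _ ?_
    unfold InRange at h
    simp only at h ⊢
    omega
  have a1 : ∀ τ : St, V.Λ.Acc τ 16 (V.pidx (q.1, q.2)) :=
    fun τ => acc τ 16 _ _ (by norm_num) (by norm_num) (by omega) (by omega) (by omega) (by omega)
  have a2 : ∀ τ : St, V.Λ.Acc τ 16 (V.pidx (q.1 - V.φ.1, q.2 - V.φ.2)) :=
    fun τ => acc τ 16 _ _ (by norm_num) (by norm_num) (by omega) (by omega) (by omega) (by omega)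
  have a3 : ∀ τ : St, V.Λ.Acc τ 16 (V.pidx (q.1 - V.ψ.1, q.2 - V.ψ.2)) :=
    fun τ => acc τ 16 _ _ (by norm_num) (by norm_num) (by omega) (by omega) (by omega) (by omega)
  have a4 : ∀ τ : St, V.Λ.Acc τ 16 (V.pidx (q.1 - V.φ.1 - V.ψ.1, q.2 - V.φ.2 - V.ψ.2)) :=
    fun τ => acc τ 16 _ _ (by norm_num) (by norm_num) (by omega) (by omega) (by omega) (by omega)
  have a5 : ∀ τ : St, V.Λ.Acc τ 17 (V.pidx (q.1, q.2)) :=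
    fun τ => acc τ 17 _ _ (by norm_num) (by norm_num) (by omega) (by omega) (by omega) (by omega)
  have a6 : ∀ τ : St, V.Λ.Acc τ 17 (V.pidx (q.1 - 1, q.2)) :=
    fun τ => acc τ 17 _ _ (by norm_num) (by norm_num) (by omega) (by omega) (by omega) (by omega)
  have a7 : ∀ τ : St, V.Λ.Acc τ 17 (V.pidx (q.1, q.2 + 1)) :=
    fun τ => acc τ 17 _ _ (by norm_num) (by norm_num) (by omega) (by omega) (by omega) (by omega)
  have a8 : ∀ τ : St, V.Λ.Acc τ 17 (V.pidx (q.1 - 1, q.2 + 1)) :=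
    fun τ => acc τ 17 _ _ (by norm_num) (by norm_num) (by omega) (by omega) (by omega) (by omega)
  have a9 : ∀ τ : St, V.Λ.Acc τ 11 (V.pidx (q.1, q.2)) :=
    fun τ => acc τ 11 _ _ (by norm_num) (by norm_num) (by omega) (by omega) (by omega) (by omega)
  -- The quadrant conditions place the predecessor earlier: `φ` has nonnegative first and negative
  -- second coordinate, and for the next two reads `ψ` has positive first coordinate.
  have f1 := readF (q.1 - V.φ.1) (q.2 - V.φ.2) (by omega) (by omega) (by omega) (by omega)
    (by omega)
  have f2 := readF (q.1 - V.ψ.1) (q.2 - V.ψ.2) (by omega) (by omega) (by omega) (by omega)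
    (by omega)
  have f3 := readF (q.1 - V.φ.1 - V.ψ.1) (q.2 - V.φ.2 - V.ψ.2) (by omega) (by omega) (by omega)
    (by omega) (by omega)
  have p1 := readR (q.1 - 1) q.2 (by omega) (by omega) (by omega) (by omega) (by omega)
  have p2 := readR q.1 (q.2 + 1) (by omega) (by omega) (by omega) (by omega) (by omega)
  have p3 := readR (q.1 - 1) (q.2 + 1) (by omega) (by omega) (by omega) (by omega) (by omega)
  have eF : σ.var 26 + F (q.1 - V.φ.1, q.2 - V.φ.2) + F (q.1 - V.ψ.1, q.2 - V.ψ.2) -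
      F (q.1 - V.φ.1 - V.ψ.1, q.2 - V.φ.2 - V.ψ.2) = F q := by
    rw [hS.F_rec q ⟨⟨r1, r2⟩, r3, r4⟩, h26]
  have eR : σ.mem 11 (V.pidx (q.1, q.2)) + R (q.1 - 1, q.2) + R (q.1, q.2 + 1) -
      R (q.1 - 1, q.2 + 1) = R q := (hS.R_rec q ⟨⟨r1, r2⟩, r3, r4⟩).symm
  simp only [wp_blk_cons, wp_blk_nil, wp_st, pidxE_sf, V.pidxE_eq hg, V.pidxE_eq (hg' _ _ _ _),
    sf_add, sf_sub, sf_ld, sf_v, sf_one, ev_add, ev_sub, ev_ld, ev_v, ev_one, St.setm_var,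
    St.setm_mem, h20, h21, hg.v3, hg.v4, hg.v5, hg.v6, a1, a2, a3, a4, a5, a6, a7, a8, a9,
    Nat.reduceEqDiff, if_false, true_and, and_self, f1, f2, f3, p1, p2, p3, eF, eR,
    Prod.mk.eta]
  refine ⟨?_, ?_, ?_⟩
  · rw [St.tick_mem, St.setm_mem, if_neg (by norm_num), St.setm_mem, if_pos rfl]
    exact hF.step hi
  · rw [St.tick_mem, St.setm_mem, if_pos rfl, St.setm_mem, if_neg (by norm_num)]
    exact hR.step hi
  · simp [pidxE_cost]

lemma queryP_wp {F R : Pt → ℤ} {σ : St} (hg : V.Glob σ) (hS : V.Spec F R σ)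
    (h16 : σ.mem 16 = 0) (h17 : σ.mem 17 = 0) :
    queryP.wp V.Λ (fun σ' => V.Filled F (2 * V.n * (2 * V.n)) (σ'.mem 16) ∧
      V.Filled R (2 * V.n * (2 * V.n)) (σ'.mem 17) ∧
      σ'.time ≤ σ.time + (305 * V.L ^ 4 + 600) * (2 * V.n * (2 * V.n)) + 20) σ := by
  have hX := V.X_lt_half
  have hXg := V.X_ge
  have hX' := V.X_lt_half'
  have hn := V.n_lt_E
  have hn2 := V.n_two
  have hO := V.E3_le_O
  have hd := V.d_pos; have hd2 := V.d_lt
  have hE2 := V.E2_ge; have hE3 := V.E3_le; have hE4 := V.E4_le; have hB := V.B_le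
  have hO2 := V.O_le; have hO' := V.O_le'; have hX2 := V.X_le
  have hEE := V.E_le_E2
  have h4n : 2 * (V.n : ℤ) * (2 * V.n) < V.X := by
    have : 2 * (V.n : ℤ) * (2 * V.n) ≤ 2 * V.E * (2 * V.E) :=
      mul_le_mul (by omega) (by omega) (by omega) (by omega)
    have e : 2 * V.E * (2 * V.E) = 4 * V.E ^ 2 := by ring
    omega
  have hmv : ∀ r ∈ [1, 2, 3, 4, 5, 6, 7, 9, 10, 11, 28, 29], r ∉ queryP.vars := by decide
  refine Sm.wp_rep (fun i σ' => V.Filled F i (σ'.mem 16) ∧ V.Filled R i (σ'.mem 17) ∧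
    (∀ k, k ≠ 16 → k ≠ 17 → σ'.mem k = σ.mem k) ∧ (∀ r, r ∉ queryP.vars → σ'.var r = σ.var r) ∧
    σ'.time ≤ σ.time + (305 * V.L ^ 4 + 600) * i + 15) (2 * V.n * (2 * V.n)) (by simp) ?_
    (by push_cast; omega) ?_ ?_ ?_
  · simp only [ev_mul, ev_lit, ev_v, hg.v2]; push_cast; ring
  · refine ⟨Filled.zero h16, Filled.zero h17, fun _ _ _ => rfl, fun _ _ => rfl, ?_⟩
    simp
  · rintro i hi σ₁ ⟨i1, i2, i3, i4, i5⟩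
    have hg1 : V.Glob σ₁ := hg.frame fun r hr => i4 r (hmv r hr)
    have hr := V.pt_inRange hi
    have hib : (i : ℤ) < V.X := by zify at hi; omega
    rw [wp_blk_cons, wp_asg, wp_blk_cons, wp_asg, wp_blk_cons]
    simp only [sf_sub, sf_div, sf_mod, sf_mul, sf_lit, sf_v, sf_one, ev_sub, ev_div, ev_mod,
      ev_mul, ev_lit, ev_v, ev_one, St.setv_var, Nat.reduceEqDiff, if_true, if_false, hg1.v2,
      true_and, and_true]
    refine ⟨by omega, by omega, ?_⟩
    have hv : ∀ (r : ℕ) (z₁ z₂ z₃ : ℤ) (c₁ c₂ c₃ : ℕ), r ∉ queryP.vars →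
        (((σ₁.setv 17 z₁ c₁).setv 20 z₂ c₂).setv 21 z₃ c₃).var r = σ.var r := by
      intro r z₁ z₂ z₃ c₁ c₂ c₃ hr
      have e1 : r ≠ 17 ∧ r ≠ 20 ∧ r ≠ 21 := by
        refine ⟨?_, ?_, ?_⟩ <;> (rintro rfl; exact hr (by decide))
      rw [← i4 r hr]
      simp [St.setv_var, e1]
    refine Sm.wp_mono _ ?_ (Sm.wp_frame _ (V.functionalsP_wp (u := V.pt i)
      (hg.frame fun r hr => hv r _ _ _ _ _ _ (hmv r hr)) ?_ ?_))
    · rintro σ₂ ⟨⟨f1, f2⟩, hf⟩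
      have m2 : σ₂.mem = σ₁.mem := by
        funext k
        exact hf.2 k (by simp [functionalsP, blk, Sm.arrs])
      have v2 : ∀ r, r ∉ queryP.vars → σ₂.var r = σ.var r := by
        intro r hr
        rw [hf.1 r fun h => hr (by
          have : ∀ r ∈ functionalsP.vars, r ∈ queryP.vars := by decide
          exact this r h), hv r _ _ _ _ _ _ hr]
      have v20 : σ₂.var 20 = (V.pt i).1 := by
        rw [hf.1 20 (by decide)]; simp [St.setv_var, pt]
      have v21 : σ₂.var 21 = (V.pt i).2 := by
        rw [hf.1 21 (by decide)]; simp [St.setv_var, pt]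
      have hg2 : V.Glob σ₂ := hg.frame fun r hr => v2 r (hmv r hr)
      have e22 : σ₂.var 22 = cross V.φ (V.pt i) := f1 0 (by norm_num)
      have e23 : σ₂.var 23 = cross V.ψ (V.pt i) := f1 1 (by norm_num)
      have t2 : σ₂.time ≤ σ₁.time + 100 := by
        simp only [St.setv_time, cost_sub, cost_div, cost_mod, cost_mul, cost_lit, cost_v,
          cost_one] at f2
        omega
      have hnb : |(V.pt i).1| ≤ V.n ∧ |(V.pt i).2| ≤ V.n := by
        obtain ⟨⟨r1, r2⟩, r3, r4⟩ := hr
        rw [abs_le, abs_le]; omega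
      have c0 : |cross V.φ (V.pt i)| ≤ 2 * V.E ^ 3 := V.fn_bound hnb.1 hnb.2 (k := 0) (by norm_num)
      have c1 : |cross V.ψ (V.pt i)| ≤ 2 * V.E ^ 3 := V.fn_bound hnb.1 hnb.2 (k := 1) (by norm_num)
      rw [abs_le] at c0 c1
      rw [wp_blk_cons, wp_asg, wp_blk_cons, wp_asg, wp_blk_cons]
      simp only [sf_add, sf_mod, sf_mul, sf_zero, sf_v, ev_zero, ev_add, ev_mod,
        ev_mul, ev_v, St.setv_var, Nat.reduceEqDiff, if_false, hg2.v7, hg2.v10,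
        hg2.v11, e22, e23, true_and, and_true]
      refine ⟨by omega, ?_⟩
      have hv' : ∀ (r : ℕ) (z₁ z₂ : ℤ) (c₁ c₂ : ℕ), r ∉ queryP.vars →
          ((σ₂.setv 26 z₁ c₁).setv 27 z₂ c₂).var r = σ.var r := by
        intro r z₁ z₂ c₁ c₂ hr
        have e1 : r ≠ 26 ∧ r ≠ 27 := by
          refine ⟨?_, ?_⟩ <;> (rintro rfl; exact hr (by decide))
        rw [← v2 r hr]
        simp [St.setv_var, e1]
      refine Sm.wp_mono _ ?_ (Sm.wp_frame _ (V.lookupLoop_wp (q := V.pt i)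
        (hg.frame fun r hr => hv' r _ _ _ _ (hmv r hr)) hnb.1 hnb.2 ?_ ?_ ?_))
      · rintro σ₃ ⟨⟨l1, l2⟩, hl⟩
        have m3 : σ₃.mem = σ₁.mem := by
          rw [← m2]
          funext k
          exact hl.2 k (by simp [lookupP, lookStep, dims, blk, Sm.arrs])
        have v3 : ∀ r, r ∉ queryP.vars → σ₃.var r = σ.var r := by
          intro r hr
          rw [hl.1 r fun h => hr (by
            have : ∀ r ∈ (Sm.rep 33 (.v 9 * .v 9 * .v 9 * .v 9) lookupP).vars,
              r ∈ queryP.vars := by decide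
            exact this r h), hv' r _ _ _ _ hr]
        have hS3 : V.Spec F R σ₃ := by
          have e15 : σ₃.mem 15 = σ.mem 15 := by rw [m3, i3 15 (by norm_num) (by norm_num)]
          have e11 : σ₃.mem 11 = σ.mem 11 := by rw [m3, i3 11 (by norm_num) (by norm_num)]
          refine ⟨?_, hS.F_zero, ?_, hS.R_zero⟩
          · rw [e15]; exact hS.F_rec
          · rw [e11]; exact hS.R_rec
        refine Sm.wp_mono _ ?_ (Sm.wp_frame _ (V.queryStore_wp
          (hg.frame fun r hr => v3 r (hmv r hr)) hS3 hi ?_ ?_ ?_ (by rw [m3]; exact i1)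
          (by rw [m3]; exact i2)))
        · rintro σ₄ ⟨⟨s1, s2, s3⟩, hs⟩
          refine ⟨s1, s2, ?_, ?_, ?_⟩
          · intro k hk1 hk2
            rw [St.tick_mem, hs.2 k (by simp [blk, Sm.arrs, hk1, hk2]), m3, i3 k hk1 hk2]
          · intro r hr
            rw [St.tick_var, hs.1 r (by simp [blk, Sm.vars]), v3 r hr]
          · rw [mul_add, mul_one]
            simp only [St.tick_time, St.setv_time, cost_add, cost_mod, cost_mul, cost_v,
              cost_zero] at l2 s3 ⊢
            omega
        · rw [hl.1 20 (by decide)]; simp [St.setv_var, v20]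
        · rw [hl.1 21 (by decide)]; simp [St.setv_var, v21]
        · rw [l1, m3]; rw [St.setv_mem, St.setv_mem, m2]
      · intro k hk
        have e1 : 22 + k ≠ 26 ∧ 22 + k ≠ 27 := by omega
        rw [← f1 k hk]
        simp [St.setv_var, e1]
      · simp [St.setv_var]
      · simp [St.setv_var, quBase, Env.d]
    · simp [St.setv_var, pt]
    · simp [St.setv_var, pt]
  · rintro σ₁ ⟨i1, i2, i3, i4, i5⟩
    exact ⟨i1, i2, by simp only [St.tick_time]; omega⟩

end Env

/-! ### Verification of the output. -/

namespace Env
variable (V : Env)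

/-- The value written for the shift `q`. -/
def out (F R : Pt → ℤ) (q : Pt) : ℤ :=
  R (q.1 + V.m - 1, q.2) - R (q.1 - 1, q.2) - R (q.1 + V.m - 1, q.2 + V.m) +
    R (q.1 - 1, q.2 + V.m) - F q

lemma outputP_wp {F R : Pt → ℤ} {σ : St} (hg : V.Glob σ) {Qs : List Pt}
    (hF : V.Filled F (2 * V.n * (2 * V.n)) (σ.mem 16))
    (hR : V.Filled R (2 * V.n * (2 * V.n)) (σ.mem 17))
    (hF0 : ∀ q, ¬ V.InRange q → F q = 0)
    (hR0 : ∀ q : Pt, (q.1 < -(V.n : ℤ) ∨ (V.n : ℤ) ≤ q.2) → R q = 0)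
    (h30 : σ.var 30 = Qs.length) (h14 : 0 ≤ σ.var 14 ∧ σ.var 14 + 2 * Qs.length < V.X)
    (hraw : Seg (σ.mem 0) (σ.var 14) (Qs.flatMap fun q => [q.1, q.2]))
    (hQ : ∀ q ∈ Qs, (0 ≤ q.1 ∧ q.1 + V.m ≤ V.n) ∧ 0 ≤ q.2 ∧ q.2 + V.m ≤ V.n) :
    outputP.wp V.Λ (fun σ' => (∀ (i : ℕ) (hi : i < Qs.length), σ'.mem 0 i = V.out F R Qs[i]) ∧
      σ'.time ≤ σ.time + 300 * Qs.length + 10) σ := by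
  have hX := V.X_lt_half'
  have hn := V.n_le_E2
  have hn2 := V.n_two
  have hm := V.m_pos
  have hmn := V.m_le
  set p := σ.var 14 with hp
  have hmv : ∀ r ∈ [1, 2, 3, 4, 5, 6, 7, 9, 10, 11, 28, 29], r ∉ outputP.vars := by decide
  refine Sm.wp_rep_list Qs (fun l σ' => σ'.var 14 = p + 2 * l.length ∧
    (∀ (i : ℕ) (q : Pt), l[i]? = some q → σ'.mem 0 i = V.out F R q) ∧
    (∀ i : ℤ, l.length ≤ i → σ'.mem 0 i = σ.mem 0 i) ∧
    σ'.mem 16 = σ.mem 16 ∧ σ'.mem 17 = σ.mem 17 ∧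
    (∀ r, r ∉ outputP.vars → σ'.var r = σ.var r) ∧ σ'.time ≤ σ.time + 300 * l.length + 5)
    (by simp) (by simpa using h30) (by omega) ?_ ?_ ?_
  · exact ⟨by simp [hp], by simp, fun _ _ => rfl, rfl, rfl, fun _ _ => rfl, by simp⟩
  · rintro l₁ q l₂ rfl σ₁ ⟨i1, i2, i3, i4, i5, i6, i7⟩
    rw [List.length_append, List.length_cons] at h14
    push_cast at h14
    rw [List.flatMap_append, List.flatMap_cons, seg_append, seg_append] at hraw
    have hl : ((l₁.flatMap fun q : Pt => [q.1, q.2]).length : ℤ) = 2 * l₁.length := by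
      rw [List.length_flatMap]; simp; ring
    obtain ⟨-, ⟨s1, s2, -⟩, -⟩ := hraw
    rw [hl] at s1 s2
    -- Answers overwrite the input in place. The reading position advances two cells per shift and
    -- the writing position one, so unread shifts are intact.
    rw [← i3 _ (by omega)] at s1 s2
    have hg1 : V.Glob σ₁ := hg.frame fun r hr => i6 r (hmv r hr)
    obtain ⟨⟨q1, q2⟩, q3, q4⟩ := hQ q (by simp)
    have fin : ∀ x y : ℤ, -1 ≤ x → x < V.n → 0 ≤ y → y ≤ V.n →
        σ.mem 17 (V.pidx (x, y)) = R (x, y) := by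
      intro x y h1 h2 h3 h4
      refine hR.final (by rw [abs_le]; simp only; omega) (by rw [abs_lt]; simp only; omega)
        fun h => hR0 _ ?_
      unfold InRange at h
      simp only at h ⊢
      omega
    have r1 := fin (q.1 + V.m - 1) q.2 (by omega) (by omega) (by omega) (by omega)
    have r2 := fin (q.1 - 1) q.2 (by omega) (by omega) (by omega) (by omega)
    have r3 := fin (q.1 + V.m - 1) (q.2 + V.m) (by omega) (by omega) (by omega) (by omega)
    have r4 := fin (q.1 - 1) (q.2 + V.m) (by omega) (by omega) (by omega) (by omega)
    have r5 : σ.mem 16 (V.pidx q) = F q :=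
      hF.final (by rw [abs_le]; omega) (by rw [abs_lt]; omega) (hF0 q)
    have a0 : ∀ τ : St, V.Λ.Acc τ 0 (p + 2 * l₁.length) := fun τ => V.acc0 (by omega) (by omega)
    have a1 : ∀ τ : St, V.Λ.Acc τ 0 (p + 2 * l₁.length + 1) :=
      fun τ => V.acc0 (by omega) (by omega)
    have a2 : ∀ τ : St, V.Λ.Acc τ 0 l₁.length := fun τ => V.acc0 (by omega) (by omega)
    have acc : ∀ (τ : St) (k : ℕ) (x y : ℤ), 1 ≤ k → k ≤ 31 → -1 ≤ x → x < V.n → 0 ≤ y →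
        y ≤ V.n → V.Λ.Acc τ k (V.pidx (x, y)) := by
      intro τ k x y hk1 hk2 h1 h2 h3 h4
      exact V.acc_pidx hk1 hk2 (by rw [abs_le]; simp only; omega) (by rw [abs_le]; simp only; omega)
    have b1 : ∀ τ : St, V.Λ.Acc τ 17 (V.pidx (q.1 + V.m - 1, q.2)) := fun τ =>
      acc τ 17 _ _ (by norm_num) (by norm_num) (by omega) (by omega) (by omega) (by omega)
    have b2 : ∀ τ : St, V.Λ.Acc τ 17 (V.pidx (q.1 - 1, q.2)) := fun τ =>
      acc τ 17 _ _ (by norm_num) (by norm_num) (by omega) (by omega) (by omega) (by omega)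
    have b3 : ∀ τ : St, V.Λ.Acc τ 17 (V.pidx (q.1 + V.m - 1, q.2 + V.m)) := fun τ =>
      acc τ 17 _ _ (by norm_num) (by norm_num) (by omega) (by omega) (by omega) (by omega)
    have b4 : ∀ τ : St, V.Λ.Acc τ 17 (V.pidx (q.1 - 1, q.2 + V.m)) := fun τ =>
      acc τ 17 _ _ (by norm_num) (by norm_num) (by omega) (by omega) (by omega) (by omega)
    have b5 : ∀ τ : St, V.Λ.Acc τ 16 (V.pidx q) := fun τ =>
      acc τ 16 q.1 q.2 (by norm_num) (by norm_num) (by omega) (by omega) (by omega) (by omega)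
    have hgs : ∀ (z₁ z₂ z₃ z₄ : ℤ) (c₁ c₂ c₃ c₄ : ℕ), V.Glob
        ((((σ₁.setv 17 z₁ c₁).setv 20 z₂ c₂).setv 21 z₃ c₃).setv 14 z₄ c₄) := by
      intro z₁ z₂ z₃ z₄ c₁ c₂ c₃ c₄
      refine hg1.frame fun r hr => ?_
      have e1 : r ≠ 17 ∧ r ≠ 20 ∧ r ≠ 21 ∧ r ≠ 14 := by
        refine ⟨?_, ?_, ?_, ?_⟩ <;> (rintro rfl; revert hr; decide)
      simp [St.setv_var, e1]
    simp only [wp_blk_cons, wp_blk_nil, wp_asg, wp_st, sf_ld, ev_ld, sf_v, ev_v, sf_add, ev_add,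
      sf_one, ev_one, sf_lit, ev_lit, sf_sub, ev_sub, St.setv_var, St.setv_mem, pidxE_sf,
      V.pidxE_eq (hgs _ _ _ _ _ _ _ _), Nat.reduceEqDiff, if_true, if_false, hg1.v1, i1, s1, s2,
      i4, i5, r1, r2, r3, r4, r5, a0, a1, a2, b1, b2, b3, b4, b5, true_and, and_self,
      OfNat.one_ne_ofNat]
    refine ⟨?_, ?_, ?_, ?_, ?_, ?_, ?_⟩
    · simp [St.setv_var]; ring
    · intro i q' hi
      rw [St.tick_mem, St.tick_mem, St.setm_mem, if_pos rfl, Function.update_apply]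
      rcases lt_trichotomy i l₁.length with h | h | h
      · rw [List.getElem?_append_left h] at hi
        rw [if_neg (by omega)]
        exact i2 i q' hi
      · subst h
        simp at hi
        subst hi
        rw [if_pos rfl]; rfl
      · rw [List.getElem?_eq_none (by simp; omega)] at hi
        simp at hi
    · intro i hi
      rw [List.length_append, List.length_singleton] at hi
      push_cast at hi
      rw [St.tick_mem, St.tick_mem, St.setm_mem, if_pos rfl, Function.update_of_ne (by omega)]
      exact i3 i (by omega)
    · simpa [St.setm_mem] using i4
    · simpa [St.setm_mem] using i5
    · intro r hr
      have e1 : r ≠ 17 ∧ r ≠ 20 ∧ r ≠ 21 ∧ r ≠ 14 := by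
        refine ⟨?_, ?_, ?_, ?_⟩ <;> (rintro rfl; revert hr; decide)
      rw [← i6 r hr]
      simp [St.setv_var, e1]
    · simp only [St.tick_time, St.setm_time, St.setv_time, pidxE_cost, cost_ld, cost_v, cost_add,
        cost_sub, cost_one, cost_lit, List.length_append, List.length_singleton]
      omega
  · rintro σ₁ ⟨i1, i2, i3, i4, i5, i6, i7⟩
    exact ⟨fun i hi => i2 i _ (List.getElem?_eq_getElem hi), by simp only [St.tick_time]; omega⟩

end Env

/-! ### The whole program. -/

namespace Env
variable (V : Env)

/-- The table after all pairs have been treated. -/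
def table (Vs Ss : List StoredStr) : ℤ → ℤ := (Ss.map (V.stringTab Vs)).sum

/-- The number of steps of the whole program. -/
def totalTime (Vs Ss : List StoredStr) (Qs : List Pt) : ℕ :=
  100 * V.n + famTime Vs + famTime Ss + 200 * (Vs ++ Ss).length + 100 * Vs.length +
    (Ss.map (V.stringTime Vs)).sum + 200 * Ss.length +
    (305 * V.L ^ 4 + 600) * (2 * V.n * (2 * V.n)) + 300 * Qs.length + 1000

lemma mainP_wp {F R : Pt → ℤ} {σ : St} {Vs Ss : List StoredStr} {Qs : List Pt}
    (hv : ∀ r, σ.var r = 0) (hmem : ∀ k, 1 ≤ k → σ.mem k = 0)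
    (hraw : Seg (σ.mem 0) 0 (encodeInput V.m V.n V.φ V.ψ Vs Ss Qs))
    (hX : ((encodeInput V.m V.n V.φ V.ψ Vs Ss Qs).length : ℤ) < V.X) (hi : V.Inp Vs Ss)
    (hroff : V.Λ.roff = freeOffset V.Λ.w (V.X ^ 11) (Vs ++ Ss) ((Vs ++ Ss).length + 1))
    (hb : ∀ L ∈ Vs, L ≠ [] → ∀ S ∈ Ss, S ≠ [] → V.PairBounds (V.lo L) (V.hi L) (V.lo S) (V.hi S))
    (hQ : ∀ q ∈ Qs, (0 ≤ q.1 ∧ q.1 + V.m ≤ V.n) ∧ 0 ≤ q.2 ∧ q.2 + V.m ≤ V.n)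
    (hS : ∀ σ' : St, σ'.mem 15 = V.table Vs Ss →
      (∀ i, σ'.mem 11 i = (Ss.map fun L => V.marks L i).sum) → V.Spec F R σ') :
    mainP.wp V.Λ (fun σ' => (∀ (i : ℕ) (hi : i < Qs.length), σ'.mem 0 i = V.out F R Qs[i]) ∧
      σ'.time ≤ σ.time + V.totalTime Vs Ss Qs) σ := by
  have gl : ∀ r ∈ [1, 2, 3, 4, 5, 6, 7, 9, 10, 11, 28, 29], r ∉ parseP.vars ∧ r ∉ flagP.vars ∧
      r ∉ chainP.vars ∧ r ∉ pairsP.vars ∧ r ∉ queryP.vars := by decide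
  have ip : Seg (σ.mem 0) 0 [(V.m : ℤ), V.n, V.φ.1, V.φ.2, V.ψ.1, V.ψ.2] := by
    unfold encodeInput at hraw
    rw [List.append_assoc, List.append_assoc, seg_append] at hraw
    exact hraw.1
  obtain ⟨p0, p1, p2, p3, p4, p5, -⟩ := ip
  norm_num at p0 p1 p2 p3 p4 p5
  unfold mainP
  rw [wp_blk_cons]
  refine Sm.wp_mono _ ?_ (Sm.wp_frame _ (V.initP_wp p0 p1 p2 p3 p4 p5))
  rintro σ₁ ⟨⟨g1, t1⟩, f1⟩
  have m1 : σ₁.mem = σ.mem := by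
    funext k; exact f1.2 k (by simp [initP, blk, Sm.arrs])
  rw [wp_blk_cons]
  refine Sm.wp_mono _ ?_ (V.parseP_wp g1 hi (by rw [m1]; exact hraw) hX
    (fun k h1 _ => by rw [m1, hmem k h1]))
  rintro σ₂ ⟨pp, t2⟩
  have g2 : V.Glob σ₂ := g1.frame fun r hr => pp.var r (gl r hr).1
  have v20 : σ₂.var 0 = 0 := by
    rw [pp.var 0 (by decide), f1.1 0 (by decide), hv]
  have m2 : ∀ k, 12 ≤ k → σ₂.mem k = 0 := fun k hk => by
    rw [pp.mem k hk, m1, hmem k (by omega)]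
  rw [wp_blk_cons]
  refine Sm.wp_mono _ ?_ (Sm.wp_frame _ (V.flagP_wp hi g2 v20 pp.v12 pp.v13 pp.strs
    (m2 12 le_rfl)))
  rintro σ₃ ⟨⟨q1, t3⟩, f3⟩
  have g3 : V.Glob σ₃ := g2.frame fun r hr => f3.1 r (gl r hr).2.1
  have m3 : ∀ k, k ≠ 12 → σ₃.mem k = σ₂.mem k := fun k hk =>
    f3.2 k (by simp [flagP, blk, Sm.arrs, hk])
  -- Variable 0 now holds the offset that the layout has presupposed, so array 32 becomes accessible
  -- from here on.
  rw [← hroff] at q1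
  have v312 : σ₃.var 12 = Vs.length := by rw [f3.1 12 (by decide), pp.v12]
  have s3 := pp.strs.congr (mem' := σ₃.mem) fun k _ hk => m3 k (by omega)
  rw [wp_blk_cons]
  refine Sm.wp_mono _ ?_ (Sm.wp_frame _ (V.chainP_wp hi q1 v312 s3
    (by rw [m3 14 (by norm_num), m2 14 (by norm_num)])
    (by rw [m3 32 (by norm_num), m2 32 (by norm_num)])))
  rintro σ₄ ⟨⟨c4, t4⟩, f4⟩
  have g4 : V.Glob σ₄ := g3.frame fun r hr => f4.1 r (gl r hr).2.2.1
  have m4 : ∀ k, k ≠ 13 → k ≠ 14 → k ≠ 32 → σ₄.mem k = σ₃.mem k := fun k h1 h2 h3 =>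
    f4.2 k (by simp [chainP, blk, Sm.arrs, h1, h2, h3])
  rw [wp_blk_cons]
  refine Sm.wp_mono _ ?_ (Sm.wp_frame _ (V.pairsP_wp hi g4 (by rw [f4.1 0 (by decide), q1])
    (by rw [f4.1 12 (by decide), v312])
    (by rw [f4.1 13 (by decide), f3.1 13 (by decide), pp.v13])
    (s3.congr fun k _ hk => m4 k (by omega) (by omega) (by omega)) c4 hb))
  rintro σ₅ ⟨⟨c5, t5⟩, f5⟩
  have g5 : V.Glob σ₅ := g4.frame fun r hr => f5.1 r (gl r hr).2.2.2.1
  have m5 : ∀ k, k = 0 ∨ k = 11 ∨ 16 ≤ k ∧ k < 32 → σ₅.mem k = σ₂.mem k := fun k h => by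
    rw [c5.1 k (by omega), m4 k (by omega) (by omega) (by omega), m3 k (by omega)]
  have hS5 : V.Spec F R σ₅ := by
    refine hS σ₅ ?_ fun i => ?_
    · funext i
      rw [c5.2 i, m4 15 (by norm_num) (by norm_num) (by norm_num), m3 15 (by norm_num),
        m2 15 (by norm_num)]
      simp [table]
    · rw [m5 11 (by norm_num), pp.mark]
  rw [wp_blk_cons]
  refine Sm.wp_mono _ ?_ (Sm.wp_frame _ (V.queryP_wp g5 hS5
    (by rw [m5 16 (by norm_num), m2 16 (by norm_num)])
    (by rw [m5 17 (by norm_num), m2 17 (by norm_num)])))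
  rintro σ₆ ⟨⟨a6, b6, t6⟩, f6⟩
  have v6 : ∀ r ∈ [14, 30], σ₆.var r = σ₂.var r := by
    intro r hr
    have : r ∉ flagP.vars ∧ r ∉ chainP.vars ∧ r ∉ pairsP.vars ∧ r ∉ queryP.vars := by
      revert hr
      revert r
      decide
    rw [f6.1 r this.2.2.2, f5.1 r this.2.2.1, f4.1 r this.2.1, f3.1 r this.1]
  have m6 : σ₆.mem 0 = σ₂.mem 0 := by
    rw [f6.2 0 (by simp [queryP, functionalsP, lookupP, lookStep, dims, blk, Sm.arrs]),
      m5 0 (by norm_num)]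
  rw [wp_blk_cons]
  refine Sm.wp_mono _ ?_ (V.outputP_wp (g5.frame fun r hr => f6.1 r (gl r hr).2.2.2.2) a6 b6
    hS5.F_zero hS5.R_zero (by rw [v6 30 (by simp), pp.v30])
    (by rw [v6 14 (by simp)]; exact pp.v14)
    (by rw [v6 14 (by simp), m6]; exact pp.raw) hQ)
  rintro σ₇ ⟨r1, t7⟩
  rw [wp_blk_nil]
  refine ⟨r1, ?_⟩
  unfold totalTime
  simp only [St.tick_time]
  omega

end Env

/-! ### Tight bounds of stored strings. -/

/-- The points of a stored string. -/
def pts (L : StoredStr) : Finset Pt := (L.map Prod.fst).toFinset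

lemma mem_pts {L : StoredStr} {u : Pt} : u ∈ pts L ↔ ∃ a, (u, a) ∈ L := by
  simp [pts]

lemma sum_list_apply {α β : Type*} (f : α → β → ℤ) (l : List α) (x : β) :
    (l.map f).sum x = (l.map fun a => f a x).sum := by
  induction l with
  | nil => rfl
  | cons a l ih => simp [ih]

lemma sum_list_sum {α β : Type*} (f : α → β → ℤ) (l : List α) (s : Finset β) :
    ∑ t ∈ s, (l.map fun a => f a t).sum = (l.map fun a => ∑ t ∈ s, f a t).sum := by
  induction l with
  | nil => simp
  | cons a l ih => simp [ih, Finset.sum_add_distrib]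

namespace Env
variable (V : Env)

variable {V} in
-- The first point beats the initial 0 since the shifted values have a definite sign; from then on
-- the folds are ordinary minima and maxima, attained in the list.
lemma hull_lo {L : StoredStr} (hL : L ≠ [])
    (h : ∀ p ∈ L, (0 ≤ p.1.1 ∧ p.1.1 < V.n) ∧ 0 ≤ p.1.2 ∧ p.1.2 < V.n) {k : ℕ} (hk : k < 4) :
    ((∀ p ∈ L, V.lo L k ≤ fn V.φ V.ψ k p.1) ∧ ∃ p ∈ L, V.lo L k = fn V.φ V.ψ k p.1) ∧
    ((∀ p ∈ L, fn V.φ V.ψ k p.1 ≤ V.hi L k) ∧ ∃ p ∈ L, V.hi L k = fn V.φ V.ψ k p.1) := by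
  have hO := V.E3_le_O
  have hE : 0 < V.E ^ 3 := by have := V.E_ge; positivity
  induction L using List.reverseRecOn with
  | nil => exact absurd rfl hL
  | append_singleton L p ih =>
    have hp := h p (by simp)
    have hb := abs_le.1
      (V.fn_bound (u := p.1) (by rw [abs_le]; omega) (by rw [abs_le]; omega) hk)
    have e1 : V.lo (L ++ [p]) k = loStep V.O (fn V.φ V.ψ k p.1) (V.loRaw k L) + V.O := by
      simp [lo, loRaw]
    have e2 : V.hi (L ++ [p]) k = hiStep V.O (fn V.φ V.ψ k p.1) (V.hiRaw k L) - V.O := by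
      simp [Env.hi, hiRaw]
    rw [e1, e2, loStep_eq, hiStep_eq]
    rcases eq_or_ne L [] with rfl | hL'
    · rw [show V.loRaw k [] = 0 from rfl, show V.hiRaw k [] = 0 from rfl, if_pos (by omega),
        if_pos (by omega)]
      simp
    · obtain ⟨⟨i1, a, ha, i2⟩, i3, b, hb', i4⟩ := ih hL' fun p hp => h p (by simp [hp])
      have f1 : V.lo L k = V.loRaw k L + V.O := rfl
      have f2 : V.hi L k = V.hiRaw k L - V.O := rfl
      refine ⟨⟨fun x hx => ?_, ?_⟩, fun x hx => ?_, ?_⟩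
      · rcases List.mem_append.1 hx with hx | hx
        · have := i1 x hx
          split_ifs <;> omega
        · rw [List.mem_singleton.1 hx]
          split_ifs <;> omega
      · split_ifs with hc
        · exact ⟨p, by simp, by ring⟩
        · exact ⟨a, by simp [ha], by omega⟩
      · rcases List.mem_append.1 hx with hx | hx
        · have := i3 x hx
          split_ifs <;> omega
        · rw [List.mem_singleton.1 hx]
          split_ifs <;> omega
      · split_ifs with hc
        · exact ⟨p, by simp, by ring⟩
        · exact ⟨b, by simp [hb'], by omega⟩

variable {V} in
lemma isHull {L : StoredStr} (hL : L ≠ [])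
    (h : ∀ p ∈ L, (0 ≤ p.1.1 ∧ p.1.1 < V.n) ∧ 0 ≤ p.1.2 ∧ p.1.2 < V.n) :
    IsHull V.φ V.ψ (pts L) (V.lo L) (V.hi L) := by
  intro k hk
  obtain ⟨⟨h1, p, hp, h2⟩, h3, p', hp', h4⟩ := hull_lo hL h hk
  refine ⟨⟨⟨p.1, mem_pts.2 ⟨p.2, hp⟩, h2.symm⟩, ?_⟩, ⟨⟨p'.1, mem_pts.2 ⟨p'.2, hp'⟩, h4.symm⟩, ?_⟩⟩
  · rintro _ ⟨u, hu, rfl⟩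
    obtain ⟨a, ha⟩ := mem_pts.1 hu
    exact h1 _ ha
  · rintro _ ⟨u, hu, rfl⟩
    obtain ⟨a, ha⟩ := mem_pts.1 hu
    exact h3 _ ha

variable {V} in
lemma hull_bound {L : StoredStr} (hL : L ≠ [])
    (h : ∀ p ∈ L, (0 ≤ p.1.1 ∧ p.1.1 < V.n) ∧ 0 ≤ p.1.2 ∧ p.1.2 < V.n) {k : ℕ} (hk : k < 4) :
    |V.lo L k| ≤ 2 * V.E ^ 3 ∧ |V.hi L k| ≤ 2 * V.E ^ 3 ∧ V.lo L k ≤ V.hi L k := by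
  obtain ⟨⟨h1, p, hp, h2⟩, h3, p', hp', h4⟩ := hull_lo hL h hk
  have b := h p hp
  have b' := h p' hp'
  refine ⟨?_, ?_, (h1 p hp).trans (h3 p hp)⟩
  · rw [h2]
    exact V.fn_bound (by rw [abs_le]; omega) (by rw [abs_le]; omega) hk
  · rw [h4]
    exact V.fn_bound (by rw [abs_le]; omega) (by rw [abs_le]; omega) hk

lemma E4_le_B : 16 * V.E ^ 3 ≤ V.B ∧ 10 * V.E ^ 4 ≤ 3 * V.B := by
  have hE4 := V.E4_le; have hB := V.B_le
  have : 0 < V.E ^ 3 := by have := V.E_ge; positivity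
  omega

variable {V} in
-- Corner coordinates are extreme values on `S` displaced by at most `d`, hence at most `4 * E ^ 2`
-- in absolute value; the last two functionals multiply them by coordinates of `φ` and `ψ`, which
-- are at most `n < E`.
lemma pairBounds {L S : StoredStr} (hL : L ≠ []) (hS : S ≠ [])
    (h : ∀ p ∈ L, (0 ≤ p.1.1 ∧ p.1.1 < V.n) ∧ 0 ≤ p.1.2 ∧ p.1.2 < V.n)
    (h' : ∀ p ∈ S, (0 ≤ p.1.1 ∧ p.1.1 < V.n) ∧ 0 ≤ p.1.2 ∧ p.1.2 < V.n) :
    V.PairBounds (V.lo L) (V.hi L) (V.lo S) (V.hi S) := by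
  have hE4 := V.E4_le; have hB := V.B_le; have hE3 := V.E3_le
  have hE2 := V.E2_ge
  have hE := V.E_ge
  have hd := V.d_pos; have hd2 := V.d_lt
  refine ⟨fun k hk => (hull_bound hL h hk).1.trans (by omega),
    fun k hk => (hull_bound hL h hk).2.1.trans (by omega), fun k hk => (hull_bound hL h hk).2.2, ?_⟩
  intro e₀ he₀ e₁ he₁
  have key : ∀ p ∈ S, ∀ z : ℤ, |z| ≤ V.d →
      |cross V.φ p.1 + z| ≤ 4 * V.E ^ 2 ∧ |cross V.ψ p.1 + z| ≤ 4 * V.E ^ 2 := by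
    intro p hp z hz
    have hp' := h' p hp
    have hn := V.n_lt_E
    have h3 := V.φ1; have h4 := V.φ2; have h5 := V.ψ1; have h6 := V.ψ2
    have m : ∀ x y : ℤ, 0 ≤ x → x ≤ V.n → 0 ≤ y → y ≤ V.n → 0 ≤ x * y ∧ x * y ≤ V.E ^ 2 := by
      intro x y h1 h2 h3 h4
      refine ⟨mul_nonneg h1 h3, ?_⟩
      rw [sq]
      exact mul_le_mul (by omega) (by omega) h3 (by omega)
    have m1 := m V.φ.1 p.1.2 (by omega) (by omega) (by omega) (by omega)
    have m2 := m (-V.φ.2) p.1.1 (by omega) (by omega) (by omega) (by omega)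
    have m3 := m V.ψ.1 p.1.2 (by omega) (by omega) (by omega) (by omega)
    have m4 := m V.ψ.2 p.1.1 (by omega) (by omega) (by omega) (by omega)
    rw [neg_mul] at m2
    rw [abs_le] at hz ⊢
    rw [abs_le]
    unfold cross
    omega
  have cA : |cornerA V.φ V.ψ (V.lo S) (V.hi S) (e₀ : ℕ)| ≤ 4 * V.E ^ 2 := by
    obtain ⟨⟨-, p, hp, h2⟩, -, p', hp', h4⟩ := hull_lo hS h' (k := 0) (by norm_num)
    unfold cornerA
    interval_cases e₀
    · have := (key p hp 0 (by simp; omega)).1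
      rw [h2]
      simpa [fn, lin] using this
    · have := (key p' hp' V.d (by rw [abs_of_pos hd])).1
      rw [h4]
      simpa [fn, lin, Env.d] using this
  have cB : |cornerB V.φ V.ψ (V.lo S) (V.hi S) (e₁ : ℕ)| ≤ 4 * V.E ^ 2 := by
    obtain ⟨⟨-, p, hp, h2⟩, -, p', hp', h4⟩ := hull_lo hS h' (k := 1) (by norm_num)
    unfold cornerB
    interval_cases e₁
    · have := (key p' hp' 0 (by simp; omega)).2
      rw [h4]
      simpa [fn, lin] using this
    · have := (key p hp (-V.d) (by rw [abs_neg, abs_of_pos hd])).2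
      rw [h2]
      simpa [fn, lin, Env.d, sub_eq_add_neg] using this
  generalize cornerA V.φ V.ψ (V.lo S) (V.hi S) (e₀ : ℕ) = A at cA
  generalize cornerB V.φ V.ψ (V.lo S) (V.hi S) (e₁ : ℕ) = C at cB
  have two : ∀ x y : ℤ, |x| ≤ V.n → |y| ≤ V.n → |A * x - C * y| ≤ V.B := by
    intro x y hx hy
    have hn := V.n_lt_E
    have e1 : |A * x| ≤ 4 * V.E ^ 2 * V.E := by rw [abs_mul]; gcongr; omega
    have e2 : |C * y| ≤ 4 * V.E ^ 2 * V.E := by rw [abs_mul]; gcongr; omega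
    have e3 : 4 * V.E ^ 2 * V.E = 4 * V.E ^ 3 := by ring
    have := abs_sub (A * x) (C * y)
    omega
  have h3 := V.φ1; have h4 := V.φ2; have h5 := V.ψ1; have h6 := V.ψ2
  intro k hk
  interval_cases k
  · exact cA.trans (by omega)
  · exact cB.trans (by omega)
  · exact two _ _ (by rw [abs_le]; omega) (by rw [abs_le]; omega)
  · exact two _ _ (by rw [abs_le]; omega) (by rw [abs_le]; omega)

/-! ## The correlations -/

/-- The number of points of the strings in `Vs` with the character of `S` that are moved into `S`
by `q`. -/
def corr (Vs : List StoredStr) (S : StoredStr) (q : Pt) : ℤ :=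
  if S = [] then 0 else ((members Vs Vs.length (listChr S)).map fun i =>
    ∑ v ∈ pts (Vs.getD i []), ind (v + q ∈ pts S)).sum

/-- The number of points of `S` in the quadrant of `q`. -/
def quad (S : StoredStr) (q : Pt) : ℤ := (S.map fun p => ind (p.1.1 ≤ q.1 ∧ q.2 ≤ p.1.2)).sum

/-- Pair by pair, `sum_pairTab` evaluates the lookups as signed corner indicators, and
`correlation_diff` identifies these with the second difference. -/
lemma corr_rec {Vs Ss : List StoredStr} (hi : V.Inp Vs Ss)
    (hV : ∀ L ∈ Vs, IsTruncatedSubtile V.φ V.ψ (pts L)) {S : StoredStr} (hSm : S ∈ Ss)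
    (hS : IsSubtile V.φ V.ψ (pts S)) {q : Pt} (hq : V.InRange q) :
    ∑ t ∈ Finset.range (V.L ^ 4), V.stringTab Vs S
      (pointKey V.φ V.ψ V.O V.L V.X (cross V.φ q) (cross V.ψ q) t) =
    corr Vs S q - corr Vs S (q - V.φ) - corr Vs S (q - V.ψ) + corr Vs S (q - V.φ - V.ψ) := by
  unfold stringTab corr
  split_ifs with hS0
  · simp
  · have hpS := hi.pts S (List.mem_append_right _ hSm)
    simp only [sum_list_apply]
    rw [sum_list_sum]
    have hlist : ∀ (l : List ℕ) (f g : ℕ → ℤ) (a b c : ℕ → ℤ), (∀ i ∈ l, f i = g i - a i - b i + c i) →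
        (l.map f).sum = (l.map g).sum - (l.map a).sum - (l.map b).sum + (l.map c).sum := by
      intro l f g a b c
      induction l with
      | nil => simp
      | cons i l ih =>
        intro h
        simp only [List.map_cons, List.sum_cons]
        rw [ih fun j hj => h j (by simp [hj]), h i (by simp)]
        ring
    refine hlist _ _ _ _ _ _ fun i him => ?_
    obtain ⟨hin, hine, -⟩ := mem_members.1 him
    have hgd : Vs.getD i [] = Vs[i] := by simp [hin]
    rw [hgd] at hine ⊢
    have hLm : Vs[i] ∈ Vs := List.getElem_mem hin
    have hpL := hi.pts _ (List.mem_append_left Ss hLm)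
    have hb := pairBounds hine hS0 hpL hpS
    have h1 := V.E4_le_B
    have hE4 := V.E4_le; have hB := V.B_le; have hO := V.O_le; have hO' := V.O_le'
    have hX := V.X_le; have hE3 := V.E3_le; have hE2 := V.E2_ge
    have hL2 := V.L_lt
    have hL7 := V.two_pow_L
    have hnq : |q.1| ≤ V.n ∧ |q.2| ≤ V.n := by
      obtain ⟨⟨r1, r2⟩, r3, r4⟩ := hq
      rw [abs_le, abs_le]; omega
    have hd := V.d_pos; have hd2 := V.d_lt
    have := sum_pairTab (φ := V.φ) (ψ := V.ψ) V.d_pos (O := V.O) (X := V.X) (B := V.B) (L := V.L)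
      (by omega) (by omega) (by omega) (by omega) (by simp only [Env.d] at hd2; omega)
      (a' := cross V.φ q) (b' := cross V.ψ q)
      hb.lo_le hb.hi_le hb.le hb.corner fun k hk => (V.fn_bound hnq.1 hnq.2 hk).trans (by omega)
    rw [this]
    have h2 := correlation_diff V.d_pos hS (isHull hS0 hpS) (pts Vs[i]) (hV _ hLm)
      (isHull hine hpL) q
    rw [← h2]
    have e : ∀ (x : Pt) (inst : Decidable (x ∈ (pts S : Set Pt))),
        @ind (x ∈ (pts S : Set Pt)) inst = ind (x ∈ pts S) := fun x inst => ind_congr (by simp)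
    simp only [e]
    congr!

/-- All points lie in `[0, n)²`, so a shift carrying one of them to another has coordinates strictly
between `-n` and `n`. -/
lemma corr_zero {Vs Ss : List StoredStr} (hi : V.Inp Vs Ss) {S : StoredStr} (hSm : S ∈ Ss)
    {q : Pt} (hq : ¬ V.InRange q) : corr Vs S q = 0 := by
  unfold corr
  split_ifs with hS0
  · rfl
  · refine List.sum_eq_zero fun z hz => ?_
    obtain ⟨i, him, rfl⟩ := List.mem_map.1 hz
    obtain ⟨hin, -, -⟩ := mem_members.1 him
    have hgd : Vs.getD i [] = Vs[i] := by simp [hin]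
    rw [hgd]
    refine Finset.sum_eq_zero fun v hv => ?_
    unfold ind
    rw [if_neg]
    intro hvq
    obtain ⟨a, ha⟩ := mem_pts.1 hv
    obtain ⟨b, hb⟩ := mem_pts.1 hvq
    have h1 := hi.pts _ (List.mem_append_left Ss (List.getElem_mem hin)) _ ha
    have h2 := hi.pts _ (List.mem_append_right Vs hSm) _ hb
    simp only [Prod.fst_add, Prod.snd_add] at h1 h2
    unfold InRange at hq
    omega

/-- Inclusion–exclusion: the quadrants of the left and the upper neighbour cover the quadrant of `q`
except for `q` itself. -/
lemma quad_rec {Vs Ss : List StoredStr} (hi : V.Inp Vs Ss) {S : StoredStr} (hSm : S ∈ Ss)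
    {q : Pt} (hq : V.InRange q) :
    quad S q = V.marks S (V.pidx q) + quad S (q.1 - 1, q.2) + quad S (q.1, q.2 + 1) -
      quad S (q.1 - 1, q.2 + 1) := by
  have hp := hi.pts S (List.mem_append_right _ hSm)
  have hn := V.n_le_E2
  have hn2 := V.n_two
  unfold quad marks
  clear hSm hi
  induction S with
  | nil => simp
  | cons p S ih =>
    have := ih fun p hp' => hp p (by simp [hp'])
    simp only [List.map_cons, List.sum_cons]
    rw [this]
    have hpp := hp p (by simp)
    have e : ind (V.pidx p.1 = V.pidx q) = ind (p.1 = q) :=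
      ind_congr (V.pidx_inj (by rw [abs_lt]; omega) hq.bound.2)
    have e2 : ind (p.1 = q) = ind (p.1.1 = q.1 ∧ p.1.2 = q.2) := ind_congr Prod.ext_iff
    rw [e, e2]
    have key : ind (p.1.1 ≤ q.1 ∧ q.2 ≤ p.1.2) = ind (p.1.1 = q.1 ∧ p.1.2 = q.2) +
        ind (p.1.1 ≤ q.1 - 1 ∧ q.2 ≤ p.1.2) + ind (p.1.1 ≤ q.1 ∧ q.2 + 1 ≤ p.1.2) -
        ind (p.1.1 ≤ q.1 - 1 ∧ q.2 + 1 ≤ p.1.2) := by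
      unfold ind
      split_ifs <;> first | rfl | (exfalso; omega)
    rw [key]
    ring

lemma quad_zero {Vs Ss : List StoredStr} (hi : V.Inp Vs Ss) {S : StoredStr} (hSm : S ∈ Ss)
    {q : Pt} (hq : q.1 < -(V.n : ℤ) ∨ (V.n : ℤ) ≤ q.2) : quad S q = 0 := by
  refine List.sum_eq_zero fun z hz => ?_
  obtain ⟨p, hp, rfl⟩ := List.mem_map.1 hz
  have := hi.pts S (List.mem_append_right _ hSm) p hp
  unfold ind
  rw [if_neg (by omega)]

lemma spec {Vs Ss : List StoredStr} (hi : V.Inp Vs Ss)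
    (hV : ∀ L ∈ Vs, IsTruncatedSubtile V.φ V.ψ (pts L))
    (hS : ∀ S ∈ Ss, IsSubtile V.φ V.ψ (pts S)) {σ : St} (h15 : σ.mem 15 = V.table Vs Ss)
    (h11 : ∀ i, σ.mem 11 i = (Ss.map fun L => V.marks L i).sum) :
    V.Spec (fun q => (Ss.map fun S => corr Vs S q).sum) (fun q => (Ss.map fun S => quad S q).sum)
      σ := by
  have hlist : ∀ (l : List StoredStr) (f g a b c : StoredStr → ℤ),
      (∀ i ∈ l, f i = g i + a i + b i - c i) →
      (l.map f).sum = (l.map g).sum + (l.map a).sum + (l.map b).sum - (l.map c).sum := by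
    intro l f g a b c
    induction l with
    | nil => simp
    | cons i l ih =>
      intro h
      simp only [List.map_cons, List.sum_cons]
      rw [ih fun j hj => h j (by simp [hj]), h i (by simp)]
      ring
  constructor
  · intro q hq
    rw [h15]
    unfold table
    simp only [sum_list_apply]
    rw [sum_list_sum]
    refine hlist _ _ _ _ _ _ fun S hSm => ?_
    rw [V.corr_rec hi hV hSm (hS S hSm) hq]
    have e1 : (q.1 - V.φ.1, q.2 - V.φ.2) = q - V.φ := rfl
    have e2 : (q.1 - V.ψ.1, q.2 - V.ψ.2) = q - V.ψ := rfl
    have e3 : (q.1 - V.φ.1 - V.ψ.1, q.2 - V.φ.2 - V.ψ.2) = q - V.φ - V.ψ := rfl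
    rw [e1, e2, e3]
    ring
  · intro q hq
    refine List.sum_eq_zero fun z hz => ?_
    obtain ⟨S, hSm, rfl⟩ := List.mem_map.1 hz
    exact V.corr_zero hi hSm hq
  · intro q hq
    rw [h11]
    exact hlist _ _ _ _ _ _ fun S hSm => V.quad_rec hi hSm hq
  · intro q hq
    refine List.sum_eq_zero fun z hz => ?_
    obtain ⟨S, hSm, rfl⟩ := List.mem_map.1 hz
    exact V.quad_zero hi hSm hq

/-- The number of points of `S` in the square of side `m` at `q`. -/
def window (m : ℤ) (S : StoredStr) (q : Pt) : ℤ :=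
  (S.map fun p => ind ((q.1 ≤ p.1.1 ∧ p.1.1 < q.1 + m) ∧ q.2 ≤ p.1.2 ∧ p.1.2 < q.2 + m)).sum

/-- A square is an alternating sum of four quadrants. -/
lemma out_eq (F : Pt → ℤ) (Ss : List StoredStr) (q : Pt) :
    V.out F (fun q => (Ss.map fun S => quad S q).sum) q =
      (Ss.map fun S => window V.m S q).sum - F q := by
  have hm := V.m_pos
  have key : ∀ S : StoredStr, quad S (q.1 + V.m - 1, q.2) - quad S (q.1 - 1, q.2) -
      quad S (q.1 + V.m - 1, q.2 + V.m) + quad S (q.1 - 1, q.2 + V.m) = window V.m S q := by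
    intro S
    unfold quad window
    induction S with
    | nil => simp
    | cons p S ih =>
      simp only [List.map_cons, List.sum_cons]
      rw [← ih]
      have : ind (p.1.1 ≤ q.1 + V.m - 1 ∧ q.2 ≤ p.1.2) - ind (p.1.1 ≤ q.1 - 1 ∧ q.2 ≤ p.1.2) -
          ind (p.1.1 ≤ q.1 + V.m - 1 ∧ q.2 + V.m ≤ p.1.2) +
          ind (p.1.1 ≤ q.1 - 1 ∧ q.2 + V.m ≤ p.1.2) =
          ind ((q.1 ≤ p.1.1 ∧ p.1.1 < q.1 + V.m) ∧ q.2 ≤ p.1.2 ∧ p.1.2 < q.2 + V.m) := by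
        unfold ind
        split_ifs <;> first | rfl | (exfalso; omega)
      rw [← this]
      ring
  unfold out
  simp only
  congr 1
  induction Ss with
  | nil => simp
  | cons S Ss ih =>
    simp only [List.map_cons, List.sum_cons]
    rw [← ih, ← key S]
    ring

end Env

/-! ## Stored strings and strings -/

lemma Stores.dom_eq {L : StoredStr} {S : Str} (h : Stores L S) : dom S = pts L := by
  ext u
  simp only [dom, Set.mem_ofPred_eq, Finset.mem_coe, mem_pts, h.2]

lemma Stores.nodup_fst {L : StoredStr} {S : Str} (h : Stores L S) : (L.map Prod.fst).Nodup := by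
  refine (List.nodup_map_iff_inj_on h.1).2 fun x hx y hy hxy => ?_
  have e1 := (h.2 x.1 x.2).1 hx
  have e2 := (h.2 y.1 y.2).1 hy
  rw [hxy, e2] at e1
  exact Prod.ext hxy (Option.some.inj e1).symm

lemma Stores.card_pts {L : StoredStr} {S : Str} (h : Stores L S) : (pts L).card = L.length := by
  unfold pts
  rw [List.toFinset_card_of_nodup h.nodup_fst, List.length_map]

lemma Stores.ncard_dom {L : StoredStr} {S : Str} (h : Stores L S) :
    (dom S).ncard = L.length := by
  rw [h.dom_eq, Set.ncard_coe_finset, h.card_pts]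

lemma listChr_mem {L : StoredStr} (hL : L ≠ []) : ∃ p ∈ L, listChr L = p.2 := by
  induction L using List.reverseRecOn with
  | nil => exact absurd rfl hL
  | append_singleton L p _ => exact ⟨p, by simp, by simp [listChr]⟩

lemma Stores.listChr_eq {L : StoredStr} {S : Str} (h : Stores L S) {a : ℤ}
    (ha : MonochromaticWith S a) (hL : L ≠ []) : listChr L = a := by
  obtain ⟨p, hp, e⟩ := listChr_mem hL
  have h1 := (h.2 p.1 p.2).1 hp
  have h2 := ha p.1 ⟨_, h1⟩
  rw [h1] at h2
  rw [e, Option.some.inj h2]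

lemma sum_members {M : Type*} [AddCommMonoid M] (Vs : List StoredStr) (c : ℤ)
    (g : StoredStr → M) : ((members Vs Vs.length c).map fun i => g (Vs.getD i [])).sum =
    (Vs.map fun L => if L ≠ [] ∧ listChr L = c then g L else 0).sum := by
  have key : ∀ i ≤ Vs.length, ((members Vs i c).map fun i => g (Vs.getD i [])).sum =
      ((Vs.take i).map fun L => if L ≠ [] ∧ listChr L = c then g L else 0).sum := by
    intro i
    induction i with
    | zero => intro _; simp [members]
    | succ i ih =>
      intro hi
      have hgd : Vs.getD i [] = Vs[i] := by simp [show i < Vs.length by omega]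
      rw [members_succ, List.take_succ_eq_append_getElem (by omega), List.map_append,
        List.sum_append, ← ih (by omega), hgd, List.map_singleton, List.sum_singleton]
      split_ifs with h
      · rw [List.map_cons, List.sum_cons, hgd, add_comm]
      · rw [add_zero]
  have := key _ le_rfl
  rwa [List.take_length] at this

lemma sum_forall₂ {M : Type*} [AddCommMonoid M] {Ls : List StoredStr} {l : List Str}
    (h : List.Forall₂ Stores Ls l) {f : StoredStr → M} {g : Str → M}
    (hfg : ∀ L S, L ∈ Ls → S ∈ l → Stores L S → f L = g S) : (Ls.map f).sum = (l.map g).sum := by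
  induction h with
  | nil => rfl
  | cons h1 _ ih =>
    simp only [List.map_cons, List.sum_cons]
    rw [hfg _ _ (by simp) (by simp) h1, ih fun L S hL hS => hfg L S (by simp [hL]) (by simp [hS])]

lemma StoresFamily.sum_eq {M : Type*} [AddCommMonoid M] {Ls : List StoredStr} {F : Finset Str}
    (h : StoresFamily Ls F) {f : StoredStr → M} {g : Str → M}
    (hfg : ∀ L S, L ∈ Ls → S ∈ F → Stores L S → f L = g S) : (Ls.map f).sum = ∑ S ∈ F, g S := by
  classical
  obtain ⟨l, h1, h2, h3⟩ := h
  rw [sum_forall₂ h3 fun L S hL hS => hfg L S hL ((h2 S).1 hS), ← List.sum_toFinset _ h1]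
  congr 1
  ext S
  simp [h2]

lemma StoresFamily.exists_stores {Ls : List StoredStr} {F : Finset Str} (h : StoresFamily Ls F)
    {L : StoredStr} (hL : L ∈ Ls) : ∃ S ∈ F, Stores L S := by
  obtain ⟨l, h1, h2, h3⟩ := h
  have : ∃ S ∈ l, Stores L S := by
    clear h1 h2
    induction h3 with
    | nil => simp at hL
    | cons h _ ih =>
      rcases List.mem_cons.1 hL with rfl | hL
      · exact ⟨_, by simp, h⟩
      · obtain ⟨S, hS, h'⟩ := ih hL
        exact ⟨S, by simp [hS], h'⟩
  obtain ⟨S, hS, h'⟩ := this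
  exact ⟨S, (h2 S).1 hS, h'⟩

lemma StoresFamily.length_eq {Ls : List StoredStr} {F : Finset Str} (h : StoresFamily Ls F) :
    Ls.length = F.card := by
  have := h.sum_eq (f := fun _ => 1) (g := fun _ => 1) fun _ _ _ _ _ => rfl
  simpa using this

/-! ## The Hamming distance -/

lemma sum_ind {α : Type*} (s : Finset α) (p : α → Prop) [DecidablePred p] :
    ∑ x ∈ s, ind (p x) = (s.filter p).card := by
  unfold ind
  rw [Finset.card_filter]
  push_cast
  rfl

open Classical in
lemma window_eq {L : StoredStr} {S : Str} (h : Stores L S) (m : ℕ) (q : Pt) :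
    Env.window m L q = ((pts L).filter fun u => u - q ∈ grid m).card := by
  rw [← sum_ind, pts, List.sum_toFinset _ h.nodup_fst, List.map_map]
  unfold Env.window
  congr 1
  refine List.map_congr_left fun p _ => ind_congr ?_
  simp only [grid, Set.mem_ofPred_eq, Prod.fst_sub, Prod.snd_sub]
  constructor <;> rintro h <;> omega

open Classical in
lemma sum_ind_shift {L : StoredStr} {W : Str} (h : Stores L W) (D : Finset Pt) (q : Pt) :
    ∑ v ∈ pts L, ind (v + q ∈ D) = (D.filter fun u => u - q ∈ dom W).card := by
  rw [sum_ind]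
  congr 1
  refine Finset.card_nbij' (fun v => v + q) (fun u => u - q) ?_ ?_ ?_ ?_
  · intro v hv
    simp only [Finset.coe_filter, Set.mem_ofPred_eq] at hv ⊢
    refine ⟨hv.2, ?_⟩
    rw [add_sub_cancel_right, h.dom_eq]
    exact hv.1
  · intro u hu
    simp only [Finset.coe_filter, Set.mem_ofPred_eq] at hu ⊢
    rw [h.dom_eq] at hu
    refine ⟨hu.2, ?_⟩
    rw [sub_add_cancel]
    exact hu.1
  · intro v _; simp
  · intro u _; simp

/-- A mismatch is a point of `S` in the window where the shifted pattern does not carry `c`. The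
points where it does carry `c` are divided among the strings of the partition with character `c`. -/
lemma ham_eq {m : ℕ} {P : Str} {𝒱 : Finset Str} {chr : Str → ℤ} (hP : dom P = grid m)
    (hpart : PartitionedInto P 𝒱) (hchr : ∀ W ∈ 𝒱, MonochromaticWith W (chr W))
    {Vs : List StoredStr} (hVs : StoresFamily Vs 𝒱) {S : Str} {LS : StoredStr}
    (hS : Stores LS S) {c : ℤ} (hc : MonochromaticWith S c) (q : Pt) :
    (ham (shift P q) S : ℤ) = Env.window m LS q - Env.corr Vs LS q := by
  classical
  set D := pts LS with hD
  have h1 : ham (shift P q) S =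
      ((D.filter fun u => u - q ∈ grid m).filter fun u => ¬ P (u - q) = some c).card := by
    unfold ham
    rw [← Set.ncard_coe_finset]
    congr 1
    ext u
    simp only [mismatches, Set.mem_ofPred_eq, Finset.coe_filter, Finset.mem_filter, shift]
    constructor
    · rintro ⟨a, b, ha, hb, hab⟩
      have hu : u ∈ dom S := ⟨b, hb⟩
      have := hc u hu
      rw [hb] at this
      rw [← hP]
      refine ⟨⟨?_, a, ha⟩, ?_⟩
      · rw [hS.dom_eq] at hu; exact hu
      · rw [ha]
        intro h
        exact hab (by rw [Option.some.inj h, Option.some.inj this])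
    · rintro ⟨⟨hu, hg⟩, hne⟩
      rw [← hP] at hg
      obtain ⟨a, ha⟩ := hg
      refine ⟨a, c, ha, hc u (by rw [hS.dom_eq]; exact hu), ?_⟩
      rintro rfl
      exact hne ha
  have h2 : Env.corr Vs LS q =
      ((D.filter fun u => u - q ∈ grid m).filter fun u => P (u - q) = some c).card := by
    have h3 : ∑ W ∈ 𝒱, (if chr W = c then ((D.filter fun u => u - q ∈ dom W).card : ℤ) else 0) =
        ((D.filter fun u => u - q ∈ grid m).filter fun u => P (u - q) = some c).card := by
      rw [← Finset.sum_filter, ← Nat.cast_sum, ← Finset.card_biUnion]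
      · congr 2
        ext u
        simp only [Finset.mem_biUnion, Finset.mem_filter]
        constructor
        · rintro ⟨W, ⟨hW, hWc⟩, hu, hud⟩
          have e := hpart.2.2 W hW _ hud
          rw [hchr W hW _ hud, hWc] at e
          refine ⟨⟨hu, ?_⟩, e.symm⟩
          rw [← hP]
          exact ⟨c, e.symm⟩
        · rintro ⟨⟨hu, hg⟩, hPu⟩
          rw [← hP, ← hpart.2.1] at hg
          simp only [Set.mem_iUnion] at hg
          obtain ⟨W, hW, hud⟩ := hg
          have e := hpart.2.2 W hW _ hud
          rw [hchr W hW _ hud, hPu] at e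
          exact ⟨W, ⟨hW, Option.some.inj e⟩, hu, hud⟩
      · intro W hW W' hW' hne
        rw [Finset.coe_filter] at hW hW'
        have := hpart.1 W hW.1 W' hW'.1 hne
        rw [Function.onFun, Finset.disjoint_left]
        intro u hu hu'
        rw [Finset.mem_filter] at hu hu'
        exact Set.disjoint_left.1 this hu.2 hu'.2
    rw [← h3]
    unfold Env.corr
    split_ifs with h0
    · have : D = ∅ := by rw [hD, h0]; rfl
      simp [this]
    · have hlc := hS.listChr_eq hc h0
      rw [sum_members Vs (listChr LS) fun L => ∑ v ∈ pts L, ind (v + q ∈ pts LS), hlc]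
      refine hVs.sum_eq fun L W _ hW hLW => ?_
      rcases eq_or_ne L [] with rfl | hL
      -- An empty string may have any nominal character; it is in no list and contributes nothing on
      -- either side.
      · have hdW : dom W = ∅ := by rw [hLW.dom_eq]; simp [pts]
        simp [hdW]
      · rw [hLW.listChr_eq (hchr W hW) hL]
        simp only [ne_eq, hL, not_false_eq_true, true_and]
        rw [sum_ind_shift hLW]
  rw [window_eq hS, h2, h1,
    ← Finset.card_filter_add_card_filter_not (s := D.filter fun u => u - q ∈ grid m)
      (fun u => P (u - q) = some c)]
  push_cast
  ring

/-! ## Counting -/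

/-- Disjoint nonempty strings use up distinct grid points; the extra 1 allows for the empty string,
which can occur once. -/
lemma family_bound {n : ℕ} {F : Finset Str}
    (hd : ∀ S ∈ F, ∀ S' ∈ F, S ≠ S' → Disjoint (dom S) (dom S')) (hn : ∀ S ∈ F, dom S ⊆ grid n) :
    ∑ S ∈ F, (dom S).ncard ≤ n ^ 2 ∧ F.card ≤ n ^ 2 + 1 := by
  classical
  have hgrid : grid n = ((Finset.Ico (0 : ℤ) n ×ˢ Finset.Ico (0 : ℤ) n : Finset Pt) : Set Pt) := by
    ext u
    simp [grid, and_assoc]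
  set G : Finset Pt := Finset.Ico (0 : ℤ) n ×ˢ Finset.Ico (0 : ℤ) n with hG
  have hGc : G.card = n ^ 2 := by rw [hG, Finset.card_product]; simp [sq]
  have hfin : ∀ S ∈ F, (dom S).ncard = (G.filter fun u => u ∈ dom S).card := by
    intro S hS
    rw [← Set.ncard_coe_finset]
    congr 1
    ext u
    simp only [Finset.coe_filter, Set.mem_ofPred_eq]
    refine ⟨fun h => ⟨?_, h⟩, fun h => h.2⟩
    have := hn S hS h
    rw [hgrid] at this
    exact this
  have hsum : ∑ S ∈ F, (dom S).ncard ≤ n ^ 2 := by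
    rw [Finset.sum_congr rfl hfin, ← Finset.card_biUnion, ← hGc]
    · refine Finset.card_le_card fun u hu => ?_
      simp only [Finset.mem_biUnion, Finset.mem_filter] at hu
      obtain ⟨_, _, h, _⟩ := hu
      exact h
    · intro S hS S' hS' hne
      rw [Function.onFun, Finset.disjoint_left]
      intro u hu hu'
      rw [Finset.mem_filter] at hu hu'
      exact Set.disjoint_left.1 (hd S hS S' hS' hne) hu.2 hu'.2
  refine ⟨hsum, ?_⟩
  have h1 : (F.erase fun _ => none).card ≤ ∑ S ∈ F.erase fun _ => none, (dom S).ncard := by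
    rw [Finset.card_eq_sum_ones]
    refine Finset.sum_le_sum fun S hS => ?_
    rw [Finset.mem_erase] at hS
    rw [Nat.one_le_iff_ne_zero, hfin S hS.2]
    intro h0
    apply hS.1
    funext u
    by_contra hu
    obtain ⟨a, ha⟩ := Option.ne_none_iff_exists'.1 hu
    have hud : u ∈ dom S := ⟨a, ha⟩
    have : u ∈ G.filter fun u => u ∈ dom S := by
      rw [Finset.mem_filter]
      have := hn S hS.2 hud
      rw [hgrid] at this
      exact ⟨this, hud⟩
    rw [Finset.card_eq_zero] at h0
    rw [h0] at this
    simp at this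
  have h2 : ∑ S ∈ F.erase fun _ => none, (dom S).ncard ≤ ∑ S ∈ F, (dom S).ncard :=
    Finset.sum_le_sum_of_subset (Finset.erase_subset _ _)
  have h3 := Finset.pred_card_le_card_erase (s := F) (a := fun _ => none)
  omega

lemma StoresFamily.sum_length {n : ℕ} {F : Finset Str} {Ls : List StoredStr}
    (h : StoresFamily Ls F)
    (hd : ∀ S ∈ F, ∀ S' ∈ F, S ≠ S' → Disjoint (dom S) (dom S')) (hn : ∀ S ∈ F, dom S ⊆ grid n) :
    (Ls.map List.length).sum ≤ n ^ 2 ∧ Ls.length ≤ n ^ 2 + 1 := by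
  obtain ⟨h1, h2⟩ := family_bound hd hn
  rw [h.length_eq, h.sum_eq (g := fun S => (dom S).ncard) fun L S _ _ hs => hs.ncard_dom.symm]
  exact ⟨h1, h2⟩

/-- Equality can fail only through the empty string, which `chr` may assign to `c` although it
enters no list. -/
lemma length_members_le {Vs : List StoredStr} {𝒱 : Finset Str} (hVs : StoresFamily Vs 𝒱)
    {chr : Str → ℤ} (hchr : ∀ W ∈ 𝒱, MonochromaticWith W (chr W)) (c : ℤ) :
    (members Vs Vs.length c).length ≤ (withChar 𝒱 chr c).ncard := by
  classical
  have h1 := sum_members Vs c fun _ => (1 : ℕ)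
  rw [List.map_const', List.sum_replicate, smul_eq_mul, mul_one] at h1
  have h2 : withChar 𝒱 chr c = ((𝒱.filter fun W => chr W = c : Finset Str) : Set Str) := by
    ext W; simp [withChar]
  rw [h1, h2, Set.ncard_coe_finset, Finset.card_filter,
    hVs.sum_eq (g := fun W => if (dom W).Nonempty ∧ chr W = c then 1 else 0)]
  · refine Finset.sum_le_sum fun W _ => ?_
    split_ifs with a b b
    · exact le_rfl
    · exact absurd a.2 b
    · simp
    · exact le_rfl
  · intro L W _ hW hLW
    refine if_congr ?_ rfl rfl
    have e : L ≠ [] ↔ (dom W).Nonempty := by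
      rw [hLW.dom_eq, Finset.coe_nonempty, ← Finset.card_pos, hLW.card_pts,
        List.length_pos_iff]
    rw [← e]
    refine and_congr_right fun hL => ?_
    rw [hLW.listChr_eq (hchr W hW) hL]

/-! ## The memory layout -/

lemma dvd_of_ofInt_eq {w : ℕ} {a b : ℤ} (h : BitVec.ofInt w a = BitVec.ofInt w b) :
    (2 : ℤ) ^ w ∣ a - b := by
  have h1 := congrArg BitVec.toNat h
  rw [BitVec.toNat_ofInt, BitVec.toNat_ofInt] at h1
  have hp : (0 : ℤ) < 2 ^ w := by positivity
  have m1 := Int.emod_nonneg a hp.ne'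
  have m2 := Int.emod_nonneg b hp.ne'
  push_cast at h1
  exact Int.ModEq.dvd (show b % 2 ^ w = a % 2 ^ w by omega)

lemma eq_of_dvd_of_lt {W a b : ℤ} (h : W ∣ a - b) (h1 : a - b < W) (h2 : b - a < W) : a = b := by
  have := Int.eq_zero_of_abs_lt_dvd h (by rw [abs_lt]; omega)
  omega

/-- The usable cells. -/
def cells (X : ℤ) (all : List StoredStr) (k : ℕ) (i : ℤ) : Prop :=
  (k = 0 ∧ 0 ≤ i ∧ i < X) ∨ ((1 ≤ k ∧ k ≤ 31) ∧ 0 ≤ i ∧ i < X ^ 10) ∨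
    (k = 32 ∧ ∃ L ∈ all, L ≠ [] ∧ i = listChr L)

/-- With `M = X ^ 11`, arrays 0 to 31 occupy addresses strictly between `-M` and `M`: the input on
the nonnegative side, the others interleaved modulo 32 on the negative side. Rotated characters
avoid this region, and distinct characters stay distinct as words. -/
lemma addr_inj {w : ℕ} {X roff : ℤ} {all : List StoredStr} (hX : 32 ≤ X)
    (hw : (all.length + 1) * (2 * X ^ 11) ≤ 2 ^ w)
    (hroff : roff = freeOffset w (X ^ 11) all (all.length + 1))
    (hfit : ∀ L ∈ all, L ≠ [] → FitsWord w (listChr L)) (hwp : 0 < w) {k k' : ℕ} {i i' : ℤ}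
    (h : cells X all k i) (h' : cells X all k' i')
    (he : BitVec.ofInt w (addr roff k i) = BitVec.ofInt w (addr roff k' i')) :
    k = k' ∧ i = i' := by
  obtain ⟨r, hr, hfree, hro⟩ := freeOffset_spec (w := w) (M := X ^ 11) (all := all)
  rw [← hroff] at hro
  have hX11 : X ^ 11 = X * X ^ 10 := by ring
  have hX10 : X ≤ X ^ 10 := le_self_pow₀ (by omega) (by norm_num)
  have hXM : X ≤ X ^ 11 := le_self_pow₀ (by omega) (by norm_num)
  have h32 : 32 * X ^ 10 ≤ X ^ 11 := by rw [hX11]; exact mul_le_mul_of_nonneg_right hX (by omega)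
  set M := X ^ 11 with hM
  have hW : (1 : ℤ) * (2 * M) ≤ 2 ^ w := le_trans (mul_le_mul_of_nonneg_right (by omega)
    (by omega)) hw
  have hd := dvd_of_ofInt_eq he
  have hz : ∀ (k : ℕ) (i : ℤ), (k = 0 ∧ 0 ≤ i ∧ i < X) ∨ ((1 ≤ k ∧ k ≤ 31) ∧ 0 ≤ i ∧ i < X ^ 10) →
      -M < addr roff k i ∧ addr roff k i < M := by
    rintro k i (⟨rfl, h1, h2⟩ | ⟨⟨h1, h2⟩, h3, h4⟩)
    · unfold addr; rw [if_pos rfl]; omega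
    · unfold addr; rw [if_neg (by omega), if_neg (by omega)]; omega
  -- A character rotated into the region would lie in block `r` before the rotation, but that block
  -- is free. The added `M` in `block` centres the blocks so that the region is one whole block.
  have mix : ∀ L ∈ all, L ≠ [] → ∀ z : ℤ, -M < z → z < M →
      ¬ (2 : ℤ) ^ w ∣ addr roff 32 (listChr L) - z := by
    intro L hL hne z hz1 hz2 hdvd
    refine hfree L hL ?_
    have e1 : addr roff 32 (listChr L) = listChr L - r * (2 * M) := by
      unfold addr; rw [if_neg (by norm_num), if_pos rfl, hro]
    rw [e1] at hdvd
    have hr2 : (r : ℤ) * (2 * M) + 2 * M ≤ 2 ^ w := by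
      refine le_trans ?_ hw
      have : ((r : ℤ) + 1) * (2 * M) ≤ (all.length + 1) * (2 * M) :=
        mul_le_mul_of_nonneg_right (by omega) (by omega)
      linarith
    have hr0 : 0 ≤ (r : ℤ) * (2 * M) := mul_nonneg (by omega) (by omega)
    have e2 : (listChr L + M) % 2 ^ w = r * (2 * M) + (z + M) := by
      have : (listChr L + M) % 2 ^ w = (r * (2 * M) + (z + M)) % 2 ^ w := by
        refine Int.emod_eq_emod_iff_emod_sub_eq_zero.2 (Int.emod_eq_zero_of_dvd ?_)
        convert hdvd using 1
        ring
      rw [this, Int.emod_eq_of_lt (by omega) (by omega)]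
    unfold block
    rw [e2, add_comm, Int.add_mul_ediv_right _ _ (by omega),
      Int.ediv_eq_zero_of_lt (by omega) (by omega), zero_add, Int.emod_eq_of_lt (by omega) (by omega)]
  rcases h with h | h | ⟨rfl, L, hL, hne, rfl⟩ <;> rcases h' with h' | h' | ⟨rfl, L', hL', hne', rfl⟩
  · have b := hz k i (Or.inl h)
    have b' := hz k' i' (Or.inl h')
    have := eq_of_dvd_of_lt hd (by omega) (by omega)
    obtain ⟨rfl, -⟩ := h
    obtain ⟨rfl, -⟩ := h'
    exact ⟨rfl, by simpa [addr] using this⟩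
  · have b := hz k i (Or.inl h)
    have b' := hz k' i' (Or.inr h')
    have := eq_of_dvd_of_lt hd (by omega) (by omega)
    unfold addr at this
    rw [if_pos h.1, if_neg (by omega), if_neg (by omega)] at this
    omega
  · have b := hz k i (Or.inl h)
    exact absurd ((dvd_neg.2 hd).trans (by rw [neg_sub])) (mix L' hL' hne' _ b.1 b.2)
  · have b := hz k i (Or.inr h)
    have b' := hz k' i' (Or.inl h')
    have := eq_of_dvd_of_lt hd (by omega) (by omega)
    unfold addr at this
    rw [if_pos h'.1, if_neg (by omega), if_neg (by omega)] at this
    omega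
  · have b := hz k i (Or.inr h)
    have b' := hz k' i' (Or.inr h')
    have := eq_of_dvd_of_lt hd (by omega) (by omega)
    unfold addr at this
    rw [if_neg (by omega), if_neg (by omega), if_neg (by omega), if_neg (by omega)] at this
    omega
  · have b := hz k i (Or.inr h)
    exact absurd ((dvd_neg.2 hd).trans (by rw [neg_sub])) (mix L' hL' hne' _ b.1 b.2)
  · have b := hz k' i' (Or.inl h')
    exact absurd hd (mix L hL hne _ b.1 b.2)
  · have b := hz k' i' (Or.inr h')
    exact absurd hd (mix L hL hne _ b.1 b.2)
  · refine ⟨rfl, ?_⟩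
    have e : ∀ c : ℤ, addr roff 32 c = c - roff := fun c => by simp [addr]
    rw [e, e, sub_sub_sub_cancel_right] at hd
    have f := hfit L hL hne
    have f' := hfit L' hL' hne'
    unfold FitsWord at f f'
    have hw2 : (2 : ℤ) ^ w = 2 * 2 ^ (w - 1) := by rw [← pow_succ']; congr 1; omega
    exact eq_of_dvd_of_lt hd (by omega) (by omega)

/-! ## The start state -/

lemma length_encodeFamily (Ls : List StoredStr) :
    (encodeFamily Ls).length = 3 * (Ls.map List.length).sum + Ls.length + 1 := by
  unfold encodeFamily
  rw [List.length_cons, List.length_flatMap]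
  congr 1
  induction Ls with
  | nil => rfl
  | cons L Ls ih =>
    rw [List.map_cons, List.sum_cons, ih, Env.length_encodeStr, List.map_cons, List.sum_cons,
      List.length_cons]
    ring

lemma length_encodePoints (Qs : List Pt) : (encodePoints Qs).length = 2 * Qs.length + 1 := by
  unfold encodePoints
  rw [List.length_cons, List.length_flatMap]
  simp [mul_comm]

lemma seg_of_getElem {raw : ℤ → ℤ} : ∀ {l : List ℤ} {p : ℤ},
    (∀ (i : ℕ) (hi : i < l.length), raw (p + i) = l[i]) → Seg raw p l
  | [], _, _ => trivial
  | z :: l, p, h => by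
    refine ⟨by rw [← add_zero p]; exact h 0 (by simp), seg_of_getElem fun i hi => ?_⟩
    have := h (i + 1) (by simpa using hi)
    rw [List.getElem_cons_succ] at this
    rw [← this]
    congr 1
    push_cast
    ring

/-- The abstract start state. -/
def startSt (input : List ℤ) : St where
  var _ := 0
  mem k i := if k = 0 then input.getD i.toNat 0 else 0
  time := 0

lemma seg_startSt (input : List ℤ) : Seg ((startSt input).mem 0) 0 input :=
  seg_of_getElem fun i hi => by simp [startSt, hi]

/-- Usable cells outside array 0 start at zero: an address inside the input belongs to array 0 as
well, which injectivity forbids. -/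
lemma rel_startSt {Λ : Layout} {input : List ℤ}
    (h0 : ∀ i : ℤ, Λ.ok 0 i → 0 ≤ i ∧ i < 2 ^ Λ.w)
    (h0' : ∀ i : ℤ, 0 ≤ i → i < input.length → Λ.ok 0 i) :
    Rel Λ (startSt input) (startState Λ.w input) := by
  refine ⟨fun r => by simp [startState, startSt], fun k i hk => ?_⟩
  by_cases hk0 : k = 0
  · subst hk0
    obtain ⟨h1, h2⟩ := h0 i hk
    simp only [startState, startSt, addr, if_true]
    rw [toNat_ofInt_nonneg h1 h2]
  · simp only [startState, startSt, if_neg hk0]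
    congr 1
    refine List.getD_eq_default _ _ ?_
    by_contra! hlt
    set a := BitVec.ofInt Λ.w (addr Λ.roff k i) with ha
    have hok := h0' a.toNat (by omega) (by exact_mod_cast hlt)
    have : BitVec.ofInt Λ.w (addr Λ.roff 0 a.toNat) = BitVec.ofInt Λ.w (addr Λ.roff k i) := by
      rw [← ha]
      unfold addr
      rw [if_pos rfl, BitVec.ofInt_natCast, BitVec.ofNat_toNat, BitVec.setWidth_eq]
    exact hk0 (Λ.inj _ _ _ _ hok hk this).1.symm

/-! ## Consequences of the setting -/

section
variable {m n : ℕ} {P T : Str} {Q : Finset Pt} {φ ψ : Pt} {𝒱 : Finset Str} {chr : Str → ℤ}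

lemma Setting.lt (h : Setting m n P T Q φ ψ 𝒱 chr) : m < n := by
  have h1 := h.ψ_quadrant.1
  have h2 := h.ψ_small.1
  rw [abs_of_pos h1] at h2
  omega

lemma Setting.dom_subset (h : Setting m n P T Q φ ψ 𝒱 chr) {W : Str} (hW : W ∈ 𝒱) :
    dom W ⊆ grid n := by
  have h1 : dom W ⊆ grid m := by
    rw [← h.dom_P, ← h.partition.2.1]
    exact Set.subset_biUnion_of_mem (u := fun R => dom R) hW
  intro u hu
  have h2 := h1 hu
  have h3 := h.m_le_n
  simp only [grid, Set.mem_ofPred_eq] at h2 ⊢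
  omega

lemma Setting.shift_bounds (h : Setting m n P T Q φ ψ 𝒱 chr) {q : Pt} (hq : q ∈ Q) :
    (0 ≤ q.1 ∧ q.1 + m ≤ n) ∧ 0 ≤ q.2 ∧ q.2 + m ≤ n := by
  have key : ∀ u ∈ grid m, u + q ∈ grid n := by
    intro u hu
    rw [← h.dom_T]
    refine h.shifts q hq ?_
    rw [← h.dom_P] at hu
    obtain ⟨a, ha⟩ := hu
    exact ⟨a, by rw [shift, add_sub_cancel_right]; exact ha⟩
  have hm := h.m_pos
  -- Two opposite corners of the pattern give all four inequalities.
  have h1 := key (0, 0) (by simp only [grid, Set.mem_ofPred_eq]; omega)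
  have h2 := key (m - 1, m - 1) (by simp only [grid, Set.mem_ofPred_eq]; omega)
  simp only [grid, Set.mem_ofPred_eq, Prod.fst_add, Prod.snd_add] at h1 h2
  omega

lemma Setting.length_shifts (h : Setting m n P T Q φ ψ 𝒱 chr) {Qs : List Pt}
    (hQ : StoresPoints Qs Q) : Qs.length ≤ n ^ 2 := by
  rw [← List.toFinset_card_of_nodup hQ.1]
  refine (Finset.card_le_card (t := Finset.Ico (0 : ℤ) n ×ˢ Finset.Ico (0 : ℤ) n) ?_).trans ?_
  · intro q hq
    have := h.shift_bounds ((hQ.2 q).1 (List.mem_toFinset.1 hq))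
    have := h.m_pos
    simp only [Finset.mem_product, Finset.mem_Ico]
    omega
  · rw [Finset.card_product]; simp [sq]

end

lemma sum_map_sub {α : Type*} (l : List α) (f g : α → ℤ) :
    (l.map fun x => f x - g x).sum = (l.map f).sum - (l.map g).sum := by
  induction l with
  | nil => rfl
  | cons x l ih =>
    simp only [List.map_cons, List.sum_cons, ih]
    ring

lemma finite_grid (n : ℕ) : (grid n).Finite :=
  ((Finset.Ico (0 : ℤ) n ×ˢ Finset.Ico (0 : ℤ) n).finite_toSet).subset fun u hu => by
    obtain ⟨h1, h2, h3, h4⟩ := hu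
    simp [h1, h2, h3, h4]

lemma ham_le_ncard {R S : Str} (h : (dom S).Finite) : ham R S ≤ (dom S).ncard :=
  Set.ncard_le_ncard (fun _ ⟨_, b, _, hb, _⟩ => ⟨b, hb⟩) h

/-! ## The running time -/

lemma StoresFamily.mem_length_le {Ls : List StoredStr} {n : ℕ} (h : (Ls.map List.length).sum ≤ n)
    {L : StoredStr} (hL : L ∈ Ls) : L.length ≤ n :=
  (List.single_le_sum (by simp) _ (List.mem_map_of_mem hL)).trans h

lemma sum_stringTime_le (V : Env) {Vs Ss : List StoredStr} {𝒱 𝒮 : Finset Str}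
    (hVs : StoresFamily Vs 𝒱) (hSs : StoresFamily Ss 𝒮) {chr : Str → ℤ}
    (hV : ∀ W ∈ 𝒱, MonochromaticWith W (chr W)) (hS : ∀ W ∈ 𝒮, MonochromaticWith W (chr W)) :
    (Ss.map (V.stringTime Vs)).sum ≤
      (∑ S ∈ 𝒮, (withChar 𝒱 chr (chr S)).ncard) * V.pairTime := by
  classical
  set f : StoredStr → ℕ := fun L => if L = [] then 0 else
    (withChar 𝒱 chr (listChr L)).ncard * V.pairTime with hf
  have h1 : (Ss.map (V.stringTime Vs)).sum ≤ (Ss.map f).sum := by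
    refine List.sum_le_sum fun L _ => ?_
    unfold Env.stringTime
    simp only [hf]
    split_ifs
    · exact le_rfl
    · exact Nat.mul_le_mul_right _ (length_members_le hVs hV _)
  have h2 := hSs.sum_eq (f := f) (g := fun S => if dom S = ∅ then 0 else
    (withChar 𝒱 chr (chr S)).ncard * V.pairTime) fun L S _ hSm hLS => by
      simp only [hf]
      by_cases hL : L = []
      · rw [if_pos hL, if_pos (by rw [hLS.dom_eq, hL]; simp [pts])]
      · have hd : dom S ≠ ∅ := fun h => hL (List.length_eq_zero_iff.1 (by
          rw [← hLS.ncard_dom, h, Set.ncard_empty]))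
        rw [if_neg hL, if_neg hd, hLS.listChr_eq (hS S hSm) hL]
  rw [h2] at h1
  refine h1.trans ?_
  rw [Finset.sum_mul]
  refine Finset.sum_le_sum fun S _ => ?_
  split_ifs
  · exact Nat.zero_le _
  · exact le_rfl

lemma famTime_eq (Ls : List StoredStr) :
    Env.famTime Ls = 700 * (Ls.map List.length).sum + 200 * Ls.length := by
  unfold Env.famTime
  induction Ls with
  | nil => rfl
  | cons L Ls ih =>
    simp only [List.map_cons, List.sum_cons, List.length_cons, ih]
    ring

/-- The lists and the sweep cost at most a constant times `n ^ 2 * ℓ ^ 4`, and `4 * n ^ 2 ≤ 9 * m ^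
2`. A pair costs about `605 * 64 * L ^ 4` with `L ^ 4 = 2401 * ℓ ^ 4`, which is just below `10 ^ 8 *
ℓ ^ 4`. -/
lemma totalTime_le (V : Env) {Vs Ss : List StoredStr} {Qs : List Pt} {s : ℕ}
    (hn : 2 * V.n ≤ 3 * V.m)
    (hV : (Vs.map List.length).sum ≤ V.n ^ 2 ∧ Vs.length ≤ V.n ^ 2 + 1)
    (hS : (Ss.map List.length).sum ≤ V.n ^ 2 ∧ Ss.length ≤ V.n ^ 2 + 1)
    (hQ : Qs.length ≤ V.n ^ 2) (hs : (Ss.map (V.stringTime Vs)).sum ≤ s * V.pairTime) :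
    V.totalTime Vs Ss Qs ≤ 10 ^ 8 * (V.m ^ 2 + s) * V.ℓ ^ 4 := by
  have hl : 1 ≤ V.ℓ ^ 4 := Nat.one_le_pow _ _ (by rw [V.ℓ_eq]; omega)
  have hm : 1 ≤ V.m ^ 2 := Nat.one_le_pow _ _ V.m_pos
  have hm2 : 4 * V.n ^ 2 ≤ 9 * V.m ^ 2 := by
    have := Nat.pow_le_pow_left hn 2
    rw [mul_pow, mul_pow] at this
    omega
  have hnn : V.n ≤ V.n ^ 2 := Nat.le_self_pow (by norm_num) _
  have hL4 : V.L ^ 4 = 2401 * V.ℓ ^ 4 := by unfold Env.L; rw [mul_pow]; norm_num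
  have hp : V.pairTime ≤ 10 ^ 8 * V.ℓ ^ 4 := by
    unfold Env.pairTime pairCount
    rw [mul_pow, hL4]
    omega
  have h1 : s * V.pairTime ≤ 10 ^ 8 * s * V.ℓ ^ 4 := by
    calc s * V.pairTime ≤ s * (10 ^ 8 * V.ℓ ^ 4) := Nat.mul_le_mul_left _ hp
      _ = _ := by ring
  have h2 : (305 * V.L ^ 4 + 600) * (2 * V.n * (2 * V.n)) ≤ 9000000 * (V.m ^ 2 * V.ℓ ^ 4) := by
    rw [hL4]
    calc _ ≤ (1000000 * V.ℓ ^ 4) * (9 * V.m ^ 2) := by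
          refine Nat.mul_le_mul (by omega) ?_
          rw [show 2 * V.n * (2 * V.n) = 4 * V.n ^ 2 by ring]
          exact hm2
      _ = _ := by ring
  have h3 : V.m ^ 2 ≤ V.m ^ 2 * V.ℓ ^ 4 := Nat.le_mul_of_pos_right _ hl
  unfold Env.totalTime
  rw [famTime_eq, famTime_eq, List.length_append,
    show 10 ^ 8 * (V.m ^ 2 + s) * V.ℓ ^ 4 = 10 ^ 8 * (V.m ^ 2 * V.ℓ ^ 4) + 10 ^ 8 * s * V.ℓ ^ 4 by
      ring]
  omega

end HamTwoD

/-! ### Assembling the theorem. -/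

open HamTwoD
theorem mainTheorem5 :
    ∃ (prog : Prog) (K C c : ℕ),
      ∀ (m n : ℕ) (P T : Str) (Q : Finset Pt) (φ ψ : Pt) (𝒱 : Finset Str) (chr : Str → ℤ)
        (𝒮 : Finset Str),
        Setting m n P T Q φ ψ 𝒱 chr →
        (∀ S ∈ 𝒮, IsSubtile φ ψ (dom S)) →
        (∀ S ∈ 𝒮, MonochromaticWith S (chr S)) →
        (∀ S ∈ 𝒮, dom S ⊆ dom T) →
        (∀ S ∈ 𝒮, ∀ S' ∈ 𝒮, S ≠ S' → Disjoint (dom S) (dom S')) →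
        ∀ (w : ℕ), K * (Nat.log 2 n + 1) ≤ w →
        (∀ V ∈ 𝒱, FitsWord w (chr V)) →
        (∀ S ∈ 𝒮, FitsWord w (chr S)) →
        ∀ (Vs Ss : List StoredStr) (Qs : List Pt),
        StoresFamily Vs 𝒱 → StoresFamily Ss 𝒮 → StoresPoints Qs Q →
        ∃ (t : ℕ) (σ : State w),
          Exec prog (startState w (encodeInput m n φ ψ Vs Ss Qs)) t σ ∧
          t ≤ C * (m ^ 2 + ∑ S ∈ 𝒮, (withChar 𝒱 chr (chr S)).ncard) * (Nat.log 2 n + 1) ^ c ∧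
          ∀ (i : ℕ) (hi : i < Qs.length),
            (σ.mem (BitVec.ofNat w i)).toNat = ∑ S ∈ 𝒮, ham (shift P Qs[i]) S := by
  -- The number `X ^ 13 = 2 ^ (104 * ℓ)` has to be at most `2 ^ (w - 1)`, whence 105. The exponent 4
  -- is the number of functionals.
  refine ⟨mainP.comp 0, 105, 10 ^ 8, 4, ?_⟩
  intro m n P T Q φ ψ 𝒱 chr 𝒮 hset hsub hmono hdomS hdisj w hw hfitV hfitS Vs Ss Qs hVs hSs hQs
  have hlt := hset.lt
  have hm1 := hset.m_pos
  have hgridS : ∀ S ∈ 𝒮, dom S ⊆ grid n := fun S hS => hset.dom_T ▸ hdomS S hS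
  obtain ⟨hV1, hV2⟩ := hVs.sum_length hset.partition.1 fun W hW => hset.dom_subset hW
  obtain ⟨hS1, hS2⟩ := hSs.sum_length hdisj hgridS
  have hQ1 := hset.length_shifts hQs
  set ℓ := Nat.log 2 n + 1 with hℓ
  have hnℓ : n < 2 ^ ℓ := Nat.lt_pow_succ_log_self (by norm_num) n
  have hℓ2 : 2 ≤ ℓ := by
    have : 1 ≤ Nat.log 2 n := Nat.log_pos (by norm_num) (by omega)
    omega
  set E : ℤ := 2 ^ ℓ with hE
  have hE4 : 4 ≤ E := by
    rw [hE]
    calc (4 : ℤ) = 2 ^ 2 := by norm_num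
      _ ≤ 2 ^ ℓ := pow_le_pow_right₀ (by norm_num) hℓ2
  have hnE : (n : ℤ) < E := by rw [hE]; exact_mod_cast hnℓ
  set X : ℤ := E ^ 8 with hX
  have hnX : 10 * (n : ℤ) ^ 2 + 20 < X := by
    have h1 : (n : ℤ) ^ 2 ≤ E ^ 2 := pow_le_pow_left₀ (by omega) hnE.le 2
    have h2 : (16 : ℤ) ≤ E ^ 2 := by
      calc (16 : ℤ) = 4 ^ 2 := by norm_num
        _ ≤ E ^ 2 := pow_le_pow_left₀ (by norm_num) hE4 2
    have h3 : (4096 : ℤ) ≤ E ^ 6 := by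
      calc (4096 : ℤ) = 4 ^ 6 := by norm_num
        _ ≤ E ^ 6 := pow_le_pow_left₀ (by norm_num) hE4 6
    have h4 : 4096 * E ^ 2 ≤ X := by
      rw [hX, show E ^ 8 = E ^ 6 * E ^ 2 by ring]
      exact mul_le_mul_of_nonneg_right h3 (by omega)
    omega
  have hX32 : 32 ≤ X := by
    have := sq_nonneg (n : ℤ)
    have h8 := pow_le_pow_left₀ (by norm_num) hE4 8
    omega
  have hhalf : X ^ 13 ≤ 2 ^ (w - 1) := by
    rw [hX, hE, ← pow_mul, ← pow_mul]
    exact pow_le_pow_right₀ (by norm_num) (by omega)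
  have hwpos : 0 < w := by omega
  have hXhalf : X ≤ 2 ^ (w - 1) := (le_self_pow₀ (by omega) (by norm_num)).trans hhalf
  have hXw : X ≤ 2 ^ w := hXhalf.trans (pow_le_pow_right₀ (by norm_num) (by omega))
  set all := Vs ++ Ss with hall
  have hlen : (all.length : ℤ) ≤ 2 * n ^ 2 + 2 := by
    rw [hall, List.length_append]
    push_cast
    have : (Vs.length : ℤ) ≤ n ^ 2 + 1 := by exact_mod_cast hV2
    have : (Ss.length : ℤ) ≤ n ^ 2 + 1 := by exact_mod_cast hS2
    omega
  have hfit : ∀ L ∈ all, L ≠ [] → FitsWord w (listChr L) := by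
    intro L hL hne
    rcases List.mem_append.1 hL with hL | hL
    · obtain ⟨W, hW, hLW⟩ := hVs.exists_stores hL
      rw [hLW.listChr_eq (hset.chars W hW) hne]
      exact hfitV W hW
    · obtain ⟨W, hW, hLW⟩ := hSs.exists_stores hL
      rw [hLW.listChr_eq (hmono W hW) hne]
      exact hfitS W hW
  have hblocks : ((all.length : ℤ) + 1) * (2 * X ^ 11) ≤ 2 ^ w := by
    have h1 : (2 : ℤ) * (all.length + 1) ≤ X := by omega
    calc ((all.length : ℤ) + 1) * (2 * X ^ 11) = 2 * (all.length + 1) * X ^ 11 := by ring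
      _ ≤ X * X ^ 11 := mul_le_mul_of_nonneg_right h1 (pow_nonneg (by omega) _)
      _ = X ^ 12 := by ring
      _ ≤ X ^ 13 := pow_le_pow_right₀ (by omega) (by norm_num)
      _ ≤ 2 ^ (w - 1) := hhalf
      _ ≤ 2 ^ w := pow_le_pow_right₀ (by norm_num) (by omega)
  -- The layout is determined by the data before the run; the program recomputes the same offset.
  let Λ : Layout :=
    { w := w
      ok := cells X all
      roff := freeOffset w (X ^ 11) all (all.length + 1)
      wpos := hwpos
      inj := fun k i k' i' h h' he => addr_inj (by omega) hblocks rfl hfit hwpos h h' he }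
  have hφ := hset.φ_small
  have hψ := hset.ψ_small
  rw [abs_le, abs_le] at hφ hψ
  have hφq := hset.φ_quadrant
  have hψq := hset.ψ_quadrant
  let V : Env :=
    { Λ := Λ, m := m, n := n, ℓ := ℓ, φ := φ, ψ := ψ
      m_pos := hm1, m_le := hlt.le, n_two := by omega, n_lt := hnℓ, ℓ_eq := rfl
      φ1 := by omega
      φ2 := by omega
      ψ1 := by omega
      ψ2 := by omega
      ok := fun k i h1 h2 h3 h4 => Or.inr (Or.inl ⟨⟨h1, h2⟩, h3, h4⟩)
      ok0 := fun i h1 h2 => Or.inl ⟨rfl, h1, h2⟩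
      half := hhalf }
  have hlengths : ∀ L ∈ all, (L.length : ℤ) ≤ n ^ 2 := by
    intro L hL
    rcases List.mem_append.1 hL with hL | hL
    · exact_mod_cast StoresFamily.mem_length_le hV1 hL
    · exact_mod_cast StoresFamily.mem_length_le hS1 hL
  have hin : ((encodeInput m n φ ψ Vs Ss Qs).length : ℤ) < X := by
    have : (encodeInput m n φ ψ Vs Ss Qs).length ≤ 10 * n ^ 2 + 11 := by
      unfold encodeInput
      simp only [List.length_append, length_encodeFamily, length_encodePoints, List.length_cons,
        List.length_nil]
      omega
    have h2 : ((encodeInput m n φ ψ Vs Ss Qs).length : ℤ) ≤ 10 * (n : ℤ) ^ 2 + 11 := by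
      exact_mod_cast this
    omega
  have hdomV : ∀ L ∈ Vs, ∃ W ∈ 𝒱, dom W = pts L := fun L hL => by
    obtain ⟨W, hW, hLW⟩ := hVs.exists_stores hL
    exact ⟨W, hW, hLW.dom_eq⟩
  have hdomSs : ∀ L ∈ Ss, ∃ W ∈ 𝒮, dom W = pts L := fun L hL => by
    obtain ⟨W, hW, hLW⟩ := hSs.exists_stores hL
    exact ⟨W, hW, hLW.dom_eq⟩
  have hi : V.Inp Vs Ss := by
    refine ⟨?_, fun L hL => ?_, fun L hL p hp => ?_, fun L hL hne => ?_⟩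
    · show (all.length : ℤ) + 1 < X
      omega
    · show (L.length : ℤ) < X
      have := hlengths L hL
      omega
    · have hp' : p.1 ∈ (pts L : Set Pt) := Finset.mem_coe.2 (mem_pts.2 ⟨p.2, hp⟩)
      have hg : p.1 ∈ grid n := by
        rcases List.mem_append.1 hL with hL | hL
        · obtain ⟨W, hW, e⟩ := hdomV L hL
          exact hset.dom_subset hW (e ▸ hp')
        · obtain ⟨W, hW, e⟩ := hdomSs L hL
          exact hgridS W hW (e ▸ hp')
      exact ⟨⟨hg.1, hg.2.1⟩, hg.2.2⟩
    · exact Or.inr (Or.inr ⟨rfl, L, hL, hne, rfl⟩)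
  have hVt : ∀ L ∈ Vs, IsTruncatedSubtile V.φ V.ψ (pts L) := fun L hL => by
    obtain ⟨W, hW, e⟩ := hdomV L hL
    exact e ▸ hset.subtiles W hW
  have hSt : ∀ L ∈ Ss, IsSubtile V.φ V.ψ (pts L) := fun L hL => by
    obtain ⟨W, hW, e⟩ := hdomSs L hL
    exact e ▸ hsub W hW
  have hrel : Rel V.Λ (startSt (encodeInput m n φ ψ Vs Ss Qs))
      (startState w (encodeInput m n φ ψ Vs Ss Qs)) := by
    refine rel_startSt (Λ := V.Λ) (fun i h => ?_)
      fun i h1 h2 => Or.inl ⟨rfl, h1, h2.trans hin⟩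
    rcases h with ⟨-, h1, h2⟩ | ⟨h1, -⟩ | ⟨h1, -⟩
    · exact ⟨h1, h2.trans_le hXw⟩
    · omega
    · omega
  have hwp := V.mainP_wp (σ := startSt (encodeInput m n φ ψ Vs Ss Qs)) (fun _ => rfl)
    (fun k hk => by funext i; simp [startSt, show k ≠ 0 by omega]) (seg_startSt _) hin hi rfl
    (fun L hL hne S hS hSne => Env.pairBounds hne hSne (hi.pts L (by simp [hL]))
      (hi.pts S (by simp [hS])))
    (fun q hq => hset.shift_bounds ((hQs.2 q).1 hq))
    (fun σ' h15 h11 => Env.spec V hi hVt hSt h15 h11)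
  obtain ⟨σ', τ', t, hex, ht, hrel', -, hout, htime⟩ := Sm.comp_exec V.Λ mainP 0 _ _ _ hrel hwp
  refine ⟨t, τ', hex, ?_, fun i hi' => ?_⟩
  · have h1 := totalTime_le V (Qs := Qs) hset.n_le ⟨hV1, hV2⟩ ⟨hS1, hS2⟩ hQ1
      (sum_stringTime_le V hVs hSs hset.chars hmono)
    have h2 : (startSt (encodeInput m n φ ψ Vs Ss Qs)).time = 0 := rfl
    exact (show t ≤ V.totalTime Vs Ss Qs by omega).trans h1
  · have hiX : (i : ℤ) < X := by
      have : (Qs.length : ℤ) ≤ n ^ 2 := by exact_mod_cast hQ1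
      omega
    have h1 := hrel'.2 0 i (Or.inl ⟨rfl, by omega, hiX⟩)
    have h2 : σ'.mem 0 i = ((∑ S ∈ 𝒮, ham (shift P Qs[i]) S : ℕ) : ℤ) := by
      rw [hout i hi', Env.out_eq]
      push_cast
      rw [← hSs.sum_eq (f := fun L => Env.window m L Qs[i] - Env.corr Vs L Qs[i])
        fun L S _ hS hLS => (ham_eq hset.dom_P hset.partition hset.chars hVs hLS
          (hmono S hS) _).symm, sum_map_sub]
    -- Memory is known only modulo `2 ^ w`; since the answer is at most `n ^ 2`, the word determines
    -- it.
    have h3 : ∑ S ∈ 𝒮, ham (shift P Qs[i]) S ≤ n ^ 2 :=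
      (Finset.sum_le_sum fun S hS => ham_le_ncard ((finite_grid n).subset (hgridS S hS))).trans
        (family_bound hdisj hgridS).1
    have h4 : ((∑ S ∈ 𝒮, ham (shift P Qs[i]) S : ℕ) : ℤ) ≤ n ^ 2 := by exact_mod_cast h3
    rw [h2] at h1
    have h5 : τ'.mem (BitVec.ofNat w i) =
        BitVec.ofInt w ((∑ S ∈ 𝒮, ham (shift P Qs[i]) S : ℕ) : ℤ) := by
      rw [← h1, addr, if_pos rfl, BitVec.ofInt_natCast]
    rw [h5, toNat_ofInt_nonneg (by positivity) (by omega), Int.toNat_natCast]
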